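/- **Setting.** Let $\mathcal T$ be a triangulated category with countable direct sums, let $\mathfrak I$ be a stable homological ideal in $\mathcal T$ (the kernel on morphisms of a stable homological functor to a stable Abelian category) that is compatible with countable direct sums and has enough projective objects, and let $F\colon\mathcal T\to\mathcal A$ be the universal $\mathfrak I$-exact stable homological functor. Assume that $\mathcal A$ is even: $\mathcal A=\mathcal A_+\times\mathcal A_-$ with $\mathcal A_+[-1]=\mathcal A_-$ and $\mathcal A_-[-1]=\mathcal A_+$; objects of $\mathcal A_+$ are called even. For projective $Q\in\mathcal A$ let $\hat Q\in\mathcal T$ be the object with $\mathcal T(\hat Q,B)\cong\mathcal A(Q,F(B))$ naturally in $B$, and for $f\colon Q\to R$ between projective objects let $\hat f\colon\hat Q\to\hat R$ be the induced morphism. A *lifting* of $M\in\mathcal A$ is an object $L\in\mathcal T$ with $\mathcal T(L,B)=0$ for all $\mathfrak I$-contractible $B$ (those with $\mathrm{id}_B\in\mathfrak I$), together with an isomorphism $F(L)\cong M$. Suppose that $M$ has a projective resolution $0\to P_2\to P_1\to P_0\to M\to0$; let $\Omega=\ker(P_0\to M)$ and let $D$ be a lifting of $\Omega$. Any lifting $L_i$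 of $M$ is part of an exact triangle $D\xrightarrow{\varphi_i}\hat P_0\to L_i\to D[1]$ where $\varphi_i$ lifts the inclusion $\Omega\to P_0$ and $\hat P_0\to L_i$ lifts $P_0\to M$. The *relative obstruction class* $\delta(L_2,L_1)\in\operatorname{Ext}^2_{\mathcal A}(M,M[-1])$ is the image of $\varphi_2-\varphi_1$ under $$\{f\in\mathcal T(D,\hat P_0): F(f)=0\}\to\operatorname{Ext}^1(\Omega,P_0[-1])\to\operatorname{Ext}^1(\Omega,M[-1])\cong\operatorname{Ext}^2(M,M[-1]).$$ Here the first map sends $f\colon D\to B$ with $F(f)=0$ to the class of the extension $F(B)[-1]\rightarrowtail F(Z)\twoheadrightarrow F(D)$ obtained from an exact triangle $B[-1]\to Z\to D\xrightarrow{f}B$, and the last map is the Yoneda product with the class of $\Omega\rightarrowtail P_0\twoheadrightarrow M$. The *canonical lifting* $L_0$ of $M$ is the direct sum of liftings of its even and odd parts, and the *obstruction class* of a lifting $L$ of $M$ is $\delta(L,L_0)$. An object $A\in\mathcal T$ satisfying the above vanishing condition is regarded as a lifting of $F(A)$ through $\mathrm{id}_{F(A)}$. **Theorem.** Let $$0\to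 M_1\xrightarrow{\partial_2}Q_1\xrightarrow{\partial_1}Q_0\xrightarrow{\varepsilon}M_0\to0\qquad(1)$$ be an exact chain complex in $\mathcal A$ with even projective objects $M_1,Q_1,Q_0$ (so $M_0$ is even as well), and let $\hat Q_1\xrightarrow{\hat\partial_1}\hat Q_0\xrightarrow{p}A\xrightarrow{r}\hat Q_1[1]$ be an exact triangle. (a) $\mathcal T(A,B)=0$ for all $\mathfrak I$-contractible $B$, and there is a unique isomorphism $F(A)\cong M_0\oplus M_1[1]$ that is compatible, through $F(p)$ and $F(r)$, with $M_0=\operatorname{coker}\partial_1$ and $M_1[1]=\ker(\partial_1[1])$. Under the induced isomorphism $$\operatorname{Ext}^2(F(A),F(A)[-1])\cong\operatorname{Ext}^2(M_0,M_0[-1])\oplus\operatorname{Ext}^2(M_0,M_1)\oplus\operatorname{Ext}^2(M_1[1],M_0[-1])\oplus\operatorname{Ext}^2(M_1[1],M_1),$$ the obstruction class of $A$ (which exists and does not depend on the choices in its definition) is $(0,[\,(1)\,],0,0)$, where $[\,(1)\,]\in\operatorname{Ext}^2(M_0,M_1)$ is the class of the $2$-step extension $(1)$. (b) Let $0\to M_1'\xrightarrow{\partial_2'}Q_1'\xrightarrow{\partial_1'}Q_0'\xrightarrow{\varepsilon'}M_0'\to0$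 be another exact chain complex in $\mathcal A$ with even projective objects $M_1',Q_1',Q_0'$, and let $A'$ be the cone of $\hat\partial_1'$. Then $A\cong A'$ in $\mathcal T$ if and only if there are isomorphisms $\varphi_1\colon M_1\to M_1'$, $\varphi_2\colon Q_1\oplus Q_0'\to Q_0\oplus Q_1'$, $\varphi_3\colon Q_0\oplus Q_0'\to Q_0\oplus Q_0'$ and $\varphi_4\colon M_0\to M_0'$ in $\mathcal A$ such that the diagram $$\begin{array}{ccccccc} M_1&\xrightarrow{(\partial_2,0)}&Q_1\oplus Q_0'&\xrightarrow{\partial_1\oplus\mathrm{id}}&Q_0\oplus Q_0'&\xrightarrow{(\varepsilon,0)}&M_0\\ \downarrow{\scriptstyle\varphi_1}&&\downarrow{\scriptstyle\varphi_2}&&\downarrow{\scriptstyle\varphi_3}&&\downarrow{\scriptstyle\varphi_4}\\ M_1'&\xrightarrow{(0,\partial_2')}&Q_0\oplus Q_1'&\xrightarrow{\mathrm{id}\oplus\partial_1'}&Q_0\oplus Q_0'&\xrightarrow{(0,\varepsilon')}&M_0' \end{array}$$ commutes. -/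

import Mathlib

open CategoryTheory Limits Pretriangulated Opposite Abelian

universe w u₁ v₁ u₂ v₂ u₃ v₃

namespace ObstructionClass

/-! ### Homological ideals in triangulated categories -/

section Ideals

variable {T : Type u₁} [Category.{v₁} T] [HasZeroObject T] [HasShift T ℤ] [Preadditive T]
  [∀ n : ℤ, (shiftFunctor T n).Additive] [Pretriangulated T]

/-- `I` is a stable homological ideal in `T`: the kernel on morphisms of a stable homological
functor to some stable Abelian category. -/
def IsStableHomologicalIdeal (I : MorphismProperty T) : Prop :=
  ∃ (C : Type u₂) (_ : Category.{v₂} C) (_ : Abelian C) (_ : HasShift C ℤ)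
    (_ : ∀ n : ℤ, (shiftFunctor C n).Additive)
    (H : T ⥤ C) (_ : H.CommShift ℤ) (_ : H.IsHomological),
    ∀ ⦃X Y : T⦄ (f : X ⟶ Y), I f ↔ H.map f = 0

/-- `I` is compatible with countable direct sums: a morphism out of a countable direct sum
belongs to `I` as soon as all its restrictions to the summands do.  (For an ideal this says that
`I (⨁ Xₙ, Y) = ∏ I (Xₙ, Y)`, or that countable direct sums of morphisms in `I` are in `I`.) -/
def CompatibleWithCountableSums [HasCountableCoproducts T] (I : MorphismProperty T) : Prop :=
  ∀ (J : Type) [Countable J] (X : J → T) (Y : T) (f : (∐ X) ⟶ Y),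
    (∀ j, I (Sigma.ι X j ≫ f)) → I f

/-- `P` is `I`-projective: the functor `T(P, -)` is `I`-exact, that is, it kills `I`. -/
def IsIdealProjective (I : MorphismProperty T) (P : T) : Prop :=
  ∀ ⦃X Y : T⦄ (f : X ⟶ Y), I f → ∀ g : P ⟶ X, g ≫ f = 0

/-- `f : X ⟶ Y` is an `I`-epimorphism: in an exact triangle `X ⟶ Y ⟶ Z ⟶ X[1]` on `f`, the
morphism `Y ⟶ Z` belongs to `I`. -/
def IsIdealEpi (I : MorphismProperty T) {X Y : T} (f : X ⟶ Y) : Prop :=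
  ∀ (Z : T) (g : Y ⟶ Z) (h : Z ⟶ X⟦(1 : ℤ)⟧), Triangle.mk f g h ∈ distTriang T → I g

/-- There are enough `I`-projective objects. -/
def HasEnoughIdealProjectives (I : MorphismProperty T) : Prop :=
  ∀ X : T, ∃ (P : T) (f : P ⟶ X), IsIdealProjective I P ∧ IsIdealEpi I f

/-- `B` is `I`-contractible: its identity morphism belongs to `I`. -/
def IsContractible (I : MorphismProperty T) (B : T) : Prop := I (𝟙 B)

/-- The orthogonality condition on liftings: there are no non-zero morphisms from `X` to
`I`-contractible objects. -/
def IsLeftOrthogonal (I : MorphismProperty T) (X : T) : Prop :=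
  ∀ B : T, IsContractible I B → ∀ f : X ⟶ B, f = 0

/-- A homological functor is `I`-exact if it kills `I`. -/
def IsIdealExact {A : Type u₂} [Category.{v₂} A] [Abelian A] (I : MorphismProperty T)
    (G : T ⥤ A) : Prop :=
  ∀ ⦃X Y : T⦄ (f : X ⟶ Y), I f → G.map f = 0

end Ideals

/-- A stable exact functor between stable Abelian categories. -/
structure IsStableExact {A : Type u₁} [Category.{v₁} A] [HasShift A ℤ]
    {C : Type u₂} [Category.{v₂} C] [HasShift C ℤ] (H : A ⥤ C) : Prop where
  finiteLimits : PreservesFiniteLimits H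
  finiteColimits : PreservesFiniteColimits H
  commShift : Nonempty (H.CommShift ℤ)

section Universal

variable {T : Type u₁} [Category.{v₁} T] [HasZeroObject T] [HasShift T ℤ] [Preadditive T]
  [∀ n : ℤ, (shiftFunctor T n).Additive] [Pretriangulated T]
  {A : Type u₂} [Category.{v₂} A] [Abelian A] [HasShift A ℤ]

/-- The stable homological functor `F : T ⥤ A` is the universal `I`-exact stable homological
functor: it is `I`-exact, and every `I`-exact stable homological functor `G : T ⥤ C` to a stable
Abelian category factors through `F` by a stable exact functor `A ⥤ C` that is unique up to
natural isomorphism.  The universe of the target `C` is large enough to contain copies of `A`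
and of all categories of additive functors on full subcategories of `T`. -/
structure IsUniversalExact (I : MorphismProperty T) (F : T ⥤ A) : Prop where
  exact : IsIdealExact I F
  exists_factorization : ∀ (C : Type (max u₁ v₁ u₂ v₂ + 1)) [Category.{max u₁ v₁ u₂ v₂} C]
    [Abelian C] [HasShift C ℤ] [∀ n : ℤ, (shiftFunctor C n).Additive]
    (G : T ⥤ C) [G.CommShift ℤ] [G.IsHomological], IsIdealExact I G →
    ∃ H : A ⥤ C, IsStableExact H ∧ Nonempty (F ⋙ H ≅ G)
  unique_factorization : ∀ (C : Type (max u₁ v₁ u₂ v₂ + 1)) [Category.{max u₁ v₁ u₂ v₂} C]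
    [Abelian C] [HasShift C ℤ] [∀ n : ℤ, (shiftFunctor C n).Additive]
    (G : T ⥤ C) [G.CommShift ℤ] [G.IsHomological], IsIdealExact I G →
    ∀ H H' : A ⥤ C, IsStableExact H → IsStableExact H' →
      Nonempty (F ⋙ H ≅ G) → Nonempty (F ⋙ H' ≅ G) → Nonempty (H ≅ H')

end Universal

/-! ### Parity -/

/-- An even stable Abelian category `A = A₊ × A₋` with `A₊[-1] = A₋` and `A₋[-1] = A₊`; the
two factors are given as full subcategories of `A`. -/
structure ParityDecomposition (A : Type u₂) [Category.{v₂} A] [Abelian A] [HasShift A ℤ] where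
  /-- the objects of `A₊` -/
  even : ObjectProperty A
  /-- the objects of `A₋` -/
  odd : ObjectProperty A
  even_of_iso : ∀ {X Y : A}, (X ≅ Y) → even X → even Y
  odd_of_iso : ∀ {X Y : A}, (X ≅ Y) → odd X → odd Y
  even_odd_zero : ∀ {X Y : A}, even X → odd Y → ∀ f : X ⟶ Y, f = 0
  odd_even_zero : ∀ {X Y : A}, odd X → even Y → ∀ f : X ⟶ Y, f = 0
  exists_decomposition : ∀ X : A, ∃ Xe Xo : A, even Xe ∧ odd Xo ∧ Nonempty (X ≅ Xe ⊞ Xo)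
  even_iff : ∀ X : A, even X ↔ odd (X⟦(-1 : ℤ)⟧)
  odd_iff : ∀ X : A, odd X ↔ even (X⟦(-1 : ℤ)⟧)

/-! ### Two-step extensions and their Yoneda classes -/

/-- An exact complex `0 ⟶ M₁ ⟶ Q₁ ⟶ Q₀ ⟶ M₀ ⟶ 0`. -/
structure TwoStepExtension {A : Type u₂} [Category.{v₂} A] [Abelian A] (M₁ M₀ : A) where
  Q₁ : A
  Q₀ : A
  d₂ : M₁ ⟶ Q₁
  d₁ : Q₁ ⟶ Q₀
  ε : Q₀ ⟶ M₀
  d₂_d₁ : d₂ ≫ d₁ = 0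
  d₁_ε : d₁ ≫ ε = 0
  mono_d₂ : Mono d₂
  exact₁ : (ShortComplex.mk d₂ d₁ d₂_d₁).Exact
  exact₀ : (ShortComplex.mk d₁ ε d₁_ε).Exact
  epi_ε : Epi ε

namespace TwoStepExtension

variable {A : Type u₂} [Category.{v₂} A] [Abelian A] {M₁ M₀ : A} (S : TwoStepExtension M₁ M₀)

/-- The syzygy, `ker ε = im d₁ ≅ coker d₂`. -/
noncomputable def syzygy : A := kernel S.ε

/-- The inclusion `ker ε ⟶ Q₀`. -/
noncomputable def ι : S.syzygy ⟶ S.Q₀ := kernel.ι S.ε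

/-- The surjection `Q₁ ⟶ ker ε` induced by `d₁`. -/
noncomputable def π : S.Q₁ ⟶ S.syzygy := kernel.lift S.ε S.d₁ S.d₁_ε

lemma π_ι : S.π ≫ S.ι = S.d₁ := kernel.lift_ι _ _ _

lemma ι_ε : S.ι ≫ S.ε = 0 := kernel.condition _

lemma d₂_π : S.d₂ ≫ S.π = 0 := by
  have : Mono S.ι := inferInstanceAs (Mono (kernel.ι S.ε))
  rw [← cancel_mono S.ι, Category.assoc, π_ι, d₂_d₁, zero_comp]

/-- `0 ⟶ ker ε ⟶ Q₀ ⟶ M₀ ⟶ 0` is exact. -/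
lemma shortExact₀ : (ShortComplex.mk S.ι S.ε S.ι_ε).ShortExact := by
  have := S.epi_ε
  have : Mono S.ι := inferInstanceAs (Mono (kernel.ι S.ε))
  exact { exact := ShortComplex.exact_of_f_is_kernel _ (kernelIsKernel S.ε) }

/-- `0 ⟶ M₁ ⟶ Q₁ ⟶ ker ε ⟶ 0` is exact. -/
lemma shortExact₁ : (ShortComplex.mk S.d₂ S.π S.d₂_π).ShortExact := by
  have := S.mono_d₂
  have : Mono S.ι := inferInstanceAs (Mono (kernel.ι S.ε))
  have : Epi S.π := S.exact₀.epi_kernelLift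
  refine { exact := ?_ }
  let φ : ShortComplex.mk S.d₂ S.π S.d₂_π ⟶ ShortComplex.mk S.d₂ S.d₁ S.d₂_d₁ :=
    { τ₁ := 𝟙 _, τ₂ := 𝟙 _, τ₃ := S.ι, comm₂₃ := by simp [π_ι] }
  have : Epi φ.τ₁ := inferInstanceAs (Epi (𝟙 M₁))
  have : IsIso φ.τ₂ := inferInstanceAs (IsIso (𝟙 S.Q₁))
  have : Mono φ.τ₃ := inferInstanceAs (Mono S.ι)
  exact (ShortComplex.exact_iff_of_epi_of_isIso_of_mono φ).2 S.exact₁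

/-- The class of the two-step extension in `Ext²(M₀, M₁)`, the Yoneda product (splice) of the
classes of its two short exact pieces. -/
noncomputable def extClass [HasExt.{w} A] : Ext M₀ M₁ 2 :=
  S.shortExact₀.extClass.comp S.shortExact₁.extClass (by norm_num)

end TwoStepExtension

/-! ### The partial left adjoint on objects, liftings, and obstruction classes -/

section Obstruction

variable {T : Type u₁} [Category.{v₁} T]
  {A : Type u₂} [Category.{v₂} A]

/-- A value at `Q` of the partially defined left adjoint of `F`: an object `Q̂` of `T` with a
natural bijection `T(Q̂, X) ≃ A(Q, F X)`. -/
structure AdjointObj (F : T ⥤ A) (Q : A) where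
  obj : T
  corep : (F ⋙ coyoneda.obj (op Q)).CorepresentableBy obj

namespace AdjointObj

variable {F : T ⥤ A} {Q R : A}

/-- The bijection `T(Q̂, X) ≃ A(Q, F X)`. -/
def adj (Q' : AdjointObj F Q) (X : T) : (Q'.obj ⟶ X) ≃ (Q ⟶ F.obj X) := Q'.corep.homEquiv

/-- The canonical morphism `Q ⟶ F Q̂`. -/
def unit (Q' : AdjointObj F Q) : Q ⟶ F.obj Q'.obj := Q'.adj _ (𝟙 _)

/-- The partial left adjoint on morphisms: the morphism `f̂ : Q̂ ⟶ R̂` that lifts `f : Q ⟶ R`. -/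
def map (Q' : AdjointObj F Q) (R' : AdjointObj F R) (f : Q ⟶ R) : Q'.obj ⟶ R'.obj :=
  (Q'.adj _).symm (f ≫ R'.unit)

end AdjointObj

variable [HasZeroObject T] [HasShift T ℤ] [Preadditive T]
  [∀ n : ℤ, (shiftFunctor T n).Additive] [Pretriangulated T]
  [Abelian A] [HasShift A ℤ]

/-- A lifting of `M`: an object of `T`, orthogonal to the `I`-contractible objects, with an
isomorphism `F obj ≅ M`. -/
structure Lifting (I : MorphismProperty T) (F : T ⥤ A) (M : A) where
  obj : T
  orthogonal : IsLeftOrthogonal I obj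
  iso : F.obj obj ≅ M

variable [HasExt.{w} A]

/-- For `f : D ⟶ B` in `T` with `F f = 0`, `x` is the class in `Ext¹(F D, (F B)[-1])` that the
Universal Coefficient Theorem attaches to `f`: if `B[-1] ⟶ Z ⟶ D ⟶ B` is an exact triangle with
last map `f`, then `x` is the class of the extension `(F B)[-1] ↣ F Z ↠ F D`. -/
def IsUCTClass (F : T ⥤ A) [F.CommShift ℤ] {D B : T} (f : D ⟶ B)
    (x : Ext (F.obj D) ((F.obj B)⟦(-1 : ℤ)⟧) 1) : Prop :=
  ∃ (Z : T) (i : B⟦(-1 : ℤ)⟧ ⟶ Z) (q : Z ⟶ D)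
    (_ : Triangle.mk i q
      (f ≫ (shiftFunctorCompIsoId T (-1 : ℤ) 1 (by norm_num)).inv.app B) ∈ distTriang T)
    (zero : F.map i ≫ F.map q = 0)
    (h : (ShortComplex.mk (F.map i) (F.map q) zero).ShortExact),
    x = h.extClass.comp (Ext.mk₀ ((F.commShiftIso (-1 : ℤ)).hom.app B)) (add_zero 1)

/-- `c ∈ Ext²(M, M[-1])` is the relative obstruction class `δ(L₂, L₁)` of two liftings of `M`.
Given a length-two projective resolution `P₂ ↣ P₁ ⟶ P₀ ↠ M` with syzygy `Ω = ker (P₀ ⟶ M)` and a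
lifting `D` of `Ω`, write `Lᵢ` as the cone of `φᵢ : D ⟶ P̂₀`, where `φᵢ` lifts the inclusion
`Ω ⟶ P₀` and `P̂₀ ⟶ Lᵢ` lifts `P₀ ⟶ M`.  Then `δ(L₂, L₁)` is the image of `φ₂ - φ₁` under
`T(D, P̂₀) ⊇ Ext¹(Ω, P₀[-1]) ⟶ Ext¹(Ω, M[-1]) ≅ Ext²(M, M[-1])`, where the last map is the
Yoneda product with the class of `Ω ↣ P₀ ↠ M`. -/
def IsRelativeObstructionClass (I : MorphismProperty T) (F : T ⥤ A) [F.CommShift ℤ] {M : A}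
    (L₂ L₁ : Lifting I F M) (c : Ext M (M⟦(-1 : ℤ)⟧) 2) : Prop :=
  ∃ (P₂ : A) (R : TwoStepExtension P₂ M)
    (_ : Projective P₂) (_ : Projective R.Q₁) (_ : Projective R.Q₀)
    (P : AdjointObj F R.Q₀) (D : Lifting I F R.syzygy)
    (φ₁ φ₂ : D.obj ⟶ P.obj)
    (p₁ : P.obj ⟶ L₁.obj) (r₁ : L₁.obj ⟶ D.obj⟦(1 : ℤ)⟧)
    (p₂ : P.obj ⟶ L₂.obj) (r₂ : L₂.obj ⟶ D.obj⟦(1 : ℤ)⟧)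
    (x : Ext (F.obj D.obj) ((F.obj P.obj)⟦(-1 : ℤ)⟧) 1),
    Triangle.mk φ₁ p₁ r₁ ∈ distTriang T ∧
    Triangle.mk φ₂ p₂ r₂ ∈ distTriang T ∧
    F.map φ₁ = D.iso.hom ≫ R.ι ≫ P.unit ∧
    F.map φ₂ = D.iso.hom ≫ R.ι ≫ P.unit ∧
    P.unit ≫ F.map p₁ ≫ L₁.iso.hom = R.ε ∧
    P.unit ≫ F.map p₂ ≫ L₂.iso.hom = R.ε ∧
    IsUCTClass F (φ₂ - φ₁) x ∧
    c = R.shortExact₀.extClass.comp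
      ((Ext.mk₀ D.iso.inv).comp
        (x.comp (Ext.mk₀ ((F.map p₁ ≫ L₁.iso.hom)⟦(-1 : ℤ)⟧')) (add_zero 1))
        (zero_add 1))
      (by norm_num)

/-- `L₀` is the canonical lifting of `M`: the direct sum of liftings of the even and the odd
part of `M`. -/
def IsCanonicalLifting (E : ParityDecomposition A) (I : MorphismProperty T) (F : T ⥤ A) {M : A}
    (L₀ : Lifting I F M) : Prop :=
  ∃ (Me Mo : A) (s : M ≅ Me ⊞ Mo) (Le : Lifting I F Me) (Lo : Lifting I F Mo)
    (b : Le.obj ⊞ Lo.obj ≅ L₀.obj),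
    E.even Me ∧ E.odd Mo ∧
    F.map (biprod.inl ≫ b.hom) ≫ L₀.iso.hom ≫ s.hom = Le.iso.hom ≫ biprod.inl ∧
    F.map (biprod.inr ≫ b.hom) ≫ L₀.iso.hom ≫ s.hom = Lo.iso.hom ≫ biprod.inr

/-- `c ∈ Ext²(M, M[-1])` is the obstruction class `δ(L) = δ(L, L₀)` of the lifting `L` of `M`,
where `L₀` is the canonical lifting of `M`. -/
def IsObstructionClass (E : ParityDecomposition A) (I : MorphismProperty T) (F : T ⥤ A)
    [F.CommShift ℤ] {M : A} (L : Lifting I F M) (c : Ext M (M⟦(-1 : ℤ)⟧) 2) : Prop :=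
  ∃ L₀ : Lifting I F M, IsCanonicalLifting E I F L₀ ∧ IsRelativeObstructionClass I F L L₀ c

end Obstruction

/-! ### The four summands of `Ext²(N, N[-1])` for `N ≅ M₀ ⊞ M₁[1]` -/

section FourSummands

variable {A : Type u₂} [Category.{v₂} A] [Abelian A] [HasShift A ℤ]
  [∀ n : ℤ, (shiftFunctor A n).Additive]

/-- The isomorphism `N[-1] ≅ M₀[-1] ⊞ M₁` induced by `e : N ≅ M₀ ⊞ M₁[1]`. -/
noncomputable def shiftSplitting {N M₀ M₁ : A} (e : N ≅ M₀ ⊞ M₁⟦(1 : ℤ)⟧) :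
    N⟦(-1 : ℤ)⟧ ≅ M₀⟦(-1 : ℤ)⟧ ⊞ M₁ :=
  have := preservesBinaryBiproducts_of_preservesBiproducts (shiftFunctor A (-1 : ℤ))
  (shiftFunctor A (-1 : ℤ)).mapIso e ≪≫ (shiftFunctor A (-1 : ℤ)).mapBiprod _ _ ≪≫
    biprod.mapIso (Iso.refl _) ((shiftFunctorCompIsoId A (1 : ℤ) (-1) (by norm_num)).app M₁)

/-- An isomorphism in both variables induces an isomorphism on `Ext`. -/
noncomputable def extCongr [HasExt.{w} A] {X X' Y Y' : A} (e : X ≅ X') (f : Y ≅ Y') (n : ℕ) :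
    Ext X Y n ≃+ Ext X' Y' n where
  toFun a := (Ext.mk₀ e.inv).comp (a.comp (Ext.mk₀ f.hom) (add_zero n)) (zero_add n)
  invFun a := (Ext.mk₀ e.hom).comp (a.comp (Ext.mk₀ f.inv) (add_zero n)) (zero_add n)
  left_inv a := by simp
  right_inv a := by simp
  map_add' a b := by simp

/-- The isomorphism
`Ext²(N, N[-1]) ≅ Ext²(M₀, M₀[-1]) ⊕ Ext²(M₀, M₁) ⊕ Ext²(M₁[1], M₀[-1]) ⊕ Ext²(M₁[1], M₁)`
induced by `e : N ≅ M₀ ⊞ M₁[1]`. -/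
noncomputable def extFourSummands [HasExt.{w} A] {N M₀ M₁ : A} (e : N ≅ M₀ ⊞ M₁⟦(1 : ℤ)⟧) :
    Ext N (N⟦(-1 : ℤ)⟧) 2 ≃+
      (Ext M₀ (M₀⟦(-1 : ℤ)⟧) 2 × Ext M₀ M₁ 2) ×
        (Ext (M₁⟦(1 : ℤ)⟧) (M₀⟦(-1 : ℤ)⟧) 2 × Ext (M₁⟦(1 : ℤ)⟧) M₁ 2) :=
  ((extCongr e (shiftSplitting e) 2).trans Ext.biprodAddEquiv).trans
    (Ext.addEquivBiprod.prodCongr Ext.addEquivBiprod)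

end FourSummands

/-! ### The cone of a lifted morphism -/

section Cone

variable {T : Type u₁} [Category.{v₁} T] [HasShift T ℤ]
  {A : Type u₂} [Category.{v₂} A] [Abelian A] [HasShift A ℤ] {M₁ M₀ : A}

/-- For an exact triangle `Q̂₁ ⟶ Q̂₀ ⟶ X ⟶ Q̂₁[1]` with maps `d̂₁`, `p`, `r`, the isomorphism
`e : F X ≅ M₀ ⊞ M₁[1]` is compatible with the identification of `coker d₁` with `M₀`, as a
subobject of `F X` through `F p`, and of `ker (d₁[1])` with `M₁[1]`, as a quotient of `F X`
through `F r`. -/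
def IsConeSplitting (F : T ⥤ A) [F.CommShift ℤ] (S : TwoStepExtension M₁ M₀)
    (Q₁' : AdjointObj F S.Q₁) (Q₀' : AdjointObj F S.Q₀) {X : T} (p : Q₀'.obj ⟶ X)
    (r : X ⟶ Q₁'.obj⟦(1 : ℤ)⟧) (e : F.obj X ≅ M₀ ⊞ M₁⟦(1 : ℤ)⟧) : Prop :=
  Q₀'.unit ≫ F.map p ≫ e.hom = S.ε ≫ biprod.inl ∧
  e.hom ≫ biprod.snd ≫ S.d₂⟦(1 : ℤ)⟧' ≫ Q₁'.unit⟦(1 : ℤ)⟧' =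
    F.map r ≫ (F.commShiftIso (1 : ℤ)).hom.app Q₁'.obj

end Cone

end ObstructionClass

/-! For (a), let Ω be the image of ∂₁ and let D be the cone of ∂̂₂, with connecting morphism d : D →
M̂₁[1]. Since F(∂̂₂) is monic, D lifts Ω and F(d) = 0, and the Ext¹ class of d is the extension M₁ ↣
Q₁ ↠ Ω (`uctClass_connecting`). The morphism ∂̂₁ factors through some ψ : D → Q̂₀ that lifts the
inclusion Ω → Q₀. Adding the projective summand M₁[1] to Q₀ turns (1) into a resolution of F(A) ≅ M₀
⊕ M₁[1] with the same syzygy Ω. By the octahedral axiom A is the cone of (ψ, d) : D → Q̂₀ ⊕ M̂₁[1],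
while the cone of (ψ, 0) is a canonical lifting. The two morphisms differ by d in the second
coordinate, so the relative class is the splice of M₁ ↣ Q₁ ↠ Ω with Ω ↣ Q₀ ↠ M₀, placed in Ext²(M₀,
M₁) (`exists_obstructionClass_cone`). Independence of all choices follows from naturality of
relative classes (`IsRelativeObstructionClass.naturality`) and from a comparison morphism to any
other canonical lifting, which exists by parity (`exists_hom_canonicalLifting`).

For (b), A is also the cone of ∂̂₁ ⊕ id and A' that of id ⊕ ∂̂₁'. An isomorphism between these two
morphisms in the Abelian category lifts to the triangulated one and yields A ≅ A'. Conversely, A ≅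
A' restricts to M₀ ≅ M₀' by parity, Schanuel's lemma extends this to Q₀ ⊕ Q₀', and completing a
morphism of triangles supplies the rest.

All this needs three facts about F: it is bijective on morphisms out of an I-projective P, it sends
P to a projective object, and such images present every object. They are extracted from the
universal property, which speaks only of stable functors into categories of one fixed large
universe. Graded objects remove stability; gluing with large Abelian groups adjusts the universe.
The first two facts come from factoring X ↦ (T(P, X) → A(F P, F X)) through F, the third from
factoring F through its presented objects. Countable sums split idempotents, which makes Q̂ exist
for every projective Q. -/

open scoped ZeroObject

namespace ObstructionClass

/-! ### Graded objects over an Abelian category -/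

section Graded

variable {C : Type u} [Category.{v} C]

noncomputable instance gradedPreadditive [Preadditive C] : Preadditive (GradedObject ℤ C) where
  homGroup X Y := inferInstanceAs (AddCommGroup (∀ i, X i ⟶ Y i))
  add_comp X Y Z f f' g := by
    funext i
    exact Preadditive.add_comp _ _ _ (f i) (f' i) (g i)
  comp_add X Y Z f g g' := by
    funext i
    exact Preadditive.comp_add _ _ _ (f i) (g i) (g' i)

instance gradedHasFiniteLimits [HasFiniteLimits C] : HasFiniteLimits (GradedObject ℤ C) where
  out _ _ _ := Adjunction.hasLimitsOfShape_of_equivalence (piEquivalenceFunctorDiscrete ℤ C).functor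

noncomputable instance gradedAbelian [Abelian C] : Abelian (GradedObject ℤ C) :=
  abelianOfEquivalence (piEquivalenceFunctorDiscrete ℤ C).functor

instance gradedEval_preservesFiniteLimits [Abelian C] (i : ℤ) :
    PreservesFiniteLimits (GradedObject.eval i : GradedObject ℤ C ⥤ C) :=
  inferInstanceAs (PreservesFiniteLimits
    ((piEquivalenceFunctorDiscrete ℤ C).functor ⋙ (evaluation _ _).obj ⟨i⟩))

instance gradedEval_preservesFiniteColimits [Abelian C] (i : ℤ) :
    PreservesFiniteColimits (GradedObject.eval i : GradedObject ℤ C ⥤ C) :=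
  inferInstanceAs (PreservesFiniteColimits
    ((piEquivalenceFunctorDiscrete ℤ C).functor ⋙ (evaluation _ _).obj ⟨i⟩))

instance gradedShift_additive [Preadditive C] (n : ℤ) :
    (shiftFunctor (GradedObjectWithShift (1 : ℤ) C) n).Additive where
  map_add := rfl

end Graded
-- Detecting exactness by exact functors
section JointlyFaithful

/-- A family of exact functors that jointly detects zero morphisms detects exactness. -/
lemma exact_of_jointly_faithful {C : Type*} [Category C] [Abelian C] {ι : Type*} {D : ι → Type*}
    [∀ i, Category (D i)] [∀ i, Abelian (D i)] (E : ∀ i, C ⥤ D i)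
    [∀ i, PreservesFiniteLimits (E i)] [∀ i, PreservesFiniteColimits (E i)]
    [∀ i, (E i).PreservesZeroMorphisms]
    (hE : ∀ ⦃X Y : C⦄ (f : X ⟶ Y), (∀ i, (E i).map f = 0) → f = 0)
    (S : ShortComplex C) (hS : ∀ i, (S.map (E i)).Exact) : S.Exact := by
  -- Exactness becomes the vanishing of one morphism, the identity of the homology, and exact
  -- functors commute with homology.
  rw [ShortComplex.exact_iff_isZero_homology, IsZero.iff_id_eq_zero]
  refine hE _ fun i => ?_
  have h := (ShortComplex.exact_iff_isZero_homology _).1 (hS i)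
  exact (h.of_iso (S.mapHomologyIso (E i)).symm).eq_of_src _ _

end JointlyFaithful

/-! ### Making functors stable by passing to graded objects -/

section GradedFunctor

variable {A : Type u₂} [Category.{v₂} A] [HasShift A ℤ] {C : Type u} [Category.{v} C]

/-- The graded functor `M ↦ (H (M[n]))ₙ`. -/
def gradedFunctor (H : A ⥤ C) : A ⥤ GradedObjectWithShift (1 : ℤ) C where
  obj M := fun n => H.obj (M⟦n⟧)
  map f := fun n => H.map (f⟦n⟧')
  map_id M := by funext n; simp
  map_comp f g := by funext n; simp

lemma gradedShift_zero_inv_app (X : GradedObjectWithShift (1 : ℤ) C) (n : ℤ) :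
    (shiftFunctorZero (GradedObjectWithShift (1 : ℤ) C) ℤ).inv.app X n = eqToHom (by
      change X n = X (n + (0 : ℤ) • (1 : ℤ)); simp) := by
  exact Category.id_comp _

lemma gradedShift_add_inv_app (X : GradedObjectWithShift (1 : ℤ) C) (a b n : ℤ) :
    (shiftFunctorAdd (GradedObjectWithShift (1 : ℤ) C) a b).inv.app X n = eqToHom (by
      change X (n + b • (1 : ℤ) + a • (1 : ℤ)) = X (n + (a + b) • (1 : ℤ)); congr 1; simp; ring) := by
  exact Category.id_comp _

/-- The graded functor commutes with shifts. -/
def gradedFunctorIso (H : A ⥤ C) (a : ℤ) :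
    shiftFunctor A a ⋙ gradedFunctor H ≅
      gradedFunctor H ⋙ shiftFunctor (GradedObjectWithShift (1 : ℤ) C) a :=
  NatIso.ofComponents (fun M => GradedObject.isoMk _ _ fun n =>
    H.mapIso ((shiftFunctorAdd' A a n (n + a • (1 : ℤ)) (by simp; ring)).symm.app M))
    (fun {M N} f => by
      funext n
      change H.map ((f⟦a⟧')⟦n⟧') ≫ H.map _ = H.map _ ≫ H.map (f⟦n + a • (1 : ℤ)⟧')
      rw [← H.map_comp, ← H.map_comp]
      congr 1
      exact (shiftFunctorAdd' A a n (n + a • (1 : ℤ)) (by simp; ring)).inv.naturality f)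

/-- The degree `k` is kept free so that the coherence conditions can be checked with whichever form
of the degree is convenient; `eqToHom` absorbs the difference. -/
lemma gradedFunctorIso_hom_app (H : A ⥤ C) (a : ℤ) (M : A) (n k : ℤ) (hk : k = n + a • (1 : ℤ)) :
    (gradedFunctorIso H a).hom.app M n =
      H.map ((shiftFunctorAdd' A a n k (by simp [hk]; ring)).inv.app M) ≫
        eqToHom (by subst hk; rfl) := by
  subst hk
  exact (Category.comp_id _).symm

noncomputable instance gradedFunctorCommShift (H : A ⥤ C) : (gradedFunctor H).CommShift ℤ where
  commShiftIso := gradedFunctorIso H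
  commShiftIso_zero := by
    ext M n
    rw [gradedFunctorIso_hom_app H 0 M n n (by simp), Functor.CommShift.isoZero_hom_app]
    change _ = H.map (((shiftFunctorZero A ℤ).hom.app M)⟦n⟧') ≫ _
    rw [gradedShift_zero_inv_app, shiftFunctorAdd'_zero_add_inv_app]
    rfl
  commShiftIso_add a b := by
    ext M n
    have hb : b + n = n + b • (1 : ℤ) := by simp; ring
    have ha : a + (n + b • (1 : ℤ)) = n + b • (1 : ℤ) + a • (1 : ℤ) := by simp; ring
    rw [gradedFunctorIso_hom_app H (a + b) M n (n + b • (1 : ℤ) + a • (1 : ℤ)) (by simp; ring),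
      Functor.CommShift.isoAdd_hom_app]
    -- This is associativity of the shifts by `a`, `b` and `n`, seen through `H`; what remains
    -- afterwards is a comparison of `eqToHom` morphisms.
    have key : H.map ((shiftFunctorAdd' A (a + b) n (n + b • (1 : ℤ) + a • (1 : ℤ))
        (by simp; ring)).inv.app M) = H.map (((shiftFunctorAdd A a b).hom.app M)⟦n⟧') ≫
        H.map ((shiftFunctorAdd' A b n _ hb).inv.app (M⟦a⟧)) ≫
        H.map ((shiftFunctorAdd' A a _ _ ha).inv.app M) := by
      rw [← H.map_comp, ← H.map_comp, ← shiftFunctorAdd'_assoc_inv_app a b n (a + b) _ _ rfl hb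
        (by simp; ring) M, shiftFunctorAdd'_eq_shiftFunctorAdd, ← Functor.map_comp_assoc]
      simp
    refine (congrArg (fun t => t ≫ eqToHom _) key).trans ?_
    refine (Category.assoc _ _ _).trans (congrArg (fun t => _ ≫ t) ?_)
    refine (Category.assoc _ _ _).trans (congrArg (fun t => _ ≫ t) (congrArg (fun t => _ ≫ t) ?_))
    exact (gradedShift_add_inv_app ((gradedFunctor H).obj M) a b n).symm

instance gradedFunctor_preservesFiniteLimits [Abelian C] (H : A ⥤ C) [PreservesFiniteLimits H] :
    PreservesFiniteLimits (gradedFunctor H) := by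
  have : PreservesFiniteLimits
      (gradedFunctor H ⋙ (piEquivalenceFunctorDiscrete ℤ C).functor) := ⟨fun J _ _ =>
    preservesLimitsOfShape_of_evaluation _ _ fun ⟨k⟩ =>
      inferInstanceAs (PreservesLimitsOfShape J (shiftFunctor A k ⋙ H))⟩
  exact ⟨fun J _ _ => preservesLimitsOfShape_of_reflects_of_preserves (gradedFunctor H)
    (piEquivalenceFunctorDiscrete ℤ C).functor⟩

instance gradedFunctor_preservesFiniteColimits [Abelian C] (H : A ⥤ C)
    [PreservesFiniteColimits H] : PreservesFiniteColimits (gradedFunctor H) := by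
  have : PreservesFiniteColimits
      (gradedFunctor H ⋙ (piEquivalenceFunctorDiscrete ℤ C).functor) := ⟨fun J _ _ =>
    preservesColimitsOfShape_of_evaluation _ _ fun ⟨k⟩ =>
      inferInstanceAs (PreservesColimitsOfShape J (shiftFunctor A k ⋙ H))⟩
  exact ⟨fun J _ _ => preservesColimitsOfShape_of_reflects_of_preserves (gradedFunctor H)
    (piEquivalenceFunctorDiscrete ℤ C).functor⟩

lemma isStableExact_gradedFunctor [Abelian C] (H : A ⥤ C) [PreservesFiniteLimits H]
    [PreservesFiniteColimits H] : IsStableExact (gradedFunctor H) :=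
  ⟨inferInstance, inferInstance, ⟨inferInstance⟩⟩

end GradedFunctor

section GradedHomological

variable {T : Type u₁} [Category.{v₁} T] [HasZeroObject T] [HasShift T ℤ] [Preadditive T]
  [∀ n : ℤ, (shiftFunctor T n).Additive] [Pretriangulated T]
  {C : Type u} [Category.{v} C] [Abelian C]

/-- In degree `n` the exactness required is that of the long exact sequence of `G` at its `n`-th
place. -/
instance gradedFunctor_isHomological (G : T ⥤ C) [G.IsHomological] :
    (gradedFunctor G).IsHomological where
  map_zero X Y := by
    ext n
    exact (congrArg G.map (Functor.map_zero _ _ _)).trans (G.map_zero _ _)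
  exact Δ hΔ := by
    have : (gradedFunctor G).PreservesZeroMorphisms := ⟨fun X Y => by
      ext n
      exact (congrArg G.map (Functor.map_zero _ _ _)).trans (G.map_zero _ _)⟩
    refine exact_of_jointly_faithful (fun n : ℤ => (GradedObject.eval n : GradedObject ℤ C ⥤ C))
      (fun X Y f hf => by ext n; exact hf n) _ fun n => ?_
    let _ := Functor.ShiftSequence.tautological G ℤ
    exact G.homologySequence_exact₂ Δ hΔ n

end GradedHomological
-- Abelian comma categories
lemma isIso_comma {B : Type*} [Category B] {D : Type*} [Category D] {V : Type*} [Category V]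
    (L : B ⥤ V) (R : D ⥤ V) {X Y : Comma L R} (f : X ⟶ Y) (hl : IsIso f.left)
    (hr : IsIso f.right) : IsIso f := by
  have h : f = (Comma.isoMk (asIso f.left) (asIso f.right) f.w).hom := by ext <;> rfl
  rw [h]
  infer_instance

section CommaAbelian

variable {B : Type*} [Category B] [Abelian B] {D : Type*} [Category D] [Abelian D]
  {V : Type*} [Category V] [Abelian V] (L : B ⥤ V) (R : D ⥤ V)

instance comma_preservesFiniteLimits_fst [PreservesFiniteLimits R] :
    PreservesFiniteLimits (Comma.fst L R) where
  preservesFiniteLimits _ _ _ := ⟨fun {K} =>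
    preservesLimit_of_preserves_limit_cone
      (Comma.coneOfPreservesIsLimit K (limit.isLimit _) (limit.isLimit _)) (limit.isLimit _)⟩

instance comma_preservesFiniteLimits_snd [PreservesFiniteLimits R] :
    PreservesFiniteLimits (Comma.snd L R) where
  preservesFiniteLimits _ _ _ := ⟨fun {K} =>
    preservesLimit_of_preserves_limit_cone
      (Comma.coneOfPreservesIsLimit K (limit.isLimit _) (limit.isLimit _)) (limit.isLimit _)⟩

instance comma_preservesFiniteColimits_fst [PreservesFiniteColimits L] :
    PreservesFiniteColimits (Comma.fst L R) where
  preservesFiniteColimits _ _ _ := inferInstance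

instance comma_preservesFiniteColimits_snd [PreservesFiniteColimits L] :
    PreservesFiniteColimits (Comma.snd L R) where
  preservesFiniteColimits _ _ _ := inferInstance

/-- The comma category of a right exact and a left exact functor is Abelian. -/
noncomputable instance commaAbelian [L.Additive] [R.Additive] [PreservesFiniteColimits L]
    [PreservesFiniteLimits R] : Abelian (Comma L R) := by
  have : HasFiniteProducts (Comma L R) := hasFiniteProducts_of_hasFiniteLimits _
  -- Both projections are exact and together they reflect isomorphisms, so the comparison of coimage
  -- and image can be tested in `B` and `D`.
  have (X Y : Comma L R) (f : X ⟶ Y) : IsIso (Abelian.coimageImageComparison f) := by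
    have hl : IsIso ((Comma.fst L R).map (Abelian.coimageImageComparison f)) :=
      (Arrow.isIso_iff_isIso_of_isIso
        (Abelian.PreservesCoimageImageComparison.iso (Comma.fst L R) f).hom).2 inferInstance
    have hr : IsIso ((Comma.snd L R).map (Abelian.coimageImageComparison f)) :=
      (Arrow.isIso_iff_isIso_of_isIso
        (Abelian.PreservesCoimageImageComparison.iso (Comma.snd L R) f).hom).2 inferInstance
    exact isIso_comma L R _ hl hr
  exact Abelian.ofCoimageImageComparisonIsIso

lemma comma_exact [L.Additive] [R.Additive] [PreservesFiniteColimits L]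
    [PreservesFiniteLimits R] (S : ShortComplex (Comma L R))
    (hl : (S.map (Comma.fst L R)).Exact) (hr : (S.map (Comma.snd L R)).Exact) : S.Exact := by
  rw [ShortComplex.exact_iff_isZero_homology, IsZero.iff_id_eq_zero] at *
  ext
  · exact (((IsZero.iff_id_eq_zero _).2 hl).of_iso
      (S.mapHomologyIso (Comma.fst L R)).symm).eq_of_src _ _
  · exact (((IsZero.iff_id_eq_zero _).2 hr).of_iso
      (S.mapHomologyIso (Comma.snd L R)).symm).eq_of_src _ _

end CommaAbelian

/-! ### The universal property without stability -/

section Unstable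

variable {T : Type u₁} [Category.{v₁} T] [HasZeroObject T] [HasShift T ℤ] [Preadditive T]
  [∀ n : ℤ, (shiftFunctor T n).Additive] [Pretriangulated T]
  {A : Type u₂} [Category.{v₂} A] [Abelian A] [HasShift A ℤ]

lemma isHomological_comp_exact {A' : Type*} [Category A'] [Abelian A'] {C : Type*} [Category C]
    [Abelian C] (F : T ⥤ A') [F.IsHomological] (H : A' ⥤ C) [PreservesFiniteLimits H]
    [PreservesFiniteColimits H] : (F ⋙ H).IsHomological := by
  have := preservesBinaryBiproducts_of_preservesBinaryProducts H
  have : H.Additive := Functor.additive_of_preservesBinaryBiproducts H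
  exact ⟨fun Δ hΔ => (F.map_distinguished_exact Δ hΔ).map H⟩

/-- The ideal is closed under shifts. -/
lemma IsStableHomologicalIdeal.shift {I : MorphismProperty T}
    (hI : IsStableHomologicalIdeal.{u₁, v₁, u₃, v₃} I) {X Y : T} {f : X ⟶ Y} (hf : I f) (n : ℤ) :
    I (f⟦n⟧') := by
  obtain ⟨C, _, _, _, _, H, _, _, h⟩ := hI
  rw [h] at hf ⊢
  rw [← cancel_mono ((H.commShiftIso n).hom.app Y), H.commShiftIso_hom_naturality, hf]
  simp

variable {I : MorphismProperty T} {F : T ⥤ A}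

/-- The stable functor X ↦ (G(X[n]))ₙ still kills `I`, because `I` is closed under shifts. Its
factorization, evaluated in degree 0, factors `G`. -/
lemma IsUniversalExact.exists_exact_of_large (hF : IsUniversalExact I F)
    (hI : IsStableHomologicalIdeal.{u₁, v₁, u₃, v₃} I)
    (C : Type (max u₁ v₁ u₂ v₂ + 1)) [Category.{max u₁ v₁ u₂ v₂} C] [Abelian C]
    (G : T ⥤ C) [G.IsHomological] (hG : IsIdealExact I G) :
    ∃ (H : A ⥤ C) (_ : PreservesFiniteLimits H) (_ : PreservesFiniteColimits H),
      Nonempty (F ⋙ H ≅ G) := by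
  obtain ⟨H, hH, ⟨e⟩⟩ := hF.exists_factorization (GradedObjectWithShift (1 : ℤ) C)
    (gradedFunctor G) (fun X Y f hf => by ext n; exact hG _ (hI.shift hf n))
  have := hH.finiteLimits
  have := hH.finiteColimits
  refine ⟨H ⋙ GradedObject.eval 0, inferInstance, inferInstance, ⟨?_⟩⟩
  exact Functor.isoWhiskerRight e (GradedObject.eval 0) ≪≫
    Functor.isoWhiskerRight (shiftFunctorZero T ℤ) G ≪≫ G.leftUnitor

/-- Functors that agree on the range of `F` have graded functors that agree there. -/
noncomputable def gradedFunctorCongr (F : T ⥤ A) [F.CommShift ℤ] {C : Type*} [Category C]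
    {H H' : A ⥤ C} (e : F ⋙ H ≅ F ⋙ H') : F ⋙ gradedFunctor H ≅ F ⋙ gradedFunctor H' :=
  let j (n : ℤ) : F ⋙ shiftFunctor A n ⋙ H ≅ F ⋙ shiftFunctor A n ⋙ H' :=
    Functor.isoWhiskerRight (F.commShiftIso n).symm H ≪≫
      Functor.isoWhiskerLeft (shiftFunctor T n) e ≪≫
      Functor.isoWhiskerRight (F.commShiftIso n) H'
  NatIso.ofComponents (fun X => GradedObject.isoMk _ _ fun n => (j n).app X)
    (fun {X Y} f => by ext n; exact (j n).hom.naturality f)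

/-- Since `F` commutes with shifts, agreement on its range passes to the graded functors; degree 0
of the resulting isomorphism is the one sought. -/
lemma IsUniversalExact.unique_exact_of_large [F.CommShift ℤ] [F.IsHomological]
    (hF : IsUniversalExact I F)
    (C : Type (max u₁ v₁ u₂ v₂ + 1)) [Category.{max u₁ v₁ u₂ v₂} C] [Abelian C]
    (H H' : A ⥤ C) [PreservesFiniteLimits H] [PreservesFiniteColimits H]
    [PreservesFiniteLimits H'] [PreservesFiniteColimits H'] (e : F ⋙ H ≅ F ⋙ H') :
    Nonempty (H ≅ H') := by
  have : (F ⋙ gradedFunctor H).IsHomological := isHomological_comp_exact F _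
  obtain ⟨i⟩ := hF.unique_factorization (GradedObjectWithShift (1 : ℤ) C) (F ⋙ gradedFunctor H)
    (fun X Y f hf => by simp [hF.exact f hf]) (gradedFunctor H) (gradedFunctor H')
    (isStableExact_gradedFunctor H) (isStableExact_gradedFunctor H') ⟨Iso.refl _⟩
    ⟨(gradedFunctorCongr F e).symm⟩
  exact ⟨H.leftUnitor.symm ≪≫ Functor.isoWhiskerRight (shiftFunctorZero A ℤ).symm H ≪≫
    Functor.isoWhiskerRight i (GradedObject.eval 0) ≪≫
    Functor.isoWhiskerRight (shiftFunctorZero A ℤ) H' ≪≫ H'.leftUnitor⟩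

end Unstable
-- Gluing Abelian groups to an Abelian category
section Gluing

variable {C : Type u₂} [Category.{v₂} C] [Abelian C]

/-- The left exact functor `C(X, -)` with values in large Abelian groups. -/
noncomputable def coyonedaLift (X : C) : C ⥤ AddCommGrpCat.{max u₁ v₁ u₂ v₂} :=
  preadditiveCoyoneda.obj (op X) ⋙ AddCommGrpCat.uliftFunctor.{max u₁ v₁ u₂ v₂, v₂}

instance (X : C) : (coyonedaLift.{u₁, v₁} X).Additive :=
  inferInstanceAs (preadditiveCoyoneda.obj (op X) ⋙ AddCommGrpCat.uliftFunctor).Additive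

instance (X : C) : PreservesFiniteLimits (coyonedaLift.{u₁, v₁} X) :=
  inferInstanceAs
    (PreservesFiniteLimits (preadditiveCoyoneda.obj (op X) ⋙ AddCommGrpCat.uliftFunctor))

/-- Abelian groups glued to `C` along `C(X, -)`. -/
abbrev Glued (X : C) := Comma (𝟭 AddCommGrpCat.{max u₁ v₁ u₂ v₂}) (coyonedaLift.{u₁, v₁} X)

/-- The objects of `C` as glued objects with trivial group component. -/
noncomputable def gluedInclusion (X : C) : C ⥤ Glued.{u₁, v₁} X where
  obj M := { left := AddCommGrpCat.of PUnit, right := M, hom := 0 }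
  map f := { left := 𝟙 _, right := f, w := by simp }

lemma isZero_gluedInclusion_left (X M : C) : IsZero ((gluedInclusion.{u₁, v₁} X).obj M).left :=
  AddCommGrpCat.isZero_of_subsingleton (AddCommGrpCat.of PUnit)

instance (X : C) : (gluedInclusion.{u₁, v₁} X).Additive where
  map_add := by
    intro M N f g
    apply CommaMorphism.ext
    · exact (isZero_gluedInclusion_left.{u₁, v₁} X _).eq_of_src _ _
    · rfl

lemma gluedInclusion_exact (X : C) :
    PreservesFiniteLimits (gluedInclusion.{u₁, v₁} X) ∧
      PreservesFiniteColimits (gluedInclusion.{u₁, v₁} X) := by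
  refine ((gluedInclusion.{u₁, v₁} X).exact_tfae.out 1 3).1 fun S hS => ?_
  refine comma_exact _ _ _ ?_ hS
  exact ShortComplex.exact_of_isZero_X₂ _ (isZero_gluedInclusion_left.{u₁, v₁} X S.X₂)

instance (X : C) : PreservesFiniteLimits (gluedInclusion.{u₁, v₁} X) := (gluedInclusion_exact X).1

instance (X : C) : PreservesFiniteColimits (gluedInclusion.{u₁, v₁} X) :=
  (gluedInclusion_exact X).2

end Gluing

/-- The morphism in `C` that the structure map of a glued object attaches to an element. -/
noncomputable def gluedHom {C : Type u₂} [Category.{v₂} C] [Abelian C] {X : C} (Z : Glued.{u₁, v₁} X)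
    (x : Z.left) : X ⟶ Z.right :=
  (Z.hom x : ULift.{max u₁ v₁ u₂ v₂} (X ⟶ Z.right)).down

lemma gluedHom_naturality {C : Type u₂} [Category.{v₂} C] [Abelian C] {X : C}
    {Z Z' : Glued.{u₁, v₁} X} (f : Z ⟶ Z') (x : Z.left) :
    gluedHom Z' (f.left x) = gluedHom Z x ≫ f.right :=
  congrArg ULift.down (ConcreteCategory.congr_hom f.w x)

/-! ### The functor on `I`-projective objects -/

section Unstable

variable {T : Type u₁} [Category.{v₁} T] [HasZeroObject T] [HasShift T ℤ] [Preadditive T]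
  [∀ n : ℤ, (shiftFunctor T n).Additive] [Pretriangulated T]
  {A : Type u₂} [Category.{v₂} A] [Abelian A] [HasShift A ℤ]
  {I : MorphismProperty T} {F : T ⥤ A}

/-- Every exact homological functor factors through `F`, regardless of shifts. -/
lemma IsUniversalExact.exists_exact (hF : IsUniversalExact I F)
    (hI : IsStableHomologicalIdeal.{u₁, v₁, u₃, v₃} I)
    (C : Type u₂) [Category.{v₂} C] [Abelian C]
    (G : T ⥤ C) [G.IsHomological] (hG : IsIdealExact I G) :
    ∃ (H : A ⥤ C) (_ : PreservesFiniteLimits H) (_ : PreservesFiniteColimits H),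
      Nonempty (F ⋙ H ≅ G) := by
  -- Gluing along C(0, -) = 0 merely adjoins an independent copy of the large Abelian groups. This
  -- brings `C` into the universe required by the universal property, and `Comma.snd` leads back.
  have : (G ⋙ gluedInclusion.{u₁, v₁} (0 : C)).IsHomological := isHomological_comp_exact _ _
  obtain ⟨H, _, _, ⟨e⟩⟩ := hF.exists_exact_of_large hI (Glued.{u₁, v₁} (0 : C))
    (G ⋙ gluedInclusion.{u₁, v₁} (0 : C)) (fun X Y f hf => by simp [hG f hf])
  exact ⟨H ⋙ Comma.snd _ _, inferInstance, inferInstance,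
    ⟨Functor.isoWhiskerRight e (Comma.snd _ _)⟩⟩

/-- Exact functors that agree on the range of `F` are isomorphic, regardless of shifts. -/
lemma IsUniversalExact.unique_exact [F.CommShift ℤ] [F.IsHomological]
    (hF : IsUniversalExact I F) (C : Type u₂) [Category.{v₂} C] [Abelian C]
    (H H' : A ⥤ C) [PreservesFiniteLimits H] [PreservesFiniteColimits H]
    [PreservesFiniteLimits H'] [PreservesFiniteColimits H'] (e : F ⋙ H ≅ F ⋙ H') :
    Nonempty (H ≅ H') := by
  obtain ⟨i⟩ := hF.unique_exact_of_large (Glued.{u₁, v₁} (0 : C))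
    (H ⋙ gluedInclusion.{u₁, v₁} 0) (H' ⋙ gluedInclusion.{u₁, v₁} 0)
    (Functor.isoWhiskerRight e (gluedInclusion.{u₁, v₁} 0))
  exact ⟨Functor.isoWhiskerRight i (Comma.snd _ _)⟩

/-- The functor `X ↦ (T(P, X) ⟶ A(F P, F X))`. -/
noncomputable def gluedFunctor (F : T ⥤ A) [F.Additive] (P : T) :
    T ⥤ Glued.{u₁, v₁} (F.obj P) where
  obj X :=
    { left := (preadditiveCoyoneda.obj (op P) ⋙
        AddCommGrpCat.uliftFunctor.{max u₁ v₁ u₂ v₂, v₁}).obj X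
      right := F.obj X
      hom := AddCommGrpCat.ofHom
        { toFun := fun f => ULift.up (F.map f.down)
          map_zero' := by ext; exact F.map_zero _ _
          map_add' := fun f g => by ext; exact F.map_add } }
  map f :=
    { left := (preadditiveCoyoneda.obj (op P) ⋙ AddCommGrpCat.uliftFunctor).map f
      right := F.map f
      w := by
        ext g
        exact congrArg ULift.up (F.map_comp g.down f) }

instance (F : T ⥤ A) [F.IsHomological] (P : T) : (gluedFunctor F P).IsHomological where
  map_zero X Y := by
    ext
    · exact congrArg ULift.up comp_zero
    · exact F.map_zero _ _
  exact Δ hΔ := by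
    have : (preadditiveCoyoneda.obj (op P) ⋙
      AddCommGrpCat.uliftFunctor.{max u₁ v₁ u₂ v₂, v₁}).IsHomological :=
      isHomological_comp_exact _ _
    have : (gluedFunctor F P).PreservesZeroMorphisms := ⟨fun X Y => by
      ext
      · exact congrArg ULift.up comp_zero
      · exact F.map_zero _ _⟩
    exact comma_exact _ _ _ ((preadditiveCoyoneda.obj (op P) ⋙
      AddCommGrpCat.uliftFunctor.{max u₁ v₁ u₂ v₂, v₁}).map_distinguished_exact Δ hΔ)
      (F.map_distinguished_exact Δ hΔ)

/-- The data that the universal property provides for an `I`-projective object `P`: an exact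
functor `E` with an element `y ∈ E (F P)` that is universal among elements of the `E (F B)`, and
an inverse up to isomorphism of the Yoneda transformation. -/
lemma IsUniversalExact.exists_retraction [F.CommShift ℤ] [F.IsHomological]
    (hF : IsUniversalExact I F) (hI : IsStableHomologicalIdeal.{u₁, v₁, u₃, v₃} I)
    {P : T} (hP : IsIdealProjective I P) :
    ∃ (E : A ⥤ AddCommGrpCat.{max u₁ v₁ u₂ v₂}) (_ : PreservesFiniteColimits E)
      (σ : ∀ M : A, E.obj M → (F.obj P ⟶ M)) (y : E.obj (F.obj P)),
      (∀ {M N : A} (f : M ⟶ N) (x : E.obj M), σ N (E.map f x) = σ M x ≫ f) ∧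
      IsIso (σ _ y) ∧ ∀ B : T, Function.Bijective (fun f : P ⟶ B => E.map (F.map f) y) := by
  obtain ⟨Θ, _, _, ⟨τ⟩⟩ := hF.exists_exact_of_large hI (Glued.{u₁, v₁} (F.obj P))
    (gluedFunctor F P) (fun X Y f hf => by
      ext g
      · exact congrArg ULift.up (hP f hf g.down)
      · exact hF.exact f hf)
  -- On the range of `F` the second component of `Θ` agrees with the identity of `A`, hence
  -- everywhere up to `ρ`. No compatibility of `ρ` with `τ` is available, so for the element `y`
  -- attached to `𝟙 P` one obtains that its image is an isomorphism, not that it is an identity.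
  obtain ⟨ρ⟩ := hF.unique_exact A (Θ ⋙ Comma.snd _ _) (𝟭 A)
    (Functor.isoWhiskerRight τ (Comma.snd _ _))
  let y : (Θ.obj (F.obj P)).left := (τ.inv.app P).left (ULift.up (𝟙 P))
  refine ⟨Θ ⋙ Comma.fst _ _, inferInstance,
    fun M x => gluedHom (Θ.obj M) x ≫ ρ.hom.app M, y, ?_, ?_, ?_⟩
  · intro M N f x
    have h : (Θ.map f).right ≫ ρ.hom.app N = ρ.hom.app M ≫ f := ρ.hom.naturality f
    change gluedHom (Θ.obj N) ((Θ.map f).left x) ≫ _ = (gluedHom (Θ.obj M) x ≫ _) ≫ _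
    rw [gluedHom_naturality, Category.assoc, h, Category.assoc]
  · have h : gluedHom (Θ.obj (F.obj P)) y = (τ.inv.app P).right :=
      (gluedHom_naturality (τ.inv.app P) (ULift.up (𝟙 P))).trans
        ((congrArg (· ≫ _) (F.map_id P)).trans (Category.id_comp _))
    have hτ : IsIso (τ.inv.app P).right :=
      inferInstanceAs (IsIso ((Comma.snd _ _).map (τ.inv.app P)))
    change IsIso (gluedHom (Θ.obj (F.obj P)) y ≫ ρ.hom.app (F.obj P))
    rw [h]
    have : IsIso (ρ.hom.app (F.obj P)) := inferInstance
    exact IsIso.comp_isIso' hτ this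
  · intro B
    have h (f : P ⟶ B) : (Θ.map (F.map f)).left y = (τ.inv.app B).left (ULift.up f) := by
      have h₁ := ConcreteCategory.congr_hom
        (congrArg CommaMorphism.left (τ.inv.naturality f)) (ULift.up (𝟙 P))
      refine h₁.symm.trans ?_
      exact congrArg (τ.inv.app B).left (congrArg ULift.up (Category.id_comp f))
    have : IsIso (τ.inv.app B).left :=
      inferInstanceAs (IsIso ((Comma.fst _ _).map (τ.inv.app B)))
    have hb := (ConcreteCategory.bijective_of_isIso (τ.inv.app B).left).comp
      (Equiv.ulift.symm.bijective : Function.Bijective (ULift.up : (P ⟶ B) → _))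
    exact (funext h : _ = (τ.inv.app B).left ∘ ULift.up) ▸ hb

/-- On morphisms out of an `I`-projective object, `F` is bijective. -/
lemma IsUniversalExact.map_bijective [F.CommShift ℤ] [F.IsHomological]
    (hF : IsUniversalExact I F) (hI : IsStableHomologicalIdeal.{u₁, v₁, u₃, v₃} I)
    {P : T} (hP : IsIdealProjective I P) (B : T) :
    Function.Bijective (fun f : P ⟶ B => F.map f) := by
  obtain ⟨E, _, σ, y, hσ, hy, hE⟩ := hF.exists_retraction hI hP
  -- Both halves use that f ↦ E(F f)(y) is bijective. It depends only on `F f`, which gives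
  -- injectivity. For surjectivity, `E.map h y` comes from some `f`, and the isomorphism `σ _ y`
  -- turns equality of elements into equality of morphisms.
  refine ⟨fun f g h => (hE B).1 (by simpa using congrArg (fun t => E.map t y) h), fun h => ?_⟩
  obtain ⟨f, hf⟩ := (hE B).2 (E.map h y)
  refine ⟨f, ?_⟩
  rw [← cancel_epi (σ _ y), ← hσ, ← hσ]
  exact congrArg _ hf

/-- `F` maps `I`-projective objects to projective objects. -/
lemma IsUniversalExact.projective [F.CommShift ℤ] [F.IsHomological]
    (hF : IsUniversalExact I F) (hI : IsStableHomologicalIdeal.{u₁, v₁, u₃, v₃} I)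
    {P : T} (hP : IsIdealProjective I P) : Projective (F.obj P) := by
  obtain ⟨E, _, σ, y, hσ, hy, hE⟩ := hF.exists_retraction hI hP
  refine ⟨fun {M N} f e _ => ?_⟩
  -- Right exactness of `E` lifts the element `E.map f y`; `σ` converts the lifted element into a
  -- lifted morphism.
  have : Function.Surjective (E.map e) :=
    (AddCommGrpCat.epi_iff_surjective _).1 inferInstance
  obtain ⟨x, hx⟩ := this (E.map f y)
  refine ⟨inv (σ _ y) ≫ σ _ x, ?_⟩
  rw [Category.assoc, ← hσ, hx, hσ, IsIso.inv_hom_id_assoc]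

end Unstable
-- Objects presented by images of `I`-projective objects
section Presented

variable {T : Type u₁} [Category.{v₁} T] [HasZeroObject T] [HasShift T ℤ] [Preadditive T]
  [∀ n : ℤ, (shiftFunctor T n).Additive] [Pretriangulated T]
  {A : Type u₂} [Category.{v₂} A] [Abelian A]
  {I : MorphismProperty T} {F : T ⥤ A}

/-- An `I`-epimorphism is mapped to an epimorphism by every `I`-exact homological functor. -/
lemma IsIdealEpi.epi_map [F.IsHomological] (hF : IsIdealExact I F) {X Y : T} {f : X ⟶ Y}
    (hf : IsIdealEpi I f) : Epi (F.map f) := by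
  obtain ⟨Z, g, h, hΔ⟩ := distinguished_cocone_triangle f
  exact (F.map_distinguished_exact _ hΔ).epi_f_iff.2 (hF _ (hf Z g h hΔ))

/-- The kernel of `F g` is covered by an `I`-projective object. -/
lemma exists_exact_cover [F.IsHomological] (hF : IsIdealExact I F)
    (hIproj : HasEnoughIdealProjectives I) {X Y : T} (g : X ⟶ Y) :
    ∃ (P : T) (k : P ⟶ X) (_ : IsIdealProjective I P) (w : F.map k ≫ F.map g = 0),
      (ShortComplex.mk _ _ w).Exact := by
  obtain ⟨Z, i, h, hΔ⟩ := distinguished_cocone_triangle₁ g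
  obtain ⟨P, q, hP, hq⟩ := hIproj Z
  have hw : i ≫ g = 0 := comp_distTriang_mor_zero₁₂ _ hΔ
  have := hq.epi_map hF
  refine ⟨P, q ≫ i, hP, by rw [← F.map_comp, Category.assoc, hw]; simp, ?_⟩
  have hex := F.map_distinguished_exact _ hΔ
  let φ : ShortComplex.mk (F.map (q ≫ i)) (F.map g)
      (by rw [← F.map_comp, Category.assoc, hw]; simp) ⟶
      (shortComplexOfDistTriangle _ hΔ).map F :=
    { τ₁ := F.map q, τ₂ := 𝟙 _, τ₃ := 𝟙 _
      comm₁₂ := (F.map_comp q i).symm.trans (Category.comp_id _).symm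
      comm₂₃ := (Category.id_comp _).trans (Category.comp_id _).symm }
  have : Epi φ.τ₁ := this
  have : IsIso φ.τ₂ := inferInstanceAs (IsIso (𝟙 _))
  have : Mono φ.τ₃ := inferInstanceAs (Mono (𝟙 _))
  exact (ShortComplex.exact_iff_of_epi_of_isIso_of_mono φ).2 hex

lemma IsIdealProjective.biprod {P Q : T} (hP : IsIdealProjective I P)
    (hQ : IsIdealProjective I Q) : IsIdealProjective I (P ⊞ Q) := by
  intro X Y f hf g
  ext
  · simpa using hP f hf (biprod.inl ≫ g)
  · simpa using hQ f hf (biprod.inr ≫ g)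

/-- The objects of `A` with a presentation by images of `I`-projective objects. -/
def Presented (I : MorphismProperty T) (F : T ⥤ A) : ObjectProperty A := fun M =>
  ∃ (P₁ P₀ : T) (d : P₁ ⟶ P₀) (f : F.obj P₀ ⟶ M) (w : F.map d ≫ f = 0),
    IsIdealProjective I P₁ ∧ IsIdealProjective I P₀ ∧ Epi f ∧ (ShortComplex.mk _ _ w).Exact

lemma presented_of_epi_of_refinements {M : A} {P₁ P₀ : T} (h₁ : IsIdealProjective I P₁)
    (h₀ : IsIdealProjective I P₀) (d : P₁ ⟶ P₀) (f : F.obj P₀ ⟶ M) (w : F.map d ≫ f = 0)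
    (hf : Epi f) (h : ∀ ⦃X : A⦄ (x : X ⟶ F.obj P₀), x ≫ f = 0 →
      ∃ (X' : A) (π : X' ⟶ X) (_ : Epi π) (y : X' ⟶ F.obj P₁), π ≫ x = y ≫ F.map d) :
    Presented I F M :=
  ⟨P₁, P₀, d, f, w, h₁, h₀, hf, (ShortComplex.exact_iff_exact_up_to_refinements _).2 h⟩

lemma presented_obj [F.IsHomological] (hF : IsIdealExact I F)
    (hIproj : HasEnoughIdealProjectives I) (X : T) : Presented I F (F.obj X) := by
  obtain ⟨P, f, hP, hf⟩ := hIproj X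
  obtain ⟨P', k, hP', w, hw⟩ := exists_exact_cover hF hIproj f
  exact ⟨P', P, k, F.map f, w, hP', hP, hf.epi_map hF, hw⟩

instance : (Presented I F).IsClosedUnderIsomorphisms where
  of_iso := by
    rintro M N e ⟨P₁, P₀, d, f, w, h₁, h₀, hf, hw⟩
    refine ⟨P₁, P₀, d, f ≫ e.hom, by rw [reassoc_of% w, zero_comp], h₁, h₀, inferInstance, ?_⟩
    exact ShortComplex.exact_of_iso (S₁ := ShortComplex.mk _ _ w)
      (ShortComplex.isoMk (Iso.refl _) (Iso.refl _) e (by simp) (by simp)) hw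

lemma presented_biprod [F.IsHomological] {M N : A} (hM : Presented I F M)
    (hN : Presented I F N) : Presented I F (M ⊞ N) := by
  obtain ⟨P₁, P₀, d, f, w, h₁, h₀, hf, hw⟩ := hM
  obtain ⟨P₁', P₀', d', f', w', h₁', h₀', hf', hw'⟩ := hN
  refine presented_of_epi_of_refinements (h₁.biprod h₁') (h₀.biprod h₀') (biprod.map d d')
    (biprod.lift (F.map biprod.fst ≫ f) (F.map biprod.snd ≫ f')) ?_ ?_ ?_
  · ext
    · simp [← F.map_comp_assoc, w]
    · simp [← F.map_comp_assoc, w']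
  · rw [epi_iff_surjective_up_to_refinements]
    intro X y
    obtain ⟨X₁, π₁, _, x₁, e₁⟩ := surjective_up_to_refinements_of_epi f (y ≫ biprod.fst)
    obtain ⟨X₂, π₂, _, x₂, e₂⟩ := surjective_up_to_refinements_of_epi f' (π₁ ≫ y ≫ biprod.snd)
    refine ⟨X₂, π₂ ≫ π₁, inferInstance,
      (π₂ ≫ x₁) ≫ F.map biprod.inl + x₂ ≫ F.map biprod.inr, ?_⟩
    ext
    · simp [e₁, ← F.map_comp_assoc]
    · simp [e₂, ← F.map_comp_assoc]
  · intro X x hx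
    have hx₁ : (x ≫ F.map biprod.fst) ≫ f = 0 := by simpa using hx =≫ biprod.fst
    have hx₂ : (x ≫ F.map biprod.snd) ≫ f' = 0 := by simpa using hx =≫ biprod.snd
    obtain ⟨X₁, π₁, _, y₁, e₁⟩ := hw.exact_up_to_refinements _ hx₁
    obtain ⟨X₂, π₂, _, y₂, e₂⟩ := hw'.exact_up_to_refinements (π₁ ≫ x ≫ F.map biprod.snd)
      (by simpa using π₁ ≫= hx₂)
    refine ⟨X₂, π₂ ≫ π₁, inferInstance,
      (π₂ ≫ y₁) ≫ F.map biprod.inl + y₂ ≫ F.map biprod.inr, ?_⟩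
    have hid : π₂ ≫ π₁ ≫ x = π₂ ≫ (π₁ ≫ x ≫ F.map biprod.fst) ≫ F.map biprod.inl +
        (π₂ ≫ π₁ ≫ x ≫ F.map biprod.snd) ≫ F.map biprod.inr := by
      simp only [Category.assoc, ← Preadditive.comp_add, ← F.map_comp, ← F.map_add,
        biprod.total, F.map_id, Category.comp_id]
    dsimp at e₁ e₂
    rw [Category.assoc, hid, e₁, e₂]
    simp only [Preadditive.add_comp, Category.assoc, ← F.map_comp, biprod.inl_map,
      biprod.inr_map]

lemma exists_lift_of_exact [F.IsHomological]
    (hFP : ∀ P : T, IsIdealProjective I P → Projective (F.obj P))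
    (hFB : ∀ P : T, IsIdealProjective I P → ∀ B : T,
      Function.Bijective (fun f : P ⟶ B => F.map f))
    {P Q : T} (hP : IsIdealProjective I P) {M : A} (f : F.obj Q ⟶ M) [Epi f] (g : F.obj P ⟶ M) :
    ∃ a : P ⟶ Q, F.map a ≫ f = g := by
  have := hFP P hP
  obtain ⟨a, ha⟩ := (hFB P hP Q).2 (Projective.factorThru g f)
  exact ⟨a, by dsimp at ha; rw [ha, Projective.factorThru_comp]⟩

/-- With `a` a lift of `m` to the covers, the relations of the cokernel are those of `N` together
with the image of `a`: it is presented by (a, d') : P₀ ⊞ P₁' → P₀'. -/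
lemma presented_cokernel [F.IsHomological]
    (hFP : ∀ P : T, IsIdealProjective I P → Projective (F.obj P))
    (hFB : ∀ P : T, IsIdealProjective I P → ∀ B : T,
      Function.Bijective (fun f : P ⟶ B => F.map f))
    {M N : A} (m : M ⟶ N) (hM : Presented I F M) (hN : Presented I F N) :
    Presented I F (cokernel m) := by
  obtain ⟨P₁, P₀, d, f, w, h₁, h₀, hf, hw⟩ := hM
  obtain ⟨P₁', P₀', d', f', w', h₁', h₀', hf', hw'⟩ := hN
  obtain ⟨a, ha⟩ := exists_lift_of_exact hFP hFB h₀ f' (f ≫ m)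
  refine presented_of_epi_of_refinements (h₀.biprod h₁') h₀' (biprod.desc a d')
    (f' ≫ cokernel.π m) ?_ inferInstance ?_
  · have hd : F.map (biprod.desc a d') =
        F.map biprod.fst ≫ F.map a + F.map biprod.snd ≫ F.map d' := by
      simp only [← F.map_comp, ← F.map_add]
      congr 1
      ext <;> simp
    rw [hd, Preadditive.add_comp, Category.assoc, Category.assoc, reassoc_of% ha, reassoc_of% w']
    simp
  · intro X x hx
    have hex := ShortComplex.exact_of_g_is_cokernel (ShortComplex.mk m (cokernel.π m) (by simp))
      (cokernelIsCokernel m)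
    obtain ⟨X₁, π₁, _, y, e₁⟩ := hex.exact_up_to_refinements (x ≫ f') (by simpa using hx)
    obtain ⟨X₂, π₂, _, z, e₂⟩ := surjective_up_to_refinements_of_epi f y
    dsimp at e₁
    obtain ⟨X₃, π₃, _, u, e₃⟩ := hw'.exact_up_to_refinements (π₂ ≫ π₁ ≫ x - z ≫ F.map a) (by
      simp [ha, e₁, reassoc_of% e₂])
    refine ⟨X₃, π₃ ≫ π₂ ≫ π₁, inferInstance,
      (π₃ ≫ z) ≫ F.map biprod.inl + u ≫ F.map biprod.inr, ?_⟩
    dsimp at e₃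
    simp only [Preadditive.add_comp, Category.assoc, ← F.map_comp, biprod.inl_desc,
      biprod.inr_desc, ← e₃, Preadditive.comp_sub]
    abel

/-- Up to sign, generators of the kernel form the fibre product of F P₀ and F P₁' over F P₀', which
`P₂` covers. Their relations come from the fibre product of F P₂ and F P₁ over F P₀, which `P₃`
covers. Both are kernels of morphisms in the image of `F`, so `I`-projective covers exist. -/
lemma presented_kernel [F.IsHomological] (hF : IsIdealExact I F)
    (hIproj : HasEnoughIdealProjectives I)
    (hFP : ∀ P : T, IsIdealProjective I P → Projective (F.obj P))
    (hFB : ∀ P : T, IsIdealProjective I P → ∀ B : T,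
      Function.Bijective (fun f : P ⟶ B => F.map f))
    {M N : A} (m : M ⟶ N) (hM : Presented I F M) (hN : Presented I F N) :
    Presented I F (kernel m) := by
  obtain ⟨P₁, P₀, d, f, w, h₁, h₀, hf, hw⟩ := hM
  obtain ⟨P₁', P₀', d', f', w', h₁', h₀', hf', hw'⟩ := hN
  obtain ⟨a, ha⟩ := exists_lift_of_exact hFP hFB h₀ f' (f ≫ m)
  -- exactness at a fibre product, up to refinements
  have fib : ∀ {X Y Z W : T} (g : X ⟶ Z) (h : Y ⟶ Z) (k : W ⟶ X ⊞ Y)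
      (wk : F.map k ≫ F.map (biprod.desc g h) = 0) (_ : (ShortComplex.mk _ _ wk).Exact)
      ⦃V : A⦄ (x : V ⟶ F.obj X) (y : V ⟶ F.obj Y), x ≫ F.map g + y ≫ F.map h = 0 →
      ∃ (V' : A) (π : V' ⟶ V) (_ : Epi π) (z : V' ⟶ F.obj W),
        π ≫ x = z ≫ F.map (k ≫ biprod.fst) := by
    intro X Y Z W g h k wk hk V x y hxy
    obtain ⟨V', π, hπ, z, hz⟩ := hk.exact_up_to_refinements
      (x ≫ F.map biprod.inl + y ≫ F.map biprod.inr) (by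
        simpa [Preadditive.add_comp, ← F.map_comp] using hxy)
    refine ⟨V', π, hπ, z, ?_⟩
    have := hz =≫ F.map biprod.fst
    simp only [Preadditive.add_comp, Preadditive.comp_add, Category.assoc, ← F.map_comp,
      biprod.inl_fst, biprod.inr_fst, F.map_zero, F.map_id, comp_zero, add_zero,
      Category.comp_id] at this
    exact this
  obtain ⟨P₂, k, h₂, wk, hk⟩ := exists_exact_cover hF hIproj (biprod.desc a d')
  obtain ⟨P₃, l, h₃, wl, hl⟩ := exists_exact_cover hF hIproj (biprod.desc (k ≫ biprod.fst) d)
  have wk' : F.map (k ≫ biprod.fst) ≫ F.map a + F.map (k ≫ biprod.snd) ≫ F.map d' = 0 := by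
    rw [← wk]
    simp only [← F.map_comp, ← F.map_add]
    congr 1
    simp only [Category.assoc, ← Preadditive.comp_add]
    congr 1
    ext <;> simp
  have wl' : F.map (l ≫ biprod.fst) ≫ F.map (k ≫ biprod.fst) +
      F.map (l ≫ biprod.snd) ≫ F.map d = 0 := by
    rw [← wl]
    simp only [← F.map_comp, ← F.map_add]
    congr 1
    simp only [Category.assoc, ← Preadditive.comp_add]
    congr 1
    ext <;> simp
  have hk₀ : (F.map (k ≫ biprod.fst) ≫ f) ≫ m = 0 := by
    have := wk' =≫ f'
    simpa only [Preadditive.add_comp, Category.assoc, ha, w', comp_zero, add_zero,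
      zero_comp] using this
  refine presented_of_epi_of_refinements h₃ h₂ (l ≫ biprod.fst)
    (kernel.lift m (F.map (k ≫ biprod.fst) ≫ f) hk₀) ?_ ?_ ?_
  · rw [← cancel_mono (kernel.ι m)]
    have := wl' =≫ f
    simpa only [Preadditive.add_comp, Category.assoc, w, comp_zero, add_zero,
      zero_comp, kernel.lift_ι] using this
  · rw [epi_iff_surjective_up_to_refinements]
    intro X x
    obtain ⟨X₁, π₁, _, y, e₁⟩ := surjective_up_to_refinements_of_epi f (x ≫ kernel.ι m)
    obtain ⟨X₂, π₂, _, z, e₂⟩ := hw'.exact_up_to_refinements (y ≫ F.map a) (by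
      rw [Category.assoc, ha, ← Category.assoc, ← e₁]; simp)
    obtain ⟨X₃, π₃, _, v, e₃⟩ := fib a d' k wk hk (π₂ ≫ y) (-z) (by
      dsimp at e₂; simp [e₂])
    refine ⟨X₃, π₃ ≫ π₂ ≫ π₁, inferInstance, v, ?_⟩
    rw [← cancel_mono (kernel.ι m)]
    have e₃' := e₃ =≫ f
    simp only [Category.assoc] at e₃'
    rw [Category.assoc, Category.assoc, Category.assoc, Category.assoc, e₁, e₃', kernel.lift_ι]
  · intro X x hx
    have hx' : (x ≫ F.map (k ≫ biprod.fst)) ≫ f = 0 := by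
      simpa using hx =≫ kernel.ι m
    obtain ⟨X₁, π₁, _, y, e₁⟩ := hw.exact_up_to_refinements _ hx'
    obtain ⟨X₂, π₂, _, v, e₂⟩ := fib (k ≫ biprod.fst) d l wl hl (π₁ ≫ x) (-y) (by
      dsimp at e₁; rw [Category.assoc, e₁]; simp)
    exact ⟨X₂, π₂ ≫ π₁, inferInstance, v, by rw [Category.assoc, e₂]⟩

end Presented
section Presented

variable {T : Type u₁} [Category.{v₁} T] [HasZeroObject T] [HasShift T ℤ] [Preadditive T]
  [∀ n : ℤ, (shiftFunctor T n).Additive] [Pretriangulated T]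
  {A : Type u₂} [Category.{v₂} A] [Abelian A] [HasShift A ℤ]
  {I : MorphismProperty T} {F : T ⥤ A}

/-- Every object of `A` has a presentation by images of `I`-projective objects. -/
lemma IsUniversalExact.presented [F.CommShift ℤ] [F.IsHomological]
    (hF : IsUniversalExact I F) (hI : IsStableHomologicalIdeal.{u₁, v₁, u₃, v₃} I)
    (hIproj : HasEnoughIdealProjectives I) (M : A) : Presented I F M := by
  have hFP : ∀ P : T, IsIdealProjective I P → Projective (F.obj P) :=
    fun P hP => hF.projective hI hP
  have hFB : ∀ P : T, IsIdealProjective I P → ∀ B : T,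
      Function.Bijective (fun f : P ⟶ B => F.map f) := fun P hP => hF.map_bijective hI hP
  let Q := Presented I F
  have : Q.ContainsZero :=
    ⟨F.obj 0, F.map_isZero (isZero_zero T), presented_obj hF.exact hIproj 0⟩
  have : Q.IsClosedUnderKernels := ⟨by
    rintro K ⟨f, k, hk, hM, hN⟩
    exact Q.prop_of_iso (IsLimit.conePointUniqueUpToIso (kernelIsKernel f) hk)
      (presented_kernel hF.exact hIproj hFP hFB f hM hN)⟩
  have : Q.IsClosedUnderCokernels := ⟨by
    rintro K ⟨f, k, hk, hM, hN⟩
    exact Q.prop_of_iso (IsColimit.coconePointUniqueUpToIso (cokernelIsCokernel f) hk)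
      (presented_cokernel hFP hFB f hM hN)⟩
  have : Q.IsClosedUnderBinaryProducts := ⟨by
    rintro K ⟨p⟩
    exact Q.prop_of_iso (IsLimit.conePointsIsoOfNatIso (BinaryBiproduct.isLimit _ _) p.isLimit
      (diagramIsoPair p.diag).symm) (presented_biprod (p.prop_diag_obj _) (p.prop_diag_obj _))⟩
  have : Q.IsClosedUnderFiniteProducts := .mk'
  have : PreservesFiniteLimits Q.ι := by
    have := fun {X Y : Q.FullSubcategory} (f : X ⟶ Y) => Q.preservesKernels_ι f
    exact Q.ι.preservesFiniteLimits_of_preservesKernels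
  have : PreservesFiniteColimits Q.ι := by
    have := fun {X Y : Q.FullSubcategory} (f : X ⟶ Y) => Q.preservesCokernels_ι f
    exact Q.ι.preservesFiniteColimits_of_preservesCokernels
  let F₀ : T ⥤ Q.FullSubcategory := Q.lift F (presented_obj hF.exact hIproj)
  have : F₀.PreservesZeroMorphisms := ⟨fun X Y => by ext; exact F.map_zero X Y⟩
  have : F₀.IsHomological := ⟨fun Δ hΔ =>
    exact_of_jointly_faithful (fun _ : Unit => Q.ι) (fun X Y f hf => by ext; exact hf ())
      _ fun _ => F.map_distinguished_exact Δ hΔ⟩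
  obtain ⟨H, _, _, ⟨e⟩⟩ := hF.exists_exact hI Q.FullSubcategory F₀
    (fun X Y f hf => by ext; exact hF.exact f hf)
  -- The exact inclusion of the presented objects, preceded by `H`, agrees with the identity on the
  -- range of `F`. By uniqueness it is isomorphic to the identity, so every object is isomorphic to
  -- a presented one.
  obtain ⟨i⟩ := hF.unique_exact A (H ⋙ Q.ι) (𝟭 A) (Functor.isoWhiskerRight e Q.ι)
  exact Q.prop_of_iso (i.app M) (H.obj M).property

end Presented
/-! ### Projective objects and the partial left adjoint -/

section IdempotentSplitting

variable {T : Type u₁} [Category.{v₁} T] [HasZeroObject T] [HasShift T ℤ] [Preadditive T]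
  [∀ n : ℤ, (shiftFunctor T n).Additive] [Pretriangulated T]

/-- A split monomorphism in a triangulated category has a split cokernel. -/
lemma exists_split_cokernel {S S' : T} (j : S ⟶ S') (k : S' ⟶ S) (h : j ≫ k = 𝟙 S) :
    ∃ (Y : T) (y : S' ⟶ Y) (t : Y ⟶ S'), t ≫ y = 𝟙 Y ∧ y ≫ t = 𝟙 S' - k ≫ j := by
  obtain ⟨Y, y, l, hΔ⟩ := distinguished_cocone_triangle j
  have hjy : j ≫ y = 0 := comp_distTriang_mor_zero₁₂ _ hΔ
  have hl : l = 0 := by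
    have h' : l ≫ j⟦(1 : ℤ)⟧' = 0 := comp_distTriang_mor_zero₃₁ _ hΔ
    have := h' =≫ k⟦(1 : ℤ)⟧'
    rwa [Category.assoc, ← Functor.map_comp, h, zero_comp, CategoryTheory.Functor.map_id, Category.comp_id]
      at this
  obtain ⟨s, hs⟩ : ∃ s : Y ⟶ S', 𝟙 Y = s ≫ y :=
    Triangle.coyoneda_exact₃ _ hΔ (𝟙 Y) ((congrArg _ hl).trans comp_zero)
  obtain ⟨t, ht⟩ : ∃ t : Y ⟶ S', 𝟙 S' - k ≫ j = y ≫ t :=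
    Triangle.yoneda_exact₂ _ hΔ (𝟙 S' - k ≫ j) (show j ≫ (𝟙 S' - k ≫ j) = 0 by
      simp [Preadditive.comp_sub, reassoc_of% h])
  refine ⟨Y, y, t, ?_, ht.symm⟩
  have hyty : y ≫ t ≫ y = y := by
    rw [← Category.assoc, ← ht]
    simp [Preadditive.sub_comp, hjy]
  have : s ≫ y ≫ t ≫ y = s ≫ y := by rw [hyty]
  rwa [← reassoc_of% hs, ← hs] at this

/-- Idempotents split in a triangulated category with countable direct sums. -/
lemma exists_idempotent_splitting [HasCountableCoproducts T] {P : T} (e : P ⟶ P)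
    (he : e ≫ e = e) : ∃ (Y : T) (a : P ⟶ Y) (b : Y ⟶ P), a ≫ b = e ∧ b ≫ a = 𝟙 Y := by
  let ι (n : ℕ) : P ⟶ ∐ fun _ : ℕ => P := Sigma.ι (fun _ : ℕ => P) n
  -- On the image of `e`, `j` is the one-sided shift, and on the complement it is the identity. Its
  -- left inverse is `k`, and its split cokernel is the image of `e` in degree 0.
  let j : (∐ fun _ : ℕ => P) ⟶ ∐ fun _ : ℕ => P :=
    Sigma.desc fun n => (𝟙 P - e) ≫ ι n + e ≫ ι (n + 1)
  let k : (∐ fun _ : ℕ => P) ⟶ ∐ fun _ : ℕ => P :=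
    Sigma.desc fun n => Nat.casesOn n ((𝟙 P - e) ≫ ι 0)
      fun m => (𝟙 P - e) ≫ ι (m + 1) + e ≫ ι m
  let d : (∐ fun _ : ℕ => P) ⟶ P := Sigma.desc fun n => Nat.casesOn n e fun _ => 0
  have hj (n : ℕ) : ι n ≫ j = (𝟙 P - e) ≫ ι n + e ≫ ι (n + 1) := Sigma.ι_desc _ _
  have hk₀ : ι 0 ≫ k = (𝟙 P - e) ≫ ι 0 := Sigma.ι_desc _ _
  have hk (n : ℕ) : ι (n + 1) ≫ k = (𝟙 P - e) ≫ ι (n + 1) + e ≫ ι n := Sigma.ι_desc _ _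
  have hd₀ : ι 0 ≫ d = e := Sigma.ι_desc _ _
  have hd (n : ℕ) : ι (n + 1) ≫ d = 0 := Sigma.ι_desc _ _
  have hjk : j ≫ k = 𝟙 _ := by
    refine Sigma.hom_ext _ _ fun n => ?_
    change ι n ≫ j ≫ k = ι n ≫ 𝟙 _
    rw [reassoc_of% hj n, Preadditive.add_comp, Category.assoc, Category.assoc, hk n]
    cases n with
    | zero => rw [hk₀]; simp [Preadditive.sub_comp, Preadditive.comp_sub, reassoc_of% he]
    | succ m => rw [hk m]; simp [Preadditive.sub_comp, Preadditive.comp_sub, reassoc_of% he]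
  have hkj : 𝟙 _ - k ≫ j = d ≫ ι 0 := by
    refine Sigma.hom_ext _ _ fun n => ?_
    change ι n ≫ (𝟙 _ - k ≫ j) = ι n ≫ d ≫ ι 0
    cases n with
    | zero =>
      rw [reassoc_of% hd₀, Preadditive.comp_sub, reassoc_of% hk₀, hj]
      simp [Preadditive.sub_comp, Preadditive.comp_sub, reassoc_of% he]
    | succ m =>
      rw [reassoc_of% hd m, Preadditive.comp_sub, reassoc_of% hk m, Preadditive.add_comp,
        Category.assoc, Category.assoc, hj, hj]
      simp [Preadditive.sub_comp, Preadditive.comp_sub, reassoc_of% he]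
  obtain ⟨Y, y, t, hty, hyt⟩ := exists_split_cokernel j k hjk
  rw [hkj] at hyt
  refine ⟨Y, e ≫ ι 0 ≫ y, t ≫ d, ?_, ?_⟩
  · rw [Category.assoc, Category.assoc, reassoc_of% hyt, hd₀, reassoc_of% hd₀]
    simp [he]
  · have hde : d ≫ e = d := by
      refine Sigma.hom_ext _ _ fun n => ?_
      change ι n ≫ d ≫ e = ι n ≫ d
      cases n with
      | zero => rw [reassoc_of% hd₀, hd₀, he]
      | succ m => rw [reassoc_of% hd m, hd m, zero_comp]
    rw [Category.assoc, reassoc_of% hde, ← reassoc_of% hyt, hty, Category.comp_id, hty]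

end IdempotentSplitting

namespace AdjointObj

section

variable {T : Type u₁} [Category.{v₁} T] {A : Type u₂} [Category.{v₂} A] {F : T ⥤ A} {Q R : A}

lemma adj_eq (Q' : AdjointObj F Q) {X : T} (g : Q'.obj ⟶ X) : Q'.adj X g = Q'.unit ≫ F.map g :=
  Q'.corep.homEquiv_eq g

lemma unit_map (Q' : AdjointObj F Q) (R' : AdjointObj F R) (f : Q ⟶ R) :
    Q'.unit ≫ F.map (Q'.map R' f) = f ≫ R'.unit := by
  rw [← adj_eq, map, Equiv.apply_symm_apply]

lemma hom_ext (Q' : AdjointObj F Q) {X : T} {g h : Q'.obj ⟶ X}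
    (w : Q'.unit ≫ F.map g = Q'.unit ≫ F.map h) : g = h :=
  (Q'.adj X).injective (by rw [adj_eq, adj_eq, w])

lemma exists_hom (Q' : AdjointObj F Q) {X : T} (f : Q ⟶ F.obj X) :
    ∃ g : Q'.obj ⟶ X, Q'.unit ≫ F.map g = f :=
  ⟨(Q'.adj X).symm f, by rw [← adj_eq, Equiv.apply_symm_apply]⟩

end

section

variable {T : Type u₁} [Category.{v₁} T] {A : Type u₂} [Category.{v₂} A] {F : T ⥤ A} {Q : A}

/-- A value of the partial left adjoint given by a universal morphism. -/
noncomputable def ofUnit {P : T} (η : Q ⟶ F.obj P)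
    (h : ∀ X : T, Function.Bijective (fun g : P ⟶ X => η ≫ F.map g)) : AdjointObj F Q where
  obj := P
  corep :=
    { homEquiv := fun {X} => Equiv.ofBijective _ (h X)
      homEquiv_comp := fun g f => by simp }

lemma ofUnit_unit {P : T} (η : Q ⟶ F.obj P)
    (h : ∀ X : T, Function.Bijective (fun g : P ⟶ X => η ≫ F.map g)) :
    (ofUnit η h).unit = η := by
  change η ≫ F.map (𝟙 P) = η
  simp

end

end AdjointObj

section

variable {T : Type u₁} [Category.{v₁} T] [HasZeroObject T] [HasShift T ℤ] [Preadditive T]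
  [∀ n : ℤ, (shiftFunctor T n).Additive] [Pretriangulated T] {I : MorphismProperty T}

lemma IsIdealProjective.of_retract {P Y : T} (hP : IsIdealProjective I P) (a : P ⟶ Y) (b : Y ⟶ P)
    (h : b ≫ a = 𝟙 Y) : IsIdealProjective I Y := fun U V f hf g => by
  rw [← Category.id_comp g, ← h, Category.assoc, Category.assoc, ← Category.assoc a,
    hP f hf, comp_zero]

lemma IsIdealProjective.shift (hI : IsStableHomologicalIdeal.{u₁, v₁, u₃, v₃} I) {P : T}
    (hP : IsIdealProjective I P) (n : ℤ) : IsIdealProjective I (P⟦n⟧) := fun U V f hf g => by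
  apply (shiftFunctor T (-n)).map_injective
  rw [← cancel_epi ((shiftFunctorCompIsoId T n (-n) (by simp)).inv.app P), Functor.map_comp,
    ← Category.assoc]
  exact (hP _ (hI.shift hf (-n)) _).trans (by simp)

lemma IsIdealProjective.isLeftOrthogonal {P : T} (hP : IsIdealProjective I P) :
    IsLeftOrthogonal I P := fun B hB f => by
  simpa using hP _ hB f

lemma IsLeftOrthogonal.shift (hI : IsStableHomologicalIdeal.{u₁, v₁, u₃, v₃} I) {X : T}
    (hX : IsLeftOrthogonal I X) (n : ℤ) : IsLeftOrthogonal I (X⟦n⟧) := fun B hB f => by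
  apply (shiftFunctor T (-n)).map_injective
  rw [← cancel_epi ((shiftFunctorCompIsoId T n (-n) (by simp)).inv.app X)]
  have hB' : IsContractible I (B⟦-n⟧) := by
    have := hI.shift hB (-n)
    rwa [CategoryTheory.Functor.map_id] at this
  exact (hX _ hB' _).trans (by simp)

lemma IsLeftOrthogonal.biprod {X Y : T} (hX : IsLeftOrthogonal I X) (hY : IsLeftOrthogonal I Y) :
    IsLeftOrthogonal I (X ⊞ Y) := fun B hB f => by
  ext
  · simpa using hX B hB (biprod.inl ≫ f)
  · simpa using hY B hB (biprod.inr ≫ f)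

lemma IsLeftOrthogonal.cone (hI : IsStableHomologicalIdeal.{u₁, v₁, u₃, v₃} I) (Δ : Triangle T)
    (hΔ : Δ ∈ distTriang T) (h₁ : IsLeftOrthogonal I Δ.obj₁) (h₂ : IsLeftOrthogonal I Δ.obj₂) :
    IsLeftOrthogonal I Δ.obj₃ := fun B hB f => by
  obtain ⟨g, rfl⟩ := Triangle.yoneda_exact₃ _ hΔ f (h₂ B hB _)
  rw [h₁.shift hI 1 B hB g, comp_zero]

end

section

variable {T : Type u₁} [Category.{v₁} T] [HasZeroObject T] [HasShift T ℤ] [Preadditive T]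
  [∀ n : ℤ, (shiftFunctor T n).Additive] [Pretriangulated T]
  {A : Type u₂} [Category.{v₂} A] [Abelian A] [HasShift A ℤ]
  {I : MorphismProperty T} {F : T ⥤ A} [F.CommShift ℤ] [F.IsHomological]

lemma AdjointObj.isIdealProjective (hF : IsIdealExact I F) {Q : A} (Q' : AdjointObj F Q) :
    IsIdealProjective I Q'.obj := fun U V f hf g =>
  Q'.hom_ext (by rw [F.map_comp, hF f hf, F.map_zero, comp_zero])

/-- A projective object is a retract of the image of an `I`-projective object. -/
lemma IsUniversalExact.exists_retract (hF : IsUniversalExact I F)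
    (hI : IsStableHomologicalIdeal.{u₁, v₁, u₃, v₃} I) (hIproj : HasEnoughIdealProjectives I)
    (Q : A) [Projective Q] : ∃ (P : T) (_ : IsIdealProjective I P) (s : Q ⟶ F.obj P)
      (t : F.obj P ⟶ Q), s ≫ t = 𝟙 Q := by
  obtain ⟨_, P, _, t, _, _, hP, _, _⟩ := hF.presented hI hIproj Q
  exact ⟨P, hP, Projective.factorThru (𝟙 Q) t, t, Projective.factorThru_comp _ _⟩

/-- The section `s` of a retraction onto `Q` factors through the unit, which gives the candidate
inverse. The other composite is an endomorphism of F(Q̂), so it comes from an endomorphism of Q̂,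
and the universal property identifies the latter with the identity. -/
lemma AdjointObj.isIso_unit (hF : IsUniversalExact I F)
    (hI : IsStableHomologicalIdeal.{u₁, v₁, u₃, v₃} I) (hIproj : HasEnoughIdealProjectives I)
    {Q : A} [Projective Q] (Q' : AdjointObj F Q) : IsIso Q'.unit := by
  obtain ⟨P, hP, s, t, hst⟩ := hF.exists_retract hI hIproj Q
  obtain ⟨v, hv⟩ := Q'.exists_hom s
  refine ⟨F.map v ≫ t, by rw [reassoc_of% hv, hst], ?_⟩
  obtain ⟨x, hx⟩ :=
    (hF.map_bijective hI (Q'.isIdealProjective hF.exact) _).2 ((F.map v ≫ t) ≫ Q'.unit)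
  dsimp at hx
  rw [← hx, ← F.map_id]
  congr 1
  apply Q'.hom_ext
  rw [hx, Category.assoc, reassoc_of% hv, reassoc_of% hst]
  simp

/-- An `I`-projective object is a value of the partial left adjoint. -/
noncomputable def IsUniversalExact.adjointObj (hF : IsUniversalExact I F)
    (hI : IsStableHomologicalIdeal.{u₁, v₁, u₃, v₃} I) {P : T} (hP : IsIdealProjective I P)
    {Q : A} (i : Q ≅ F.obj P) : AdjointObj F Q :=
  .ofUnit i.hom fun X => by
    refine Function.Bijective.comp (g := fun x => i.hom ≫ x) ?_ (hF.map_bijective hI hP X)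
    exact (Iso.homFromEquiv i.symm).bijective

/-- The object `Q` is the image of the idempotent `t ≫ s` on `F P`. Bijectivity of `F` on
endomorphisms of `P` lifts it to an idempotent in `T`, which splits there. -/
lemma IsUniversalExact.exists_adjointObj [HasCountableCoproducts T] (hF : IsUniversalExact I F)
    (hI : IsStableHomologicalIdeal.{u₁, v₁, u₃, v₃} I) (hIproj : HasEnoughIdealProjectives I)
    (Q : A) [Projective Q] : Nonempty (AdjointObj F Q) := by
  obtain ⟨P, hP, s, t, hst⟩ := hF.exists_retract hI hIproj Q
  obtain ⟨e, he⟩ := (hF.map_bijective hI hP _).2 (t ≫ s)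
  dsimp at he
  obtain ⟨Y, a, b, hab, hba⟩ := exists_idempotent_splitting e
    ((hF.map_bijective hI hP _).1 (by simp [he, reassoc_of% hst]))
  refine ⟨hF.adjointObj hI (hP.of_retract a b hba) ⟨s ≫ F.map a, F.map b ≫ t, ?_, ?_⟩⟩
  · rw [Category.assoc, ← F.map_comp_assoc, hab, he]
    simp [reassoc_of% hst, hst]
  · rw [Category.assoc, ← reassoc_of% he, ← F.map_comp, ← F.map_comp, ← hab]
    simp [hba, reassoc_of% hba]

end

/-! ### The class attached to a morphism in the kernel of `F` -/

section UCT

variable {T : Type u₁} [Category.{v₁} T] [HasZeroObject T] [HasShift T ℤ] [Preadditive T]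
  [∀ n : ℤ, (shiftFunctor T n).Additive] [Pretriangulated T]
  {A : Type u₂} [Category.{v₂} A] [Abelian A] [HasShift A ℤ]
  [∀ n : ℤ, (shiftFunctor A n).Additive] [HasExt.{w} A]
  {F : T ⥤ A} [F.CommShift ℤ] [F.IsHomological]

lemma map_shift_eq_zero {X Y : T} {f : X ⟶ Y} (hf : F.map f = 0) (n : ℤ) :
    F.map (f⟦n⟧') = 0 := by
  rw [← cancel_mono ((F.commShiftIso n).hom.app Y), F.commShiftIso_hom_naturality, hf]
  simp

lemma map_invRotate_mor₁_eq_zero (Δ : Triangle T) (h : F.map Δ.mor₃ = 0) :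
    F.map Δ.invRotate.mor₁ = 0 := by
  obtain ⟨u, hu⟩ : ∃ u : (Δ.obj₁⟦(1 : ℤ)⟧)⟦(-1 : ℤ)⟧ ⟶ Δ.obj₁,
      Δ.invRotate.mor₁ = -(Δ.mor₃⟦(-1 : ℤ)⟧' ≫ u) :=
    ⟨(shiftEquiv T (1 : ℤ)).unitIso.inv.app _, rfl⟩
  have h₀ : F.map (-(Δ.mor₃⟦(-1 : ℤ)⟧' ≫ u)) = 0 := by
    rw [F.map_neg, F.map_comp, map_shift_eq_zero h, zero_comp, neg_zero]
  exact (congrArg F.map hu).trans h₀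

/-- When `F f = 0`, the long exact sequence of a triangle on `f` breaks into short exact pieces. -/
lemma exists_isUCTClass {D B : T} (f : D ⟶ B) (hf : F.map f = 0) : ∃ x, IsUCTClass F f x := by
  let f' := f ≫ (shiftFunctorCompIsoId T (-1 : ℤ) 1 (by norm_num)).inv.app B
  have hf' : F.map f' = 0 := by rw [F.map_comp, hf, zero_comp]
  obtain ⟨Z, i, q, hΔ⟩ := distinguished_cocone_triangle₂ f'
  have zero : F.map i ≫ F.map q = 0 := by
    rw [← F.map_comp, show i ≫ q = 0 from comp_distTriang_mor_zero₁₂ _ hΔ, F.map_zero]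
  have hex : (ShortComplex.mk _ _ zero).Exact := F.map_distinguished_exact _ hΔ
  have hi : Mono (F.map i) :=
    (F.map_distinguished_exact _ (inv_rot_of_distTriang _ hΔ)).mono_g_iff.2
      (map_invRotate_mor₁_eq_zero _ hf')
  have hq : Epi (F.map q) :=
    (F.map_distinguished_exact _ (rot_of_distTriang _ hΔ)).epi_f_iff.2 hf'
  exact ⟨_, Z, i, q, hΔ, zero, { exact := hex }, rfl⟩

/-- A commutative square extends to a morphism of triangles, hence to a morphism of extensions.
Uniqueness, both composition rules and, through them, additivity are consequences. -/
lemma IsUCTClass.naturality {D B D' B' : T} {f : D ⟶ B} {f' : D' ⟶ B'}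
    {x : Ext (F.obj D) ((F.obj B)⟦(-1 : ℤ)⟧) 1} {x' : Ext (F.obj D') ((F.obj B')⟦(-1 : ℤ)⟧) 1}
    (hx : IsUCTClass F f x) (hx' : IsUCTClass F f' x') (β : D ⟶ D') (γ : B ⟶ B')
    (h : f ≫ γ = β ≫ f') :
    (Ext.mk₀ (F.map β)).comp x' (zero_add 1) =
      x.comp (Ext.mk₀ ((F.map γ)⟦(-1 : ℤ)⟧')) (add_zero 1) := by
  obtain ⟨Z, i, q, hΔ, zero, hS, rfl⟩ := hx
  obtain ⟨Z', i', q', hΔ', zero', hS', rfl⟩ := hx'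
  obtain ⟨b, hb₁, hb₂⟩ : ∃ b : Z ⟶ Z', i ≫ b = γ⟦(-1 : ℤ)⟧' ≫ i' ∧ q ≫ β = b ≫ q' :=
    complete_distinguished_triangle_morphism₂ _ _ hΔ hΔ' (γ⟦(-1 : ℤ)⟧') β
      (show (f ≫ (shiftFunctorCompIsoId T (-1 : ℤ) 1 (by norm_num)).inv.app B) ≫
          (shiftFunctor T (-1 : ℤ) ⋙ shiftFunctor T (1 : ℤ)).map γ =
          β ≫ f' ≫ (shiftFunctorCompIsoId T (-1 : ℤ) 1 (by norm_num)).inv.app B' by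
        rw [Category.assoc, ← (shiftFunctorCompIsoId T (-1 : ℤ) 1 (by norm_num)).inv.naturality γ,
          ← Category.assoc, ← Category.assoc, ← h]
        rfl)
  let φ : ShortComplex.mk _ _ zero ⟶ ShortComplex.mk _ _ zero' :=
    { τ₁ := F.map (γ⟦(-1 : ℤ)⟧'), τ₂ := F.map b, τ₃ := F.map β
      comm₁₂ := (F.map_comp _ _).symm.trans ((congrArg F.map hb₁.symm).trans (F.map_comp _ _))
      comm₂₃ := (F.map_comp _ _).symm.trans ((congrArg F.map hb₂.symm).trans (F.map_comp _ _)) }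
  have hφ : hS.extClass.comp (Ext.mk₀ (F.map (γ⟦(-1 : ℤ)⟧'))) (add_zero 1) =
      (Ext.mk₀ (F.map β)).comp hS'.extClass (zero_add 1) :=
    ShortComplex.ShortExact.extClass_naturality hS hS' φ
  have hn : F.map (γ⟦(-1 : ℤ)⟧') ≫ (F.commShiftIso (-1 : ℤ)).hom.app B' =
      (F.commShiftIso (-1 : ℤ)).hom.app B ≫ (F.map γ)⟦(-1 : ℤ)⟧' :=
    F.commShiftIso_hom_naturality γ (-1)
  rw [Ext.comp_assoc_of_third_deg_zero, Ext.mk₀_comp_mk₀]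
  refine (Ext.comp_assoc_of_third_deg_zero _ _ _ _).symm.trans ?_
  rw [← hφ, Ext.comp_assoc_of_third_deg_zero, Ext.mk₀_comp_mk₀, hn]

lemma IsUCTClass.unique {D B : T} {f : D ⟶ B} {x x' : Ext (F.obj D) ((F.obj B)⟦(-1 : ℤ)⟧) 1}
    (hx : IsUCTClass F f x) (hx' : IsUCTClass F f x') : x' = x := by
  simpa using hx.naturality hx' (𝟙 D) (𝟙 B) (by simp)

/-- Every map `D ⟶ B` with the properties of `f ≫ γ` has the class `x·(F γ)[-1]`. -/
lemma IsUCTClass.comp_right {D B B' : T} {f : D ⟶ B} {f' : D ⟶ B'}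
    {x : Ext (F.obj D) ((F.obj B)⟦(-1 : ℤ)⟧) 1} {x' : Ext (F.obj D) ((F.obj B')⟦(-1 : ℤ)⟧) 1}
    (hx : IsUCTClass F f x) (hx' : IsUCTClass F f' x') (γ : B ⟶ B') (h : f ≫ γ = f') :
    x' = x.comp (Ext.mk₀ ((F.map γ)⟦(-1 : ℤ)⟧')) (add_zero 1) := by
  simpa using hx.naturality hx' (𝟙 D) γ (by simpa using h)

lemma IsUCTClass.comp_left {D D' B : T} {f : D ⟶ B} {f' : D' ⟶ B}
    {x : Ext (F.obj D) ((F.obj B)⟦(-1 : ℤ)⟧) 1} {x' : Ext (F.obj D') ((F.obj B)⟦(-1 : ℤ)⟧) 1}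
    (hx : IsUCTClass F f x) (hx' : IsUCTClass F f' x') (β : D ⟶ D') (h : f = β ≫ f') :
    x = (Ext.mk₀ (F.map β)).comp x' (zero_add 1) := by
  simpa using (hx.naturality hx' β (𝟙 B) (by simpa using h)).symm

/-- The summands and the sum are all images of the class of (f, g) : D → B ⊞ B, under `biprod.fst`,
`biprod.snd` and their sum, so functoriality in the target suffices. -/
lemma IsUCTClass.add {D B : T} {f g : D ⟶ B} {x y z : Ext (F.obj D) ((F.obj B)⟦(-1 : ℤ)⟧) 1}
    (hx : IsUCTClass F f x) (hy : IsUCTClass F g y) (hz : IsUCTClass F (f + g) z) :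
    z = x + y := by
  have hfz : ∀ {f : D ⟶ B} {x}, IsUCTClass F f x → F.map f = 0 := by
    rintro f x ⟨Z, i, q, hΔ, _, hS, _⟩
    have := hS.epi_g
    have h : q ≫ f ≫ (shiftFunctorCompIsoId T (-1 : ℤ) 1 (by norm_num)).inv.app B = 0 :=
      comp_distTriang_mor_zero₂₃ _ hΔ
    have h₁ : F.map q ≫ F.map f = 0 := by
      rw [← F.map_comp, show q ≫ f = 0 by simpa [← Category.assoc] using h, F.map_zero]
    exact zero_of_epi_comp (F.map q) h₁
  obtain ⟨w, hw⟩ := exists_isUCTClass (F := F) (biprod.lift f g) (by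
    have h₁ := hfz hx
    have h₂ := hfz hy
    have : biprod.lift f g = f ≫ biprod.inl + g ≫ biprod.inr := by ext <;> simp
    rw [this, F.map_add, F.map_comp, F.map_comp, h₁, h₂]
    simp)
  rw [hw.comp_right hx biprod.fst (by simp), hw.comp_right hy biprod.snd (by simp),
    hw.comp_right hz (biprod.fst + biprod.snd) (by simp [Preadditive.comp_add]),
    ← Ext.comp_add, ← Ext.mk₀_add, F.map_add, Functor.map_add]

end UCT

/-! ### Naturality of relative obstruction classes -/

section Relative

variable {T : Type u₁} [Category.{v₁} T] [HasZeroObject T] [HasShift T ℤ] [Preadditive T]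
  [∀ n : ℤ, (shiftFunctor T n).Additive] [Pretriangulated T]
  {A : Type u₂} [Category.{v₂} A] [Abelian A] [HasShift A ℤ]
  [∀ n : ℤ, (shiftFunctor A n).Additive] [HasExt.{w} A]
  {I : MorphismProperty T} {F : T ⥤ A} [F.CommShift ℤ] [F.IsHomological]

/-- A lift `a` of `m` to the covers induces morphisms `β₁` and `β₂` between the syzygy liftings, one
for each pair of triangles. These agree after `F` but possibly not in `T`, which causes a correction
term; that term dies in Ext with values in M[-1]. For `m` the identity this yields independence of
resolution, syzygy lifting and triangles. -/
lemma IsRelativeObstructionClass.naturality (hF : IsUniversalExact I F)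
    (hI : IsStableHomologicalIdeal.{u₁, v₁, u₃, v₃} I) (hIproj : HasEnoughIdealProjectives I)
    {M M' : A} {L₂ L₁ : Lifting I F M} {L₂' L₁' : Lifting I F M'}
    {c : Ext M (M⟦(-1 : ℤ)⟧) 2} {c' : Ext M' (M'⟦(-1 : ℤ)⟧) 2}
    (hc : IsRelativeObstructionClass I F L₂ L₁ c)
    (hc' : IsRelativeObstructionClass I F L₂' L₁' c') (m : M' ⟶ M)
    (u₂ : L₂'.obj ⟶ L₂.obj) (h₂ : F.map u₂ ≫ L₂.iso.hom = L₂'.iso.hom ≫ m)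
    (u₁ : L₁'.obj ⟶ L₁.obj) (h₁ : F.map u₁ ≫ L₁.iso.hom = L₁'.iso.hom ≫ m) :
    c'.comp (Ext.mk₀ (m⟦(-1 : ℤ)⟧')) (add_zero 2) = (Ext.mk₀ m).comp c (zero_add 2) := by
  obtain ⟨_, R, _, _, _, P, D, φ₁, φ₂, p₁, r₁, p₂, r₂, x, hΔ₁, hΔ₂, hφ₁, hφ₂, hp₁, hp₂, hx, rfl⟩ := hc
  obtain ⟨_, R', _, _, _, P', D', φ₁', φ₂', p₁', r₁', p₂', r₂', x', hΔ₁', hΔ₂', hφ₁', hφ₂', hp₁', hp₂',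
    hx', rfl⟩ := hc'
  have := R.epi_ε
  have := P.isIso_unit hF hI hIproj
  let a : R'.Q₀ ⟶ R.Q₀ := Projective.factorThru (R'.ε ≫ m) R.ε
  have ha : a ≫ R.ε = R'.ε ≫ m := Projective.factorThru_comp _ _
  have hβ : ∀ {L : Lifting I F M} {L' : Lifting I F M'} {φ : D.obj ⟶ P.obj} {φ' : D'.obj ⟶ P'.obj}
      {p r} {p' r'} (u : L'.obj ⟶ L.obj), Triangle.mk φ p r ∈ distTriang T →
      Triangle.mk φ' p' r' ∈ distTriang T → F.map u ≫ L.iso.hom = L'.iso.hom ≫ m →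
      P.unit ≫ F.map p ≫ L.iso.hom = R.ε → P'.unit ≫ F.map p' ≫ L'.iso.hom = R'.ε →
      p' ≫ u = P'.map P a ≫ p ∧ ∃ β : D'.obj ⟶ D.obj, φ' ≫ P'.map P a = β ≫ φ := by
    intro L L' φ φ' p r p' r' u hΔ hΔ' hu hp hp'
    have e : p' ≫ u = P'.map P a ≫ p := by
      apply P'.hom_ext
      rw [← cancel_mono L.iso.hom]
      simp only [F.map_comp, Category.assoc, hu]
      rw [reassoc_of% P'.unit_map P a, hp, ha, reassoc_of% hp']
    obtain ⟨β, hβ, _⟩ := complete_distinguished_triangle_morphism₁ _ _ hΔ' hΔ (P'.map P a) u e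
    exact ⟨e, β, hβ⟩
  obtain ⟨e₁, β₁, hβ₁⟩ := hβ u₁ hΔ₁ hΔ₁' h₁ hp₁ hp₁'
  obtain ⟨-, β₂, hβ₂⟩ := hβ u₂ hΔ₂ hΔ₂' h₂ hp₂ hp₂'
  have hmono : Mono R.ι := inferInstanceAs (Mono (kernel.ι R.ε))
  have hb : ∀ {φ : D.obj ⟶ P.obj} {φ' : D'.obj ⟶ P'.obj} {β : D'.obj ⟶ D.obj},
      F.map φ = D.iso.hom ≫ R.ι ≫ P.unit → F.map φ' = D'.iso.hom ≫ R'.ι ≫ P'.unit →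
      φ' ≫ P'.map P a = β ≫ φ → F.map β ≫ D.iso.hom ≫ R.ι = D'.iso.hom ≫ R'.ι ≫ a := by
    intro φ φ' β hφ hφ' h
    have := congrArg F.map h
    rw [F.map_comp, F.map_comp, hφ, hφ', Category.assoc, Category.assoc, P'.unit_map] at this
    rw [← cancel_mono P.unit]
    simpa using this.symm
  have hb₁ := hb hφ₁ hφ₁' hβ₁
  have hu : F.map (β₂ - β₁) = 0 := by
    rw [F.map_sub, sub_eq_zero, ← cancel_mono (D.iso.hom ≫ R.ι), hb₁, hb hφ₂ hφ₂' hβ₂]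
  let b : R'.syzygy ⟶ R.syzygy := D'.iso.inv ≫ F.map β₁ ≫ D.iso.hom
  have hbι : b ≫ R.ι = R'.ι ≫ a := by simp [b, hb₁]
  let Φ : ShortComplex.mk R'.ι R'.ε R'.ι_ε ⟶ ShortComplex.mk R.ι R.ε R.ι_ε :=
    { τ₁ := b, τ₂ := a, τ₃ := m, comm₁₂ := hbι, comm₂₃ := ha }
  have hΦ : R'.shortExact₀.extClass.comp (Ext.mk₀ b) (add_zero 1) =
      (Ext.mk₀ m).comp R.shortExact₀.extClass (zero_add 1) :=
    ShortComplex.ShortExact.extClass_naturality R'.shortExact₀ R.shortExact₀ Φ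
  obtain ⟨y, hy⟩ := exists_isUCTClass (F := F) (β₂ - β₁) hu
  have hz₁ : F.map (β₁ ≫ (φ₂ - φ₁)) = 0 := by simp [F.map_sub, hφ₁, hφ₂]
  have hz₂ : F.map ((β₂ - β₁) ≫ φ₂) = 0 := by rw [F.map_comp, hu, zero_comp]
  have hz : (φ₂' - φ₁') ≫ P'.map P a = β₁ ≫ (φ₂ - φ₁) + (β₂ - β₁) ≫ φ₂ := by
    simp only [Preadditive.sub_comp, Preadditive.comp_sub, hβ₁, hβ₂]
    abel
  obtain ⟨z₁, hz₁⟩ := exists_isUCTClass (F := F) _ hz₁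
  obtain ⟨z₂, hz₂⟩ := exists_isUCTClass (F := F) _ hz₂
  obtain ⟨z, hz'⟩ := exists_isUCTClass (F := F) (β₁ ≫ (φ₂ - φ₁) + (β₂ - β₁) ≫ φ₂) (by
    rw [← hz]; simp [F.map_sub, hφ₁', hφ₂'])
  have key : x'.comp (Ext.mk₀ ((F.map (P'.map P a))⟦(-1 : ℤ)⟧')) (add_zero 1) =
      (Ext.mk₀ (F.map β₁)).comp x (zero_add 1) +
        y.comp (Ext.mk₀ ((F.map φ₂)⟦(-1 : ℤ)⟧')) (add_zero 1) := by
    rw [← hx'.comp_right hz' _ hz, hz₁.add hz₂ hz', hz₁.comp_left hx _ rfl,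
      hy.comp_right hz₂ _ rfl]
  -- The correction `(β₂ - β₁) ≫ φ₂` has a class that factors through F φ₂ = F φ₁, and `φ₁` is
  -- annihilated by `p₁`.
  have hdie : (F.map φ₂)⟦(-1 : ℤ)⟧' ≫ (F.map p₁ ≫ L₁.iso.hom)⟦(-1 : ℤ)⟧' = 0 := by
    have hφp : φ₁ ≫ p₁ = 0 := comp_distTriang_mor_zero₁₂ _ hΔ₁
    rw [← Functor.map_comp, hφ₂, ← hφ₁, ← F.map_comp_assoc, hφp]
    simp
  have hlast : (F.map p₁' ≫ L₁'.iso.hom) ≫ m = F.map (P'.map P a) ≫ F.map p₁ ≫ L₁.iso.hom := by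
    rw [Category.assoc, ← h₁, ← F.map_comp_assoc, e₁, F.map_comp_assoc]
  have hxm : x'.comp (Ext.mk₀ ((F.map p₁' ≫ L₁'.iso.hom)⟦(-1 : ℤ)⟧' ≫ m⟦(-1 : ℤ)⟧')) (add_zero 1) =
      (Ext.mk₀ (F.map β₁)).comp
        (x.comp (Ext.mk₀ ((F.map p₁ ≫ L₁.iso.hom)⟦(-1 : ℤ)⟧')) (add_zero 1)) (zero_add 1) := by
    rw [← Functor.map_comp, hlast, Functor.map_comp, ← Ext.mk₀_comp_mk₀,
      ← Ext.comp_assoc_of_third_deg_zero, key, Ext.add_comp, Ext.comp_assoc_of_third_deg_zero,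
      Ext.comp_assoc_of_third_deg_zero, Ext.mk₀_comp_mk₀, hdie]
    simp
  rw [Ext.comp_assoc_of_third_deg_zero, Ext.comp_assoc_of_third_deg_zero,
    Ext.comp_assoc_of_third_deg_zero, Ext.mk₀_comp_mk₀, hxm, Ext.mk₀_comp_mk₀_assoc,
    show D'.iso.inv ≫ F.map β₁ = b ≫ D.iso.inv by simp [b], ← Ext.mk₀_comp_mk₀_assoc,
    ← Ext.comp_assoc_of_second_deg_zero, hΦ, Ext.comp_assoc _ _ _ (zero_add 1) _ (by norm_num)]

end Relative
/-! ### The homology of the cone of a lifted morphism -/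

namespace ParityDecomposition

variable {A : Type u₂} [Category.{v₂} A] [Abelian A] [HasShift A ℤ] (E : ParityDecomposition A)

/-- The projection of `Y` to its odd summand vanishes after composition with the epimorphism `f`, so
that summand is zero. -/
lemma even_of_epi {X Y : A} (f : X ⟶ Y) [Epi f] (hX : E.even X) : E.even Y := by
  obtain ⟨Ye, Yo, he, ho, ⟨i⟩⟩ := E.exists_decomposition Y
  have h₀ : f ≫ i.hom ≫ biprod.snd = 0 := E.even_odd_zero hX ho _
  have h₁ : (biprod.snd : Ye ⊞ Yo ⟶ Yo) = 0 := by
    rw [← cancel_epi (f ≫ i.hom), Category.assoc, h₀, comp_zero]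
  have h₂ : IsZero Yo := (IsZero.iff_id_eq_zero _).2 (by
    rw [← biprod.inr_snd (X := Ye), h₁, comp_zero])
  have h₃ : (biprod.inr : Yo ⟶ Ye ⊞ Yo) = 0 := h₂.eq_of_src _ _
  exact E.even_of_iso (i ≪≫ ⟨biprod.fst, biprod.inl, by
    rw [← biprod.total, h₁]; simp, by simp⟩).symm he

lemma odd_shift [∀ n : ℤ, (shiftFunctor A n).Additive] {X : A} (hX : E.even X) :
    E.odd (X⟦(1 : ℤ)⟧) :=
  (E.odd_iff _).2 (E.even_of_iso
    ((shiftFunctorCompIsoId A (1 : ℤ) (-1) (by norm_num)).app X).symm hX)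

end ParityDecomposition

lemma projective_shift {A : Type u₂} [Category.{v₂} A] [HasShift A ℤ] (Q : A) [Projective Q]
    (n : ℤ) : Projective (Q⟦n⟧) :=
  (Equivalence.map_projective_iff (shiftFunctor A n).asEquivalence Q).2 inferInstance

section ConeHomology

variable {T : Type u₁} [Category.{v₁} T] [HasZeroObject T] [HasShift T ℤ] [Preadditive T]
  [∀ n : ℤ, (shiftFunctor T n).Additive] [Pretriangulated T]
  {A : Type u₂} [Category.{v₂} A] [Abelian A] [HasShift A ℤ]
  [∀ n : ℤ, (shiftFunctor A n).Additive]
  {F : T ⥤ A} [F.CommShift ℤ] [F.IsHomological]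
  {M₁ M₀ : A} (S : TwoStepExtension M₁ M₀) (Qh₁ : AdjointObj F S.Q₁) (Qh₀ : AdjointObj F S.Q₀)
  {X : T} {p : Qh₀.obj ⟶ X} {r : X ⟶ Qh₁.obj⟦(1 : ℤ)⟧}

/-- The image of a cone of `d̂₁` under `F` is an extension of `M₁[1]` by `M₀`. -/
lemma exists_shortExact_cone [IsIso Qh₁.unit] [IsIso Qh₀.unit]
    (hX : Triangle.mk (Qh₁.map Qh₀ S.d₁) p r ∈ distTriang T) :
    ∃ (s : M₀ ⟶ F.obj X) (t : F.obj X ⟶ M₁⟦(1 : ℤ)⟧) (w : s ≫ t = 0),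
      (ShortComplex.mk s t w).ShortExact ∧ S.ε ≫ s = Qh₀.unit ≫ F.map p ∧
      t ≫ S.d₂⟦(1 : ℤ)⟧' ≫ Qh₁.unit⟦(1 : ℤ)⟧' =
        F.map r ≫ (F.commShiftIso (1 : ℤ)).hom.app Qh₁.obj := by
  have := S.epi_ε
  have := S.mono_d₂
  have hdp : Qh₁.map Qh₀ S.d₁ ≫ p = 0 := comp_distTriang_mor_zero₁₂ _ hX
  have hpr : p ≫ r = 0 := comp_distTriang_mor_zero₂₃ _ hX
  have hrd : r ≫ (Qh₁.map Qh₀ S.d₁)⟦(1 : ℤ)⟧' = 0 := comp_distTriang_mor_zero₃₁ _ hX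
  have hu := Qh₁.unit_map Qh₀ S.d₁
  have ex₀ : (ShortComplex.mk (F.map (Qh₁.map Qh₀ S.d₁)) (F.map p) (by
      rw [← F.map_comp, hdp, F.map_zero])).Exact := F.map_distinguished_exact _ hX
  have ex₁ : (ShortComplex.mk (F.map p) (F.map r) (by
      rw [← F.map_comp, hpr, F.map_zero])).Exact :=
    F.map_distinguished_exact _ (rot_of_distTriang _ hX)
  have ex₂ : (ShortComplex.mk (F.map r) (F.map (-(Qh₁.map Qh₀ S.d₁)⟦(1 : ℤ)⟧')) (by
      rw [← F.map_comp, Preadditive.comp_neg, hrd, neg_zero, F.map_zero])).Exact :=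
    F.map_distinguished_exact _ (rot_of_distTriang _ (rot_of_distTriang _ hX))
  have exd : (ShortComplex.mk (S.d₂⟦(1 : ℤ)⟧') (S.d₁⟦(1 : ℤ)⟧') (by
      rw [← Functor.map_comp, S.d₂_d₁, Functor.map_zero])).Exact :=
    S.exact₁.map (shiftFunctor A (1 : ℤ))
  have hmono : Mono (S.d₂⟦(1 : ℤ)⟧') := inferInstance
  have hsh : Qh₁.unit⟦(1 : ℤ)⟧' ≫ (F.commShiftIso (1 : ℤ)).inv.app Qh₁.obj ≫
      F.map ((Qh₁.map Qh₀ S.d₁)⟦(1 : ℤ)⟧') = S.d₁⟦(1 : ℤ)⟧' ≫ Qh₀.unit⟦(1 : ℤ)⟧' ≫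
        (F.commShiftIso (1 : ℤ)).inv.app Qh₀.obj := by
    rw [← F.commShiftIso_inv_naturality, ← Functor.map_comp_assoc, hu, Functor.map_comp_assoc]
  have hsh' : F.map ((Qh₁.map Qh₀ S.d₁)⟦(1 : ℤ)⟧') ≫ (F.commShiftIso (1 : ℤ)).hom.app Qh₀.obj =
      (F.commShiftIso (1 : ℤ)).hom.app Qh₁.obj ≫ (inv Qh₁.unit)⟦(1 : ℤ)⟧' ≫ S.d₁⟦(1 : ℤ)⟧' ≫
        Qh₀.unit⟦(1 : ℤ)⟧' := by
    rw [F.commShiftIso_hom_naturality]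
    simp only [← Functor.map_comp]
    rw [← hu, IsIso.inv_hom_id_assoc]
  let s : M₀ ⟶ F.obj X := S.exact₀.desc (Qh₀.unit ≫ F.map p) (by
    change S.d₁ ≫ _ = 0
    rw [← reassoc_of% hu, ← F.map_comp, hdp, F.map_zero, comp_zero])
  have hs : S.ε ≫ s = Qh₀.unit ≫ F.map p := S.exact₀.g_desc _ _
  let t : F.obj X ⟶ M₁⟦(1 : ℤ)⟧ := exd.lift
    (F.map r ≫ (F.commShiftIso (1 : ℤ)).hom.app Qh₁.obj ≫ (inv Qh₁.unit)⟦(1 : ℤ)⟧') (by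
      change (_ ≫ _ ≫ _) ≫ S.d₁⟦(1 : ℤ)⟧' = 0
      rw [← cancel_mono (Qh₀.unit⟦(1 : ℤ)⟧')]
      simp only [Category.assoc]
      rw [← hsh', ← F.map_comp_assoc, hrd]
      simp)
  have ht' : t ≫ S.d₂⟦(1 : ℤ)⟧' = F.map r ≫ (F.commShiftIso (1 : ℤ)).hom.app Qh₁.obj ≫
      (inv Qh₁.unit)⟦(1 : ℤ)⟧' := exd.lift_f _ _
  have ht : t ≫ S.d₂⟦(1 : ℤ)⟧' ≫ Qh₁.unit⟦(1 : ℤ)⟧' =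
      F.map r ≫ (F.commShiftIso (1 : ℤ)).hom.app Qh₁.obj := by
    rw [reassoc_of% ht', ← Functor.map_comp, IsIso.inv_hom_id]
    simp
  have w : s ≫ t = 0 := by
    rw [← cancel_epi S.ε, ← cancel_mono (S.d₂⟦(1 : ℤ)⟧' ≫ Qh₁.unit⟦(1 : ℤ)⟧'), Category.assoc,
      Category.assoc, ht, reassoc_of% hs, ← F.map_comp_assoc, hpr]
    simp
  refine ⟨s, t, w, ?_, hs, ht⟩
  have hms : Mono s := by
    rw [Preadditive.mono_iff_cancel_zero]
    intro V x hx
    obtain ⟨V₁, π₁, _, y, e₁⟩ := surjective_up_to_refinements_of_epi S.ε x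
    obtain ⟨V₂, π₂, _, z, e₂⟩ := ex₀.exact_up_to_refinements (y ≫ Qh₀.unit) (by
      change (_ ≫ _) ≫ F.map p = 0
      rw [Category.assoc, ← hs, ← reassoc_of% e₁, hx, comp_zero])
    have e₂' : π₂ ≫ y ≫ Qh₀.unit = z ≫ F.map (Qh₁.map Qh₀ S.d₁) := e₂
    have e₃ : π₂ ≫ y = z ≫ inv Qh₁.unit ≫ S.d₁ := by
      rw [← cancel_mono Qh₀.unit, Category.assoc, e₂', Category.assoc, Category.assoc, ← hu,
        IsIso.inv_hom_id_assoc]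
    rw [← cancel_epi π₁, e₁, ← cancel_epi π₂, reassoc_of% e₃, S.d₁_ε]
    simp
  have het : Epi t := by
    rw [epi_iff_surjective_up_to_refinements]
    intro V x
    obtain ⟨V₁, π₁, hπ₁, y, e₁⟩ := ex₂.exact_up_to_refinements (x ≫ S.d₂⟦(1 : ℤ)⟧' ≫
        Qh₁.unit⟦(1 : ℤ)⟧' ≫ (F.commShiftIso (1 : ℤ)).inv.app Qh₁.obj) (by
      change (_ ≫ _ ≫ _ ≫ _) ≫ F.map (-(Qh₁.map Qh₀ S.d₁)⟦(1 : ℤ)⟧') = 0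
      rw [F.map_neg, Preadditive.comp_neg, Category.assoc, Category.assoc, Category.assoc, hsh,
        ← Functor.map_comp_assoc, S.d₂_d₁]
      simp)
    have e₁' : π₁ ≫ x ≫ S.d₂⟦(1 : ℤ)⟧' ≫ Qh₁.unit⟦(1 : ℤ)⟧' ≫
        (F.commShiftIso (1 : ℤ)).inv.app Qh₁.obj = y ≫ F.map r := e₁
    refine ⟨V₁, π₁, hπ₁, y, ?_⟩
    rw [← cancel_mono (S.d₂⟦(1 : ℤ)⟧' ≫ Qh₁.unit⟦(1 : ℤ)⟧'), Category.assoc, Category.assoc,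
      ht, ← reassoc_of% e₁']
    simp
  refine { exact := ?_ }
  rw [ShortComplex.exact_iff_exact_up_to_refinements]
  intro V x hx
  obtain ⟨V₁, π₁, hπ₁, y, e₁⟩ := ex₁.exact_up_to_refinements x (by
    change x ≫ F.map r = 0
    rw [← cancel_mono ((F.commShiftIso (1 : ℤ)).hom.app Qh₁.obj), Category.assoc, ← ht,
      reassoc_of% hx, zero_comp, zero_comp])
  refine ⟨V₁, π₁, hπ₁, y ≫ inv Qh₀.unit ≫ S.ε, ?_⟩
  refine e₁.trans ?_
  change y ≫ F.map p = (y ≫ inv Qh₀.unit ≫ S.ε) ≫ s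
  simp [hs]

/-- The compatibility conditions fix every entry of the comparison matrix except M₁[1] → M₀, which
vanishes because it goes from odd to even. -/
lemma IsConeSplitting.eq (E : ParityDecomposition A) (hM₁ : E.even M₁) (hQ₀ : E.even S.Q₀)
    [Mono (Qh₁.unit⟦(1 : ℤ)⟧')] {e e' : F.obj X ≅ M₀ ⊞ M₁⟦(1 : ℤ)⟧}
    (he : IsConeSplitting F S Qh₁ Qh₀ p r e) (he' : IsConeSplitting F S Qh₁ Qh₀ p r e') :
    e = e' := by
  have := S.epi_ε
  have := S.mono_d₂
  have h₂ : e.hom ≫ biprod.snd = e'.hom ≫ biprod.snd := by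
    rw [← cancel_mono (S.d₂⟦(1 : ℤ)⟧' ≫ Qh₁.unit⟦(1 : ℤ)⟧'), Category.assoc, Category.assoc,
      he.2, he'.2]
  have h₃ : e.inv ≫ e'.hom ≫ biprod.snd = biprod.snd := by
    rw [← h₂, e.inv_hom_id_assoc]
  have h₁ : biprod.inl ≫ e.inv ≫ e'.hom = biprod.inl := by
    rw [← cancel_epi S.ε, ← reassoc_of% he.1, e.hom_inv_id_assoc, he'.1]
  have h : e.inv ≫ e'.hom = 𝟙 _ := by
    ext
    · simp [reassoc_of% h₁]
    · simp [h₃]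
    · exact (E.odd_even_zero (E.odd_shift hM₁) (E.even_of_epi S.ε hQ₀) _).trans
        (E.odd_even_zero (E.odd_shift hM₁) (E.even_of_epi S.ε hQ₀) _).symm
    · simp [h₃]
  ext1
  rw [← cancel_epi e.inv, h, e.inv_hom_id]

/-- The extension of M₁[1] by M₀ splits because M₁[1] is projective; parity leaves only one
compatible splitting. -/
lemma existsUnique_isConeSplitting [Projective M₁] [IsIso Qh₁.unit] [IsIso Qh₀.unit]
    (E : ParityDecomposition A) (hM₁ : E.even M₁) (hQ₀ : E.even S.Q₀)
    (hX : Triangle.mk (Qh₁.map Qh₀ S.d₁) p r ∈ distTriang T) :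
    ∃! e : F.obj X ≅ M₀ ⊞ M₁⟦(1 : ℤ)⟧, IsConeSplitting F S Qh₁ Qh₀ p r e := by
  have := S.epi_ε
  have := S.mono_d₂
  have := projective_shift M₁ 1
  obtain ⟨s, t, w, h, hs, ht⟩ := exists_shortExact_cone S Qh₁ Qh₀ hX
  have : Projective (ShortComplex.mk s t w).X₃ := this
  let σ := h.splittingOfProjective
  have hσ : IsConeSplitting F S Qh₁ Qh₀ p r σ.isoBinaryBiproduct := by
    constructor
    · rw [← reassoc_of% hs]
      congr 1
      change s ≫ biprod.lift σ.r t = _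
      ext
      · simpa using σ.f_r
      · simpa using w
    · rw [← ht]
      change biprod.lift σ.r t ≫ _ = _
      simp
  exact ⟨_, hσ, fun e he => he.eq S Qh₁ Qh₀ E hM₁ hQ₀ hσ⟩

end ConeHomology
/-! ### Cones and direct sums -/

section Triangulated

variable {T : Type u₁} [Category.{v₁} T] [HasZeroObject T] [HasShift T ℤ] [Preadditive T]
  [∀ n : ℤ, (shiftFunctor T n).Additive] [Pretriangulated T]

lemma distinguished_inl_snd (X Y : T) :
    Triangle.mk (biprod.inl : X ⟶ X ⊞ Y) biprod.snd 0 ∈ distTriang T :=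
  binaryBiproductTriangle_distinguished X Y

lemma distinguished_inr_fst (X Y : T) :
    Triangle.mk (biprod.inr : Y ⟶ X ⊞ Y) biprod.fst 0 ∈ distTriang T := by
  refine isomorphic_distinguished _ (distinguished_inl_snd Y X) _
    (Triangle.isoMk _ _ (Iso.refl _) (biprod.braiding X Y) (Iso.refl _) ?_ ?_ ?_)
  · change biprod.inr ≫ biprod.lift biprod.snd biprod.fst = 𝟙 Y ≫ biprod.inl
    ext <;> simp
  · change biprod.fst ≫ 𝟙 X = biprod.lift biprod.snd biprod.fst ≫ biprod.snd
    simp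
  · exact zero_comp.trans comp_zero.symm

/-- Distinguished triangles on the same morphism are isomorphic. -/
lemma exists_cone_iso {X₁ X₂ Y Z : T} {f : X₁ ⟶ X₂} {g : X₂ ⟶ Y} {h : Y ⟶ X₁⟦(1 : ℤ)⟧}
    {g' : X₂ ⟶ Z} {h' : Z ⟶ X₁⟦(1 : ℤ)⟧} (hY : Triangle.mk f g h ∈ distTriang T)
    (hZ : Triangle.mk f g' h' ∈ distTriang T) :
    ∃ α : Y ≅ Z, g ≫ α.hom = g' ∧ h = α.hom ≫ h' := by
  let e := isoTriangleOfIso₁₂ _ _ hY hZ (Iso.refl X₁) (Iso.refl X₂)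
    ((Category.comp_id f).trans (Category.id_comp f).symm)
  have h₁ : e.hom.hom₁ = 𝟙 X₁ := rfl
  have h₂ : e.hom.hom₂ = 𝟙 X₂ := rfl
  refine ⟨Triangle.π₃.mapIso e, ?_, ?_⟩
  · have := e.hom.comm₂
    rw [h₂] at this
    exact this.trans (Category.id_comp _)
  · have := e.hom.comm₃
    rw [h₁] at this
    refine Eq.trans ?_ this
    change h = h ≫ (𝟙 X₁)⟦(1 : ℤ)⟧'
    simp

/-- Replacing the cone by an isomorphic object. -/
lemma distinguished_of_iso₃ {X₁ X₂ Y Z : T} {f : X₁ ⟶ X₂} {g : X₂ ⟶ Y} {h : Y ⟶ X₁⟦(1 : ℤ)⟧}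
    (hY : Triangle.mk f g h ∈ distTriang T) (α : Y ≅ Z) :
    Triangle.mk f (g ≫ α.hom) (α.inv ≫ h) ∈ distTriang T := by
  refine isomorphic_distinguished _ hY _
    (Triangle.isoMk _ _ (Iso.refl _) (Iso.refl _) α.symm ?_ ?_ ?_)
  · exact (Category.comp_id f).trans (Category.id_comp f).symm
  · change (g ≫ α.hom) ≫ α.inv = 𝟙 _ ≫ g
    simp
  · change (α.inv ≫ h) ≫ (𝟙 X₁)⟦(1 : ℤ)⟧' = α.inv ≫ h
    simp

variable [IsTriangulated T]

/-- Two morphisms that agree on the cokernel of split triangles have the same cones as the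
morphism that they induce on the first objects. -/
lemma exists_cone_of_split {A₁ X₁ A₂ X₂ X₃ X : T} {i₁ : A₁ ⟶ X₁} {u : X₁ ⟶ X₂} {s : X₂ ⟶ X₃}
    {δ₁ : X₃ ⟶ A₁⟦(1 : ℤ)⟧} {i₂ : A₂ ⟶ X₂} {δ₂ : X₃ ⟶ A₂⟦(1 : ℤ)⟧} {a : A₁ ⟶ A₂}
    {p : A₂ ⟶ X} {r : X ⟶ A₁⟦(1 : ℤ)⟧}
    (h₁ : Triangle.mk i₁ (u ≫ s) δ₁ ∈ distTriang T) (h₂ : Triangle.mk i₂ s δ₂ ∈ distTriang T)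
    [Mono (i₂⟦(1 : ℤ)⟧')] (ha : a ≫ i₂ = i₁ ≫ u) (h : Triangle.mk a p r ∈ distTriang T) :
    ∃ (p₂ : X₂ ⟶ X) (r₂ : X ⟶ X₁⟦(1 : ℤ)⟧), Triangle.mk u p₂ r₂ ∈ distTriang T ∧
      i₂ ≫ p₂ = p ∧ p₂ ≫ r = -(s ≫ δ₁) := by
  obtain ⟨Y, v, l, hY⟩ := distinguished_cocone_triangle u
  have h₁' : Triangle.mk (u ≫ s) δ₁ (-i₁⟦(1 : ℤ)⟧') ∈ distTriang T := rot_of_distTriang _ h₁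
  have h₂' : Triangle.mk s δ₂ (-i₂⟦(1 : ℤ)⟧') ∈ distTriang T := rot_of_distTriang _ h₂
  -- The cones of `u`, `s` and `u ≫ s` are `Y`, A₂[1] and A₁[1]. The octahedron gives a triangle Y →
  -- A₁[1] → A₂[1], whose second morphism must be a[1] because i₂[1] is monic.
  let o := Triangulated.someOctahedron rfl hY h₂' h₁'
  have hm : o.m₃ = a⟦(1 : ℤ)⟧' := by
    rw [← cancel_mono (i₂⟦(1 : ℤ)⟧'), ← Functor.map_comp, ha, Functor.map_comp]
    have := o.comm₄
    rwa [Preadditive.neg_comp, Preadditive.comp_neg, neg_inj, eq_comm] at this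
  have hmem : Triangle.mk o.m₁ o.m₃ ((-i₂⟦(1 : ℤ)⟧') ≫ v⟦(1 : ℤ)⟧') ∈ distTriang T := o.mem
  have hd : Triangle.mk a (i₂ ≫ v) (-o.m₁) ∈ distTriang T := by
    rw [Pretriangulated.rotate_distinguished_triangle,
      Pretriangulated.rotate_distinguished_triangle]
    let n : A₁⟦(1 : ℤ)⟧ ≅ A₁⟦(1 : ℤ)⟧ := ⟨-𝟙 _, -𝟙 _, by simp, by simp⟩
    refine isomorphic_distinguished _ hmem _
      (Triangle.isoMk _ _ (Iso.refl _) n (Iso.refl _) ?_ ?_ ?_)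
    · change (-o.m₁) ≫ (-𝟙 (A₁⟦(1 : ℤ)⟧)) = 𝟙 Y ≫ o.m₁
      simp
    · change (-a⟦(1 : ℤ)⟧') ≫ 𝟙 (A₂⟦(1 : ℤ)⟧) = (-𝟙 (A₁⟦(1 : ℤ)⟧)) ≫ o.m₃
      simp [hm]
    · change (-(i₂ ≫ v)⟦(1 : ℤ)⟧') ≫ (𝟙 Y)⟦(1 : ℤ)⟧' =
        𝟙 (A₂⟦(1 : ℤ)⟧) ≫ (-i₂⟦(1 : ℤ)⟧') ≫ v⟦(1 : ℤ)⟧'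
      simp
  obtain ⟨α, hα₁, hα₂⟩ := exists_cone_iso hd h
  refine ⟨v ≫ α.hom, α.inv ≫ l, distinguished_of_iso₃ hY α, by rw [← hα₁, Category.assoc], ?_⟩
  rw [Category.assoc, ← hα₂, Preadditive.comp_neg, o.comm₁]

/-- The cone of `biprod.lift ψ w`, where `w` is the connecting morphism of a cone of `d₂`. -/
lemma exists_cone_lift {M Q₁ Q₀ D X : T} {d₂ : M ⟶ Q₁} {q : Q₁ ⟶ D} {w : D ⟶ M⟦(1 : ℤ)⟧}
    {d₁ : Q₁ ⟶ Q₀} {ψ : D ⟶ Q₀} {p : Q₀ ⟶ X} {r : X ⟶ Q₁⟦(1 : ℤ)⟧}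
    (hD : Triangle.mk d₂ q w ∈ distTriang T) (hψ : q ≫ ψ = d₁)
    (hX : Triangle.mk d₁ p r ∈ distTriang T) :
    ∃ (p₂ : Q₀ ⊞ M⟦(1 : ℤ)⟧ ⟶ X) (r₂ : X ⟶ D⟦(1 : ℤ)⟧),
      Triangle.mk (biprod.lift ψ w) p₂ r₂ ∈ distTriang T ∧
      biprod.inl ≫ p₂ = p ∧ p₂ ≫ r = biprod.snd ≫ d₂⟦(1 : ℤ)⟧' := by
  have h₁ : Triangle.mk q (biprod.lift ψ w ≫ biprod.snd) (-d₂⟦(1 : ℤ)⟧') ∈ distTriang T := by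
    rw [biprod.lift_snd]
    exact rot_of_distTriang _ hD
  have hqw : q ≫ w = 0 := comp_distTriang_mor_zero₂₃ _ hD
  -- Projecting to M[1] gives `w` on `D` and `biprod.snd` on the target. The fibres are `Q₁` and
  -- `Q₀`, with `d₁` induced between them.
  obtain ⟨p₂, r₂, h, e₁, e₂⟩ := exists_cone_of_split h₁
    (distinguished_inl_snd Q₀ (M⟦(1 : ℤ)⟧)) (a := d₁) (by ext <;> simp [hψ, hqw]) hX
  exact ⟨p₂, r₂, h, e₁, by simpa using e₂⟩

/-- Projection to the common summand `Q` has fibres `Q₁` and `Q₀` on the two sides, so the extra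
identity does not change the cone. -/
lemma exists_cone_map_id_right {Q₁ Q₀ X : T} {d : Q₁ ⟶ Q₀} {p : Q₀ ⟶ X} {r : X ⟶ Q₁⟦(1 : ℤ)⟧}
    (hX : Triangle.mk d p r ∈ distTriang T) (Q : T) :
    ∃ r₂ : X ⟶ (Q₁ ⊞ Q)⟦(1 : ℤ)⟧,
      Triangle.mk (biprod.map d (𝟙 Q)) (biprod.fst ≫ p) r₂ ∈ distTriang T := by
  have h₁ : Triangle.mk biprod.inl (biprod.map d (𝟙 Q) ≫ biprod.snd) 0 ∈ distTriang T := by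
    rw [biprod.map_snd, Category.comp_id]
    exact distinguished_inl_snd Q₁ Q
  obtain ⟨p₂, r₂, h, e₁, -⟩ := exists_cone_of_split h₁ (distinguished_inl_snd Q₀ Q) (by simp) hX
  have h₀ : biprod.map d (𝟙 Q) ≫ p₂ = 0 := comp_distTriang_mor_zero₁₂ _ h
  have : p₂ = biprod.fst ≫ p := by
    ext
    · simp [e₁]
    · simpa using biprod.inr ≫= h₀
  exact ⟨r₂, this ▸ h⟩

lemma exists_cone_map_id_left {Q₁ Q₀ X : T} {d : Q₁ ⟶ Q₀} {p : Q₀ ⟶ X} {r : X ⟶ Q₁⟦(1 : ℤ)⟧}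
    (hX : Triangle.mk d p r ∈ distTriang T) (Q : T) :
    ∃ r₂ : X ⟶ (Q ⊞ Q₁)⟦(1 : ℤ)⟧,
      Triangle.mk (biprod.map (𝟙 Q) d) (biprod.snd ≫ p) r₂ ∈ distTriang T := by
  have h₁ : Triangle.mk biprod.inr (biprod.map (𝟙 Q) d ≫ biprod.fst) 0 ∈ distTriang T := by
    rw [biprod.map_fst, Category.comp_id]
    exact distinguished_inr_fst Q Q₁
  obtain ⟨p₂, r₂, h, e₁, -⟩ := exists_cone_of_split h₁ (distinguished_inr_fst Q Q₀) (by simp) hX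
  have h₀ : biprod.map (𝟙 Q) d ≫ p₂ = 0 := comp_distTriang_mor_zero₁₂ _ h
  have : p₂ = biprod.snd ≫ p := by
    ext
    · simpa using biprod.inl ≫= h₀
    · simp [e₁]
  exact ⟨r₂, this ▸ h⟩

/-- The cone of `ψ ≫ biprod.inl`. -/
lemma exists_cone_comp_inl {D Q C : T} {ψ : D ⟶ Q} {g : Q ⟶ C} {h : C ⟶ D⟦(1 : ℤ)⟧}
    (hC : Triangle.mk ψ g h ∈ distTriang T) (N : T) :
    ∃ (p₁ : Q ⊞ N ⟶ C ⊞ N) (r₁ : C ⊞ N ⟶ D⟦(1 : ℤ)⟧),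
      Triangle.mk (ψ ≫ biprod.inl) p₁ r₁ ∈ distTriang T ∧
      biprod.inl ≫ p₁ = g ≫ biprod.inl ∧ p₁ ≫ biprod.snd = biprod.snd := by
  obtain ⟨K, v, l, hK⟩ := distinguished_cocone_triangle (ψ ≫ (biprod.inl : Q ⟶ Q ⊞ N))
  -- The resulting triangle C → K → N has zero connecting morphism, so it splits.
  let o := Triangulated.someOctahedron rfl hC (distinguished_inl_snd Q N) hK
  obtain ⟨e, he₁, he₂⟩ : ∃ e : K ≅ C ⊞ N, o.m₁ ≫ e.hom = biprod.inl ∧ o.m₃ = e.hom ≫ biprod.snd :=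
    exists_iso_binaryBiproduct_of_distTriang _ o.mem zero_comp
  refine ⟨v ≫ e.hom, e.inv ≫ l, distinguished_of_iso₃ hK e, ?_, ?_⟩
  · rw [← Category.assoc, ← o.comm₁, Category.assoc, he₁]
  · rw [Category.assoc, ← he₂]
    exact o.comm₃

end Triangulated
/-! ### Adding a direct summand to a two-step extension -/

namespace TwoStepExtension

variable {A : Type u₂} [Category.{v₂} A] [Abelian A] {M₁ M₀ M N : A} (S : TwoStepExtension M₁ M₀)
  (e : M ≅ M₀ ⊞ N)

/-- The extension `M₁ ⟶ Q₁ ⟶ Q₀ ⊞ N ⟶ M` for `M ≅ M₀ ⊞ N`. -/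
noncomputable def addSummand : TwoStepExtension M₁ M where
  Q₁ := S.Q₁
  Q₀ := S.Q₀ ⊞ N
  d₂ := S.d₂
  d₁ := S.d₁ ≫ biprod.inl
  ε := biprod.map S.ε (𝟙 N) ≫ e.inv
  d₂_d₁ := by rw [← Category.assoc, S.d₂_d₁, zero_comp]
  d₁_ε := by simp [reassoc_of% S.d₁_ε]
  mono_d₂ := S.mono_d₂
  exact₁ := by
    let φ : ShortComplex.mk S.d₂ S.d₁ S.d₂_d₁ ⟶ ShortComplex.mk S.d₂ (S.d₁ ≫ biprod.inl)
        (by rw [← Category.assoc, S.d₂_d₁, zero_comp] : _ = (0 : M₁ ⟶ S.Q₀ ⊞ N)) :=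
      { τ₁ := 𝟙 _, τ₂ := 𝟙 _, τ₃ := biprod.inl }
    have : Epi φ.τ₁ := inferInstanceAs (Epi (𝟙 M₁))
    have : IsIso φ.τ₂ := inferInstanceAs (IsIso (𝟙 S.Q₁))
    have : Mono φ.τ₃ := inferInstanceAs (Mono (biprod.inl : S.Q₀ ⟶ S.Q₀ ⊞ N))
    exact (ShortComplex.exact_iff_of_epi_of_isIso_of_mono φ).1 S.exact₁
  exact₀ := by
    rw [ShortComplex.exact_iff_exact_up_to_refinements]
    intro V (x : V ⟶ S.Q₀ ⊞ N) (hx : x ≫ biprod.map S.ε (𝟙 N) ≫ e.inv = 0)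
    have hx' : x ≫ biprod.map S.ε (𝟙 N) = 0 := by
      rw [← cancel_mono e.inv, Category.assoc, hx, zero_comp]
    have h₁ : (x ≫ biprod.fst) ≫ S.ε = 0 := by simpa using hx' =≫ biprod.fst
    have h₂ : x ≫ biprod.snd = 0 := by simpa using hx' =≫ biprod.snd
    obtain ⟨V', π, hπ, y, hy⟩ := S.exact₀.exact_up_to_refinements _ h₁
    refine ⟨V', π, hπ, y, ?_⟩
    change π ≫ x = y ≫ S.d₁ ≫ biprod.inl
    have hy' : π ≫ x ≫ biprod.fst = y ≫ S.d₁ := hy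
    ext
    · simpa using hy'
    · simp [h₂]
  epi_ε := by
    have := S.epi_ε
    infer_instance

/-- The inclusion of the syzygy, with its target spelled out. -/
noncomputable def addSummandι : (S.addSummand e).syzygy ⟶ S.Q₀ ⊞ N := (S.addSummand e).ι

lemma addSummandι_map : S.addSummandι e ≫ biprod.map S.ε (𝟙 N) = 0 := by
  have h : S.addSummandι e ≫ biprod.map S.ε (𝟙 N) ≫ e.inv = 0 := (S.addSummand e).ι_ε
  rw [← cancel_mono e.inv, zero_comp, Category.assoc, h]

lemma addSummandι_snd : S.addSummandι e ≫ biprod.snd = 0 := by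
  simpa using S.addSummandι_map e =≫ biprod.snd

/-- The morphism between the syzygies induced by the projection `Q₀ ⊞ N ⟶ Q₀`. -/
noncomputable def addSummandSyzygyHom : (S.addSummand e).syzygy ⟶ S.syzygy :=
  kernel.lift _ (S.addSummandι e ≫ biprod.fst) (by simpa using S.addSummandι_map e =≫ biprod.fst)

/-- The morphism between the syzygies induced by the inclusion `Q₀ ⟶ Q₀ ⊞ N`. -/
noncomputable def addSummandSyzygyInv : S.syzygy ⟶ (S.addSummand e).syzygy :=
  kernel.lift _ (S.ι ≫ (biprod.inl : S.Q₀ ⟶ S.Q₀ ⊞ N)) (by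
    change (S.ι ≫ biprod.inl) ≫ biprod.map S.ε (𝟙 N) ≫ e.inv = 0
    simp [reassoc_of% S.ι_ε])

lemma addSummandSyzygyHom_ι :
    S.addSummandSyzygyHom e ≫ S.ι = S.addSummandι e ≫ biprod.fst :=
  kernel.lift_ι _ _ _

lemma addSummandSyzygyInv_ι :
    S.addSummandSyzygyInv e ≫ S.addSummandι e = S.ι ≫ biprod.inl :=
  kernel.lift_ι _ _ _

/-- The syzygies are isomorphic. -/
noncomputable def addSummandSyzygyIso : (S.addSummand e).syzygy ≅ S.syzygy where
  hom := S.addSummandSyzygyHom e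
  inv := S.addSummandSyzygyInv e
  hom_inv_id := by
    have : Mono (S.addSummandι e) := inferInstanceAs (Mono (kernel.ι (S.addSummand e).ε))
    rw [← cancel_mono (S.addSummandι e), Category.assoc, addSummandSyzygyInv_ι,
      reassoc_of% S.addSummandSyzygyHom_ι e]
    ext
    · simp
    · simp [S.addSummandι_snd e]
  inv_hom_id := by
    have : Mono S.ι := inferInstanceAs (Mono (kernel.ι S.ε))
    rw [← cancel_mono S.ι, Category.assoc, addSummandSyzygyHom_ι,
      reassoc_of% S.addSummandSyzygyInv_ι e]
    simp

/-- The projection Q₀ ⊞ N → Q₀ is part of a morphism of extensions that is invertible on syzygies,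
so the enlarged extension is the pullback of the old one along M → M₀. -/
lemma addSummand_extClass₀ [HasExt.{w} A] :
    (S.addSummand e).shortExact₀.extClass.comp
        (Ext.mk₀ (S.addSummandSyzygyIso e).hom) (add_zero 1) =
      (Ext.mk₀ (e.hom ≫ biprod.fst)).comp S.shortExact₀.extClass (zero_add 1) := by
  let φ : ShortComplex.mk (S.addSummand e).ι (S.addSummand e).ε (S.addSummand e).ι_ε ⟶
      ShortComplex.mk S.ι S.ε S.ι_ε :=
    { τ₁ := (S.addSummandSyzygyIso e).hom
      τ₂ := (biprod.fst : S.Q₀ ⊞ N ⟶ S.Q₀)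
      τ₃ := e.hom ≫ biprod.fst
      comm₁₂ := S.addSummandSyzygyHom_ι e
      comm₂₃ := by
        change biprod.fst ≫ S.ε = (biprod.map S.ε (𝟙 N) ≫ e.inv) ≫ e.hom ≫ biprod.fst
        simp }
  exact ShortComplex.ShortExact.extClass_naturality (S.addSummand e).shortExact₀ S.shortExact₀ φ

end TwoStepExtension

/-! ### The image of a direct sum -/

section Biprod

variable {T : Type u₁} [Category.{v₁} T] [Preadditive T] [HasBinaryBiproducts T]
  {A : Type u₂} [Category.{v₂} A] [Abelian A] (F : T ⥤ A) [F.Additive] {X Y : T} {X' Y' : A}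

lemma map_biprod_hom_ext {Z : A} {f g : F.obj (X ⊞ Y) ⟶ Z}
    (h₁ : F.map biprod.inl ≫ f = F.map biprod.inl ≫ g)
    (h₂ : F.map biprod.inr ≫ f = F.map biprod.inr ≫ g) : f = g := by
  rw [← Category.id_comp f, ← Category.id_comp g, ← F.map_id, ← biprod.total, F.map_add,
    F.map_comp, F.map_comp, Preadditive.add_comp, Preadditive.add_comp, Category.assoc,
    Category.assoc, Category.assoc, Category.assoc, h₁, h₂]

/-- The isomorphism `F (X ⊞ Y) ≅ X' ⊞ Y'` induced by isomorphisms `F X ≅ X'` and `F Y ≅ Y'`. -/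
noncomputable def mapBiprodIso (i : F.obj X ≅ X') (j : F.obj Y ≅ Y') :
    F.obj (X ⊞ Y) ≅ X' ⊞ Y' where
  hom := biprod.lift (F.map biprod.fst ≫ i.hom) (F.map biprod.snd ≫ j.hom)
  inv := biprod.desc (i.inv ≫ F.map biprod.inl) (j.inv ≫ F.map biprod.inr)
  hom_inv_id := by
    simp only [biprod.lift_desc, Category.assoc, Iso.hom_inv_id_assoc, ← F.map_comp, ← F.map_add,
      biprod.total, F.map_id]
  inv_hom_id := by
    ext <;> simp [← F.map_comp_assoc]

lemma map_inl_mapBiprodIso_hom (i : F.obj X ≅ X') (j : F.obj Y ≅ Y') :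
    F.map biprod.inl ≫ (mapBiprodIso F i j).hom = i.hom ≫ biprod.inl := by
  ext <;> simp [mapBiprodIso, ← F.map_comp_assoc]

lemma map_inr_mapBiprodIso_hom (i : F.obj X ≅ X') (j : F.obj Y ≅ Y') :
    F.map biprod.inr ≫ (mapBiprodIso F i j).hom = j.hom ≫ biprod.inr := by
  ext <;> simp [mapBiprodIso, ← F.map_comp_assoc]

lemma mapBiprodIso_hom_snd (i : F.obj X ≅ X') (j : F.obj Y ≅ Y') :
    (mapBiprodIso F i j).hom ≫ biprod.snd = F.map biprod.snd ≫ j.hom := by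
  simp [mapBiprodIso]

lemma inl_mapBiprodIso_inv (i : F.obj X ≅ X') (j : F.obj Y ≅ Y') :
    biprod.inl ≫ (mapBiprodIso F i j).inv = i.inv ≫ F.map biprod.inl := by
  simp [mapBiprodIso]

lemma inr_mapBiprodIso_inv (i : F.obj X ≅ X') (j : F.obj Y ≅ Y') :
    biprod.inr ≫ (mapBiprodIso F i j).inv = j.inv ≫ F.map biprod.inr := by
  simp [mapBiprodIso]

end Biprod

section Cokernel

variable {T : Type u₁} [Category.{v₁} T] [HasZeroObject T] [HasShift T ℤ] [Preadditive T]
  [∀ n : ℤ, (shiftFunctor T n).Additive] [Pretriangulated T]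
  {A : Type u₂} [Category.{v₂} A] [Abelian A] [HasShift A ℤ]
  [∀ n : ℤ, (shiftFunctor A n).Additive]
  {F : T ⥤ A} [F.CommShift ℤ] [F.IsHomological]

lemma mono_map_shift {X Y : T} (f : X ⟶ Y) [Mono (F.map f)] (n : ℤ) : Mono (F.map (f⟦n⟧')) := by
  have h : F.map (f⟦n⟧') = (F.commShiftIso n).hom.app X ≫ (F.map f)⟦n⟧' ≫
      (F.commShiftIso n).inv.app Y := by
    rw [← F.commShiftIso_hom_naturality_assoc]
    simp
  rw [h]
  infer_instance

/-- If `F u` is a monomorphism, then the connecting morphism is killed by `F`. -/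
lemma map_mor₃_eq_zero_of_mono {X Y Z : T} {u : X ⟶ Y} {v : Y ⟶ Z} {l : Z ⟶ X⟦(1 : ℤ)⟧}
    (h : Triangle.mk u v l ∈ distTriang T) [Mono (F.map u)] : F.map l = 0 := by
  have := mono_map_shift (F := F) u 1
  rw [← cancel_mono (F.map (u⟦(1 : ℤ)⟧')), ← F.map_comp,
    show l ≫ u⟦(1 : ℤ)⟧' = 0 from comp_distTriang_mor_zero₃₁ _ h]
  simp

lemma shortExact_of_mono {X Y Z : T} {u : X ⟶ Y} {v : Y ⟶ Z} {l : Z ⟶ X⟦(1 : ℤ)⟧}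
    (h : Triangle.mk u v l ∈ distTriang T) [hu : Mono (F.map u)] :
    ∃ w : F.map u ≫ F.map v = 0, (ShortComplex.mk _ _ w).ShortExact := by
  have hl : F.map l = 0 := map_mor₃_eq_zero_of_mono h
  have hv : Epi (F.map v) :=
    (F.map_distinguished_exact _ (rot_of_distTriang _ h)).epi_f_iff.2 hl
  refine ⟨?_, { exact := F.map_distinguished_exact _ h }⟩
  rw [← F.map_comp, show u ≫ v = 0 from comp_distTriang_mor_zero₁₂ _ h, F.map_zero]

/-- The image of a cone as a cokernel. -/
lemma exists_iso_of_shortExact {X Y Z : T} {u : X ⟶ Y} {v : Y ⟶ Z} {l : Z ⟶ X⟦(1 : ℤ)⟧}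
    (h : Triangle.mk u v l ∈ distTriang T) {K L N : A} {a : K ⟶ L} {b : L ⟶ N} {w : a ≫ b = 0}
    (hab : (ShortComplex.mk a b w).ShortExact) (α : K ≅ F.obj X) (β : L ≅ F.obj Y)
    (hαβ : α.hom ≫ F.map u = a ≫ β.hom) :
    Mono (F.map u) ∧ ∃ j : F.obj Z ≅ N, β.hom ≫ F.map v ≫ j.hom = b := by
  have hα : F.map u = α.inv ≫ a ≫ β.hom := by rw [← hαβ, Iso.inv_hom_id_assoc]
  have : Mono a := hab.mono_f
  have hb : Epi b := hab.epi_g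
  have hu : Mono (F.map u) := by rw [hα]; infer_instance
  obtain ⟨w', hw'⟩ := shortExact_of_mono (F := F) h
  have : Epi (F.map v) := hw'.epi_g
  refine ⟨hu, ⟨hw'.exact.desc (β.inv ≫ b) ?_, hab.exact.desc (β.hom ≫ F.map v) ?_, ?_, ?_⟩, ?_⟩
  · change F.map u ≫ β.inv ≫ b = 0
    rw [hα]
    simp [w]
  · change a ≫ β.hom ≫ F.map v = 0
    rw [← reassoc_of% hαβ, w', comp_zero]
  · rw [← cancel_epi (F.map v)]
    refine (hw'.exact.g_desc_assoc _ _ _).trans ?_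
    rw [Category.assoc]
    refine (congrArg _ (hab.exact.g_desc _ _)).trans ?_
    simp
  · rw [← cancel_epi b]
    refine (hab.exact.g_desc_assoc _ _ _).trans ?_
    rw [Category.assoc]
    refine (congrArg _ (hw'.exact.g_desc _ _)).trans ?_
    simp
  · refine (congrArg _ (hw'.exact.g_desc _ _)).trans ?_
    simp

end Cokernel
/-! ### The obstruction class of the cone -/

section FourSummandsFormula

variable {A : Type u₂} [Category.{v₂} A] [Abelian A] [HasShift A ℤ]
  [∀ n : ℤ, (shiftFunctor A n).Additive] {N M₀ M₁ : A} (e : N ≅ M₀ ⊞ M₁⟦(1 : ℤ)⟧)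

/-- The inclusion `M₁ ⟶ N[-1]` induced by `e : N ≅ M₀ ⊞ M₁[1]`. -/
noncomputable def shiftInclusion : M₁ ⟶ N⟦(-1 : ℤ)⟧ :=
  (shiftFunctorCompIsoId A (1 : ℤ) (-1) (by norm_num)).inv.app M₁ ≫
    (biprod.inr ≫ e.inv)⟦(-1 : ℤ)⟧'

lemma shiftSplitting_hom_fst : (shiftSplitting e).hom ≫ biprod.fst =
    (e.hom ≫ biprod.fst)⟦(-1 : ℤ)⟧' := by
  change (e.hom⟦(-1 : ℤ)⟧' ≫ biprod.lift (biprod.fst⟦(-1 : ℤ)⟧') (biprod.snd⟦(-1 : ℤ)⟧') ≫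
    biprod.map (𝟙 _) ((shiftFunctorCompIsoId A (1 : ℤ) (-1) (by norm_num)).hom.app M₁)) ≫
      biprod.fst = _
  rw [Category.assoc, Category.assoc, biprod.map_fst, biprod.lift_fst_assoc, Category.comp_id,
    Functor.map_comp]

lemma shiftSplitting_hom_snd : (shiftSplitting e).hom ≫ biprod.snd =
    (e.hom ≫ biprod.snd)⟦(-1 : ℤ)⟧' ≫
      (shiftFunctorCompIsoId A (1 : ℤ) (-1) (by norm_num)).hom.app M₁ := by
  change (e.hom⟦(-1 : ℤ)⟧' ≫ biprod.lift (biprod.fst⟦(-1 : ℤ)⟧') (biprod.snd⟦(-1 : ℤ)⟧') ≫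
    biprod.map (𝟙 _) ((shiftFunctorCompIsoId A (1 : ℤ) (-1) (by norm_num)).hom.app M₁)) ≫
      biprod.snd = _
  rw [Category.assoc, Category.assoc, biprod.map_snd, biprod.lift_snd_assoc,
    Functor.map_comp_assoc]

lemma shiftInclusion_shiftSplitting : shiftInclusion e ≫ (shiftSplitting e).hom = biprod.inr := by
  ext
  · rw [Category.assoc, shiftSplitting_hom_fst, shiftInclusion, Category.assoc,
      ← Functor.map_comp, Category.assoc, e.inv_hom_id_assoc, biprod.inr_fst, Functor.map_zero,
      comp_zero, biprod.inr_fst]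
  · rw [Category.assoc, shiftSplitting_hom_snd, shiftInclusion, Category.assoc,
      ← Functor.map_comp_assoc, Category.assoc, e.inv_hom_id_assoc, biprod.inr_snd,
      CategoryTheory.Functor.map_id, Category.id_comp, Iso.inv_hom_id_app, biprod.inr_snd]
    rfl

/-- A class routed through N → M₀ and M₁ → N[-1] has just one nonzero matrix entry. This is the
shape in which the obstruction class of the cone is computed. -/
lemma extFourSummands_apply [HasExt.{w} A] (z : Ext M₀ M₁ 2) :
    extFourSummands e ((Ext.mk₀ (e.hom ≫ biprod.fst)).comp
      (z.comp (Ext.mk₀ (shiftInclusion e)) (add_zero 2)) (zero_add 2)) = ((0, z), (0, 0)) := by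
  have h : extCongr e (shiftSplitting e) 2 ((Ext.mk₀ (e.hom ≫ biprod.fst)).comp
      (z.comp (Ext.mk₀ (shiftInclusion e)) (add_zero 2)) (zero_add 2)) =
      (Ext.mk₀ biprod.fst).comp (z.comp (Ext.mk₀ biprod.inr) (add_zero 2)) (zero_add 2) := by
    change (Ext.mk₀ e.inv).comp (Ext.comp _ (Ext.mk₀ (shiftSplitting e).hom) (add_zero 2))
      (zero_add 2) = _
    rw [Ext.comp_assoc_of_third_deg_zero, Ext.comp_assoc_of_third_deg_zero, Ext.mk₀_comp_mk₀,
      shiftInclusion_shiftSplitting, Ext.mk₀_comp_mk₀_assoc, e.inv_hom_id_assoc]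
  change (Ext.addEquivBiprod.prodCongr Ext.addEquivBiprod)
    (Ext.biprodAddEquiv (extCongr e (shiftSplitting e) 2 _)) = _
  rw [h]
  refine Prod.ext (Prod.ext ?_ ?_) (Prod.ext ?_ ?_)
  · change ((Ext.mk₀ biprod.inl).comp _ (zero_add 2)).comp (Ext.mk₀ biprod.fst) (add_zero 2) = 0
    simp
  · change ((Ext.mk₀ biprod.inl).comp _ (zero_add 2)).comp (Ext.mk₀ biprod.snd) (add_zero 2) = z
    simp
  · change ((Ext.mk₀ biprod.inr).comp _ (zero_add 2)).comp (Ext.mk₀ biprod.fst) (add_zero 2) = 0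
    simp
  · change ((Ext.mk₀ biprod.inr).comp _ (zero_add 2)).comp (Ext.mk₀ biprod.snd) (add_zero 2) = 0
    simp

end FourSummandsFormula

section Cone

variable {T : Type u₁} [Category.{v₁} T] [HasZeroObject T] [HasShift T ℤ] [Preadditive T]
  [∀ n : ℤ, (shiftFunctor T n).Additive] [Pretriangulated T]
  {A : Type u₂} [Category.{v₂} A] [Abelian A] [HasShift A ℤ]
  [∀ n : ℤ, (shiftFunctor A n).Additive]
  {I : MorphismProperty T} {F : T ⥤ A} [F.CommShift ℤ] [F.IsHomological]

/-- The isomorphism `F (R̂[n]) ≅ R[n]`. -/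
noncomputable def AdjointObj.shiftIso {R : A} (R' : AdjointObj F R) [IsIso R'.unit] (n : ℤ) :
    F.obj (R'.obj⟦n⟧) ≅ R⟦n⟧ :=
  (F.commShiftIso n).app R'.obj ≪≫ ((shiftFunctor A n).mapIso (asIso R'.unit)).symm

lemma AdjointObj.shiftIso_hom {R : A} (R' : AdjointObj F R) [IsIso R'.unit] (n : ℤ) :
    (R'.shiftIso n).hom = (F.commShiftIso n).hom.app R'.obj ≫ (inv R'.unit)⟦n⟧' := by
  simp [AdjointObj.shiftIso]

lemma AdjointObj.shiftIso_hom_unit {R : A} (R' : AdjointObj F R) [IsIso R'.unit] (n : ℤ) :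
    (R'.shiftIso n).hom ≫ R'.unit⟦n⟧' = (F.commShiftIso n).hom.app R'.obj := by
  rw [R'.shiftIso_hom, Category.assoc, ← Functor.map_comp, IsIso.inv_hom_id]
  simp

variable {M₁ M₀ : A} (S : TwoStepExtension M₁ M₀) (Mh : AdjointObj F M₁)
  (Qh₁ : AdjointObj F S.Q₁) [IsIso Mh.unit] [IsIso Qh₁.unit]

/-- The class attached to the connecting morphism of a cone of `d̂₂`. -/
lemma uctClass_connecting [HasExt.{w} A] {D : T} {q : Qh₁.obj ⟶ D} {d : D ⟶ Mh.obj⟦(1 : ℤ)⟧}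
    (hD : Triangle.mk (Mh.map Qh₁ S.d₂) q d ∈ distTriang T) [Mono (F.map (Mh.map Qh₁ S.d₂))]
    (j : F.obj D ≅ S.syzygy) (hj : Qh₁.unit ≫ F.map q ≫ j.hom = S.π)
    {y : Ext (F.obj D) ((F.obj (Mh.obj⟦(1 : ℤ)⟧))⟦(-1 : ℤ)⟧) 1} (hy : IsUCTClass F d y) :
    (Ext.mk₀ j.inv).comp (y.comp (Ext.mk₀ ((Mh.shiftIso 1).hom⟦(-1 : ℤ)⟧')) (add_zero 1))
      (zero_add 1) = S.shortExact₁.extClass.comp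
        (Ext.mk₀ ((shiftFunctorCompIsoId A (1 : ℤ) (-1) (by norm_num)).inv.app M₁))
        (add_zero 1) := by
  -- Definition of the class requires a triangle starting at M̂₁[1][-1]; `κ` obtains it from the
  -- given one starting at M̂₁.
  let κ := (shiftFunctorCompIsoId T (1 : ℤ) (-1) (by norm_num)).app Mh.obj
  have hΔ : Triangle.mk (κ.hom ≫ Mh.map Qh₁ S.d₂) q
      (d ≫ (shiftFunctorCompIsoId T (-1 : ℤ) 1 (by norm_num)).inv.app (Mh.obj⟦(1 : ℤ)⟧)) ∈
      distTriang T := by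
    refine isomorphic_distinguished _ hD _
      (Triangle.isoMk _ _ κ (Iso.refl _) (Iso.refl _) ?_ ?_ ?_)
    · exact Category.comp_id _
    · exact (Category.comp_id q).trans (Category.id_comp q).symm
    · refine Eq.trans ?_ (Category.id_comp d).symm
      change (d ≫ (shiftFunctorCompIsoId T (-1 : ℤ) 1 (by norm_num)).inv.app
        (Mh.obj⟦(1 : ℤ)⟧)) ≫ κ.hom⟦(1 : ℤ)⟧' = d
      have h : (shiftFunctorCompIsoId T (-1 : ℤ) 1 (by norm_num)).inv.app (Mh.obj⟦(1 : ℤ)⟧) =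
          κ.inv⟦(1 : ℤ)⟧' :=
        (shift_shiftFunctorCompIsoId_inv_app (1 : ℤ) (-1) (by norm_num) Mh.obj).symm
      rw [h, Category.assoc, ← Functor.map_comp, κ.inv_hom_id]
      simp
  have : Mono (F.map (κ.hom ≫ Mh.map Qh₁ S.d₂)) := by rw [F.map_comp]; infer_instance
  obtain ⟨w', hw'⟩ := shortExact_of_mono (F := F) hΔ
  have hy' : y = hw'.extClass.comp
      (Ext.mk₀ ((F.commShiftIso (-1 : ℤ)).hom.app (Mh.obj⟦(1 : ℤ)⟧))) (add_zero 1) :=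
    IsUCTClass.unique ⟨_, _, _, hΔ, w', hw', rfl⟩ hy
  let φ : ShortComplex.mk _ _ w' ⟶ ShortComplex.mk S.d₂ S.π S.d₂_π :=
    { τ₁ := F.map κ.hom ≫ inv Mh.unit
      τ₂ := inv Qh₁.unit
      τ₃ := j.hom
      comm₁₂ := by
        change (F.map κ.hom ≫ inv Mh.unit) ≫ S.d₂ =
          F.map (κ.hom ≫ Mh.map Qh₁ S.d₂) ≫ inv Qh₁.unit
        rw [← cancel_mono Qh₁.unit]
        simp [← Mh.unit_map Qh₁ S.d₂]
      comm₂₃ := by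
        change inv Qh₁.unit ≫ S.π = F.map q ≫ j.hom
        simp [← hj] }
  have hφ : hw'.extClass.comp (Ext.mk₀ (F.map κ.hom ≫ inv Mh.unit)) (add_zero 1) =
      (Ext.mk₀ j.hom).comp S.shortExact₁.extClass (zero_add 1) :=
    ShortComplex.ShortExact.extClass_naturality hw' S.shortExact₁ φ
  -- Cancelling [1] against [-1] in `T` and then applying `F` agrees with cancelling in `A`, through
  -- the shift isomorphisms of `F`.
  have hκ : F.map κ.hom = (F.commShiftIso (-1 : ℤ)).hom.app (Mh.obj⟦(1 : ℤ)⟧) ≫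
      ((F.commShiftIso (1 : ℤ)).hom.app Mh.obj)⟦(-1 : ℤ)⟧' ≫
        (shiftFunctorCompIsoId A (1 : ℤ) (-1) (by norm_num)).hom.app (F.obj Mh.obj) :=
    F.map_shiftFunctorCompIsoId_hom_app _ _ _ _
  have hn : (shiftFunctorCompIsoId A (1 : ℤ) (-1) (by norm_num)).hom.app (F.obj Mh.obj) ≫
      inv Mh.unit = ((inv Mh.unit)⟦(1 : ℤ)⟧')⟦(-1 : ℤ)⟧' ≫
        (shiftFunctorCompIsoId A (1 : ℤ) (-1) (by norm_num)).hom.app M₁ :=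
    ((shiftFunctorCompIsoId A (1 : ℤ) (-1) (by norm_num)).hom.naturality (inv Mh.unit)).symm
  have hτ : (F.commShiftIso (-1 : ℤ)).hom.app (Mh.obj⟦(1 : ℤ)⟧) ≫
      (Mh.shiftIso 1).hom⟦(-1 : ℤ)⟧' = (F.map κ.hom ≫ inv Mh.unit) ≫
        (shiftFunctorCompIsoId A (1 : ℤ) (-1) (by norm_num)).inv.app M₁ := by
    rw [hκ, Category.assoc, Category.assoc, Category.assoc, reassoc_of% hn, Iso.hom_inv_id_app,
      Mh.shiftIso_hom, Functor.map_comp]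
    exact congrArg _ (congrArg _ (Category.comp_id _).symm)
  have hext : hw'.extClass.comp ((Ext.mk₀ (F.map κ.hom ≫ inv Mh.unit)).comp
      (Ext.mk₀ ((shiftFunctorCompIsoId A (1 : ℤ) (-1) (by norm_num)).inv.app M₁)) (zero_add 0))
      (add_zero 1) = ((Ext.mk₀ j.hom).comp S.shortExact₁.extClass (zero_add 1)).comp
        (Ext.mk₀ ((shiftFunctorCompIsoId A (1 : ℤ) (-1) (by norm_num)).inv.app M₁))
        (add_zero 1) := by
    rw [← hφ]
    exact (Ext.comp_assoc_of_third_deg_zero _ _ _ _).symm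
  rw [hy', Ext.comp_assoc_of_third_deg_zero, Ext.mk₀_comp_mk₀, hτ, ← Ext.mk₀_comp_mk₀]
  refine (congrArg (fun t => (Ext.mk₀ j.inv).comp t (zero_add 1)) hext).trans ?_
  change (Ext.mk₀ j.inv).comp (Ext.comp _ _ _) _ = _
  rw [Ext.comp_assoc_of_third_deg_zero]
  refine (Ext.mk₀_comp_mk₀_assoc _ _ _).trans ?_
  rw [j.inv_hom_id, Ext.mk₀_id_comp]

end Cone
section Cone

variable {T : Type u₁} [Category.{v₁} T] [HasZeroObject T] [HasShift T ℤ] [Preadditive T]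
  [∀ n : ℤ, (shiftFunctor T n).Additive] [Pretriangulated T]
  {A : Type u₂} [Category.{v₂} A] [Abelian A] [HasShift A ℤ]
  [∀ n : ℤ, (shiftFunctor A n).Additive]
  {I : MorphismProperty T} {F : T ⥤ A} [F.CommShift ℤ] [F.IsHomological]
  {M₁ M₀ : A} (S : TwoStepExtension M₁ M₀) (E : ParityDecomposition A)

/-- There is a morphism to every canonical lifting from a canonical lifting that is built from
a resolution. -/
lemma exists_hom_canonicalLifting (hF : IsUniversalExact I F)
    (hI : IsStableHomologicalIdeal.{u₁, v₁, u₃, v₃} I)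
    (hM₁e : E.even M₁) (hQ₀e : E.even S.Q₀)
    (Mh : AdjointObj F M₁) (Qh₁ : AdjointObj F S.Q₁) (Qh₀ : AdjointObj F S.Q₀) [IsIso Mh.unit]
    [IsIso Qh₀.unit] {D C : T} {q : Qh₁.obj ⟶ D} {d : D ⟶ Mh.obj⟦(1 : ℤ)⟧} {ψ : D ⟶ Qh₀.obj}
    {g : Qh₀.obj ⟶ C} {h : C ⟶ D⟦(1 : ℤ)⟧}
    (hD : Triangle.mk (Mh.map Qh₁ S.d₂) q d ∈ distTriang T) (hψ : q ≫ ψ = Qh₁.map Qh₀ S.d₁)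
    (hC : Triangle.mk ψ g h ∈ distTriang T)
    (jC : F.obj C ≅ M₀) (hjC : Qh₀.unit ≫ F.map g ≫ jC.hom = S.ε) {M : A}
    (e : M ≅ M₀ ⊞ M₁⟦(1 : ℤ)⟧) {L : Lifting I F M} (hL : IsCanonicalLifting E I F L) :
    ∃ u : C ⊞ Mh.obj⟦(1 : ℤ)⟧ ⟶ L.obj,
      F.map u ≫ L.iso.hom = (mapBiprodIso F jC (Mh.shiftIso 1)).hom ≫ e.inv := by
  have := S.epi_ε
  obtain ⟨Me, Mo, s, Le, Lo, b, hMe, hMo, hb₁, hb₂⟩ := hL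
  have hM₀e : E.even M₀ := E.even_of_epi S.ε hQ₀e
  have hMh : IsIdealProjective I (Mh.obj⟦(1 : ℤ)⟧) := (Mh.isIdealProjective hF.exact).shift hI 1
  let a₀ : M₀ ⟶ Me := biprod.inl ≫ e.inv ≫ s.hom ≫ biprod.fst
  let a₁ : M₁⟦(1 : ℤ)⟧ ⟶ Mo := biprod.inr ≫ e.inv ≫ s.hom ≫ biprod.snd
  have ha : e.inv ≫ s.hom = biprod.map a₀ a₁ := by
    ext
    · simp [a₀]
    · exact (E.even_odd_zero hM₀e hMo _).trans (E.even_odd_zero hM₀e hMo _).symm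
    · exact (E.odd_even_zero (E.odd_shift hM₁e) hMe _).trans
        (E.odd_even_zero (E.odd_shift hM₁e) hMe _).symm
    · simp [a₁]
  obtain ⟨u₁, hu₁⟩ := (hF.map_bijective hI hMh Lo.obj).2
    ((Mh.shiftIso 1).hom ≫ a₁ ≫ Lo.iso.inv)
  dsimp at hu₁
  obtain ⟨k, hk⟩ := Qh₀.exists_hom (S.ε ≫ a₀ ≫ Le.iso.inv)
  have hdk : Qh₁.map Qh₀ S.d₁ ≫ k = 0 := by
    apply Qh₁.hom_ext
    rw [F.map_comp, reassoc_of% Qh₁.unit_map Qh₀ S.d₁, hk, reassoc_of% S.d₁_ε]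
    simp
  -- The composite vanishes on Q̂₁, so it factors through M̂₁[1]. This object is `I`-projective with
  -- odd image, whereas `Le` has even image, so the factor is zero and `k` descends to `C`.
  have hψk : ψ ≫ k = 0 := by
    obtain ⟨y, hy⟩ : ∃ y : Mh.obj⟦(1 : ℤ)⟧ ⟶ Le.obj, ψ ≫ k = d ≫ y :=
      Triangle.yoneda_exact₃ _ hD (ψ ≫ k) (by
        change q ≫ ψ ≫ k = 0
        rw [reassoc_of% hψ, hdk])
    have hy₀ : y = 0 := by
      apply (hF.map_bijective hI hMh Le.obj).1
      change F.map y = F.map 0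
      rw [← cancel_epi (Mh.shiftIso 1).inv, ← cancel_mono Le.iso.hom]
      exact (E.odd_even_zero (E.odd_shift hM₁e) hMe _).trans
        (E.odd_even_zero (E.odd_shift hM₁e) hMe _).symm
    rw [hy, hy₀, comp_zero]
  obtain ⟨k', hk'⟩ : ∃ k' : C ⟶ Le.obj, k = g ≫ k' := Triangle.yoneda_exact₂ _ hC k hψk
  have hk₀ : F.map k' ≫ Le.iso.hom = jC.hom ≫ a₀ := by
    have hg : Qh₀.unit ≫ F.map g = S.ε ≫ jC.inv := by rw [← hjC]; simp
    have : Epi (Qh₀.unit ≫ F.map g) := by rw [hg]; infer_instance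
    rw [← cancel_epi (Qh₀.unit ≫ F.map g), Category.assoc, ← F.map_comp_assoc, ← hk',
      ← Category.assoc, hk, Category.assoc, Category.assoc, Le.iso.inv_hom_id, Category.comp_id,
      Category.assoc, reassoc_of% hjC]
  refine ⟨biprod.desc (k' ≫ biprod.inl) (u₁ ≫ biprod.inr) ≫ b.hom, ?_⟩
  rw [← cancel_mono s.hom, Category.assoc, Category.assoc, ha]
  apply map_biprod_hom_ext
  · rw [← F.map_comp_assoc, biprod.inl_desc_assoc, reassoc_of% map_inl_mapBiprodIso_hom F jC,
      Category.assoc, F.map_comp, Category.assoc, hb₁, reassoc_of% hk₀]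
    simp
  · rw [← F.map_comp_assoc, biprod.inr_desc_assoc, reassoc_of% map_inr_mapBiprodIso_hom F jC,
      Category.assoc, F.map_comp, Category.assoc, hb₂, hu₁]
    simp

variable [IsTriangulated T] [HasExt.{w} A]

/-- The cone of `d̂₁` has the class of the two-step extension as a relative obstruction class. -/
lemma exists_obstructionClass_cone (hF : IsUniversalExact I F)
    (hI : IsStableHomologicalIdeal.{u₁, v₁, u₃, v₃} I)
    [Projective M₁] [Projective S.Q₁] [Projective S.Q₀]
    (hM₁e : E.even M₁) (hQ₀e : E.even S.Q₀)
    (Mh : AdjointObj F M₁) (Qh₁ : AdjointObj F S.Q₁) (Qh₀ : AdjointObj F S.Q₀)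
    [IsIso Mh.unit] [IsIso Qh₁.unit] [IsIso Qh₀.unit]
    {X : T} {p : Qh₀.obj ⟶ X} {r : X ⟶ Qh₁.obj⟦(1 : ℤ)⟧}
    (hX : Triangle.mk (Qh₁.map Qh₀ S.d₁) p r ∈ distTriang T) (hX' : IsLeftOrthogonal I X)
    {e : F.obj X ≅ M₀ ⊞ M₁⟦(1 : ℤ)⟧} (he : IsConeSplitting F S Qh₁ Qh₀ p r e) :
    ∃ L₀ : Lifting I F (F.obj X), IsCanonicalLifting E I F L₀ ∧
      IsRelativeObstructionClass I F ⟨X, hX', Iso.refl _⟩ L₀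
        ((Ext.mk₀ (e.hom ≫ biprod.fst)).comp
          (S.extClass.comp (Ext.mk₀ (shiftInclusion e)) (add_zero 2)) (zero_add 2)) ∧
      ∀ L : Lifting I F (F.obj X), IsCanonicalLifting E I F L →
        ∃ u : L₀.obj ⟶ L.obj, F.map u ≫ L.iso.hom = L₀.iso.hom := by
  have := S.epi_ε
  have := S.mono_d₂
  have hM₀e : E.even M₀ := E.even_of_epi S.ε hQ₀e
  have hMh : IsIdealProjective I Mh.obj := Mh.isIdealProjective hF.exact
  have hQh₁ : IsIdealProjective I Qh₁.obj := Qh₁.isIdealProjective hF.exact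
  have hQh₀ : IsIdealProjective I Qh₀.obj := Qh₀.isIdealProjective hF.exact
  have := projective_shift M₁ 1
  -- the lifting of the syzygy
  obtain ⟨D, q, d, hD⟩ := distinguished_cocone_triangle (Mh.map Qh₁ S.d₂)
  have hdd : Mh.map Qh₁ S.d₂ ≫ Qh₁.map Qh₀ S.d₁ = 0 := by
    apply Mh.hom_ext
    rw [F.map_comp, reassoc_of% Mh.unit_map Qh₁ S.d₂, Qh₁.unit_map, reassoc_of% S.d₂_d₁]
    simp
  obtain ⟨ψ, hψ⟩ : ∃ ψ : D ⟶ Qh₀.obj, Qh₁.map Qh₀ S.d₁ = q ≫ ψ :=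
    Triangle.yoneda_exact₂ _ hD _ hdd
  obtain ⟨hmono, j, hj⟩ := exists_iso_of_shortExact hD S.shortExact₁ (asIso Mh.unit)
    (asIso Qh₁.unit) (Mh.unit_map Qh₁ S.d₂)
  rw [asIso_hom] at hj
  have hd : F.map d = 0 := map_mor₃_eq_zero_of_mono hD
  have hD' : IsLeftOrthogonal I D := IsLeftOrthogonal.cone hI _ hD hMh.isLeftOrthogonal
    hQh₁.isLeftOrthogonal
  have hFψ : F.map ψ = j.hom ≫ S.ι ≫ Qh₀.unit := by
    have hq : Qh₁.unit ≫ F.map q = S.π ≫ j.inv := by rw [← hj]; simp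
    have : Epi S.π := S.shortExact₁.epi_g
    have : Epi (Qh₁.unit ≫ F.map q) := by rw [hq]; infer_instance
    rw [← cancel_epi (Qh₁.unit ≫ F.map q), Category.assoc, ← F.map_comp, ← hψ, Qh₁.unit_map,
      Category.assoc, reassoc_of% hj, reassoc_of% S.π_ι]
  -- the canonical lifting
  obtain ⟨C, g, h, hC⟩ := distinguished_cocone_triangle ψ
  obtain ⟨-, jC, hjC⟩ := exists_iso_of_shortExact hC S.shortExact₀ j.symm (asIso Qh₀.unit)
    (by simp [hFψ])
  rw [asIso_hom] at hjC
  have hC' : IsLeftOrthogonal I C := IsLeftOrthogonal.cone hI _ hC hD' hQh₀.isLeftOrthogonal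
  have hMh' : IsIdealProjective I (Mh.obj⟦(1 : ℤ)⟧) := hMh.shift hI 1
  let L₀ : Lifting I F (F.obj X) := ⟨C ⊞ Mh.obj⟦(1 : ℤ)⟧, hC'.biprod hMh'.isLeftOrthogonal,
    mapBiprodIso F jC (Mh.shiftIso 1) ≪≫ e.symm⟩
  -- the triangles
  obtain ⟨p₂, r₂, hp₂, hp₂p, hp₂r⟩ := exists_cone_lift hD hψ.symm hX
  obtain ⟨p₁, r₁, hp₁, hp₁g, hp₁s⟩ := exists_cone_comp_inl hC (Mh.obj⟦(1 : ℤ)⟧)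
  let i : S.Q₀ ⊞ M₁⟦(1 : ℤ)⟧ ≅ F.obj (Qh₀.obj ⊞ Mh.obj⟦(1 : ℤ)⟧) :=
    (mapBiprodIso F (asIso Qh₀.unit).symm (Mh.shiftIso 1)).symm
  have hi₁ : biprod.inl ≫ i.hom = Qh₀.unit ≫ F.map biprod.inl :=
    inl_mapBiprodIso_inv F (asIso Qh₀.unit).symm (Mh.shiftIso 1)
  have hi₂ : biprod.inr ≫ i.hom = (Mh.shiftIso 1).inv ≫ F.map biprod.inr :=
    inr_mapBiprodIso_inv F (asIso Qh₀.unit).symm (Mh.shiftIso 1)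
  let P : AdjointObj F (S.Q₀ ⊞ M₁⟦(1 : ℤ)⟧) := hF.adjointObj hI (hQh₀.biprod hMh') i
  have hP : P.unit = i.hom := AdjointObj.ofUnit_unit _ _
  let σ := S.addSummandSyzygyIso e
  let D₀ : Lifting I F (S.addSummand e).syzygy := ⟨D, hD', j ≪≫ σ.symm⟩
  have hσ : D₀.iso.hom ≫ S.addSummandι e ≫ i.hom = F.map (ψ ≫ biprod.inl) := by
    change (j.hom ≫ S.addSummandSyzygyInv e) ≫ _ = _
    rw [Category.assoc, reassoc_of% S.addSummandSyzygyInv_ι e, hi₁, F.map_comp, hFψ]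
    simp
  -- The whole obstruction: (ψ, d) has cone `X`, (ψ, 0) has the canonical lifting as its cone, and
  -- only `d` distinguishes them.
  have hφ : biprod.lift ψ d - ψ ≫ biprod.inl = d ≫ biprod.inr := by
    ext <;> simp
  have hFφ : F.map (biprod.lift ψ d) = F.map (ψ ≫ biprod.inl) := by
    rw [← sub_eq_zero, ← F.map_sub, hφ, F.map_comp, hd, zero_comp]
  -- The triangle leaves the component M̂₁[1] → C of `p₁` undetermined, but `F` sends it to a
  -- morphism from odd to even.
  have hp₁₂ : F.map (biprod.inr ≫ p₁) ≫ (mapBiprodIso F jC (Mh.shiftIso 1)).hom =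
      (Mh.shiftIso 1).hom ≫ biprod.inr := by
    ext
    · rw [← cancel_epi (Mh.shiftIso 1).inv]
      exact (E.odd_even_zero (E.odd_shift hM₁e) hM₀e _).trans
        (E.odd_even_zero (E.odd_shift hM₁e) hM₀e _).symm
    · rw [Category.assoc, mapBiprodIso_hom_snd, ← F.map_comp_assoc, Category.assoc, hp₁s]
      simp
  have hε₁ : i.hom ≫ F.map p₁ ≫ (mapBiprodIso F jC (Mh.shiftIso 1)).hom ≫ e.inv =
      biprod.map S.ε (𝟙 _) ≫ e.inv := by
    apply biprod.hom_ext'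
    · rw [reassoc_of% hi₁, ← F.map_comp_assoc, hp₁g, F.map_comp, Category.assoc,
        reassoc_of% map_inl_mapBiprodIso_hom F jC, reassoc_of% hjC]
      simp
    · rw [reassoc_of% hi₂, ← F.map_comp_assoc, reassoc_of% hp₁₂]
      simp
  have hε₂ : i.hom ≫ F.map p₂ ≫ 𝟙 _ = biprod.map S.ε (𝟙 _) ≫ e.inv := by
    rw [← cancel_mono e.hom]
    simp only [Category.assoc, Category.id_comp, e.inv_hom_id, Category.comp_id]
    apply biprod.hom_ext'
    · rw [reassoc_of% hi₁, ← F.map_comp_assoc, hp₂p, he.1]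
      simp
    -- The entry into M₀ vanishes by parity. The entry into M₁[1] is tested after composition with
    -- `r`, where `p₂` restricts to the shift of the lift of `d₂`.
    · apply biprod.hom_ext
      · exact (E.odd_even_zero (E.odd_shift hM₁e) hM₀e _).trans
          (E.odd_even_zero (E.odd_shift hM₁e) hM₀e _).symm
      · have hpr : (biprod.inr ≫ p₂) ≫ r = (Mh.map Qh₁ S.d₂)⟦(1 : ℤ)⟧' := by
          rw [Category.assoc, hp₂r, biprod.inr_snd_assoc]
        rw [← cancel_mono (S.d₂⟦(1 : ℤ)⟧' ≫ Qh₁.unit⟦(1 : ℤ)⟧')]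
        simp only [Category.assoc]
        rw [reassoc_of% hi₂, ← F.map_comp_assoc, he.2, ← F.map_comp_assoc, hpr,
          F.commShiftIso_hom_naturality, ← Mh.shiftIso_hom_unit, Category.assoc,
          Iso.inv_hom_id_assoc, ← Functor.map_comp, Mh.unit_map]
        simp
  -- the class
  obtain ⟨y, hy⟩ := exists_isUCTClass d hd
  obtain ⟨x, hx⟩ := exists_isUCTClass (F := F) (biprod.lift ψ d - ψ ≫ biprod.inl) (by
    rw [F.map_sub, hFφ, sub_self])
  have hxy := hy.comp_right hx biprod.inr hφ.symm
  refine ⟨L₀, ?_, ?_, fun L hL => exists_hom_canonicalLifting S E hF hI hM₁e hQ₀e Mh Qh₁ Qh₀ hD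
    hψ.symm hC jC hjC e hL⟩
  · refine ⟨M₀, M₁⟦(1 : ℤ)⟧, e, ⟨C, hC', jC⟩, ⟨_, hMh'.isLeftOrthogonal, Mh.shiftIso 1⟩,
      Iso.refl _, hM₀e, E.odd_shift hM₁e, ?_, ?_⟩
    · change F.map (biprod.inl ≫ 𝟙 _) ≫ (_ ≫ e.inv) ≫ e.hom = jC.hom ≫ biprod.inl
      rw [Category.comp_id, Category.assoc, e.inv_hom_id, Category.comp_id,
        map_inl_mapBiprodIso_hom]
    · change F.map (biprod.inr ≫ 𝟙 _) ≫ (_ ≫ e.inv) ≫ e.hom = (Mh.shiftIso 1).hom ≫ biprod.inr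
      rw [Category.comp_id, Category.assoc, e.inv_hom_id, Category.comp_id,
        map_inr_mapBiprodIso_hom]
  · have hproj : Projective (S.Q₀ ⊞ M₁⟦(1 : ℤ)⟧) := inferInstance
    refine ⟨M₁, S.addSummand e, inferInstance, ‹Projective S.Q₁›, hproj, P, D₀, ψ ≫ biprod.inl,
      biprod.lift ψ d, p₁, r₁, p₂, r₂, x, hp₁, hp₂, ?_, ?_, ?_, ?_, hx, ?_⟩
    · exact hσ.symm.trans
        (congrArg (fun t => D₀.iso.hom ≫ S.addSummandι e ≫ t) hP.symm)
    · exact (hFφ.trans hσ.symm).trans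
        (congrArg (fun t => D₀.iso.hom ≫ S.addSummandι e ≫ t) hP.symm)
    · exact (congrArg (fun t => t ≫ F.map p₁ ≫ (mapBiprodIso F jC (Mh.shiftIso 1)).hom ≫ e.inv)
        hP).trans hε₁
    · exact (congrArg (fun t => t ≫ F.map p₂ ≫ 𝟙 _) hP).trans hε₂
    · have h₁ : x.comp (Ext.mk₀ ((F.map p₁ ≫ (mapBiprodIso F jC (Mh.shiftIso 1)).hom ≫
          e.inv)⟦(-1 : ℤ)⟧')) (add_zero 1) =
          (y.comp (Ext.mk₀ ((Mh.shiftIso 1).hom⟦(-1 : ℤ)⟧')) (add_zero 1)).comp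
            (Ext.mk₀ ((biprod.inr ≫ e.inv)⟦(-1 : ℤ)⟧')) (add_zero 1) := by
        rw [hxy, Ext.comp_assoc_of_third_deg_zero, Ext.comp_assoc_of_third_deg_zero,
          Ext.mk₀_comp_mk₀, Ext.mk₀_comp_mk₀, ← Functor.map_comp, ← Functor.map_comp,
          ← F.map_comp_assoc, reassoc_of% hp₁₂]
      have h₂ : (Ext.mk₀ (σ.hom ≫ j.inv)).comp (x.comp (Ext.mk₀ ((F.map p₁ ≫
          (mapBiprodIso F jC (Mh.shiftIso 1)).hom ≫ e.inv)⟦(-1 : ℤ)⟧')) (add_zero 1))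
          (zero_add 1) = (Ext.mk₀ σ.hom).comp (S.shortExact₁.extClass.comp
            (Ext.mk₀ (shiftInclusion e)) (add_zero 1)) (zero_add 1) := by
        rw [h₁, ← Ext.mk₀_comp_mk₀_assoc]
        congr 1
        rw [← Ext.comp_assoc_of_third_deg_zero, uctClass_connecting S Mh Qh₁ hD j hj hy,
          Ext.comp_assoc_of_third_deg_zero, Ext.mk₀_comp_mk₀, shiftInclusion]
      -- The factor `σ.hom` converts the enlarged extension into the pullback of the original one
      -- along F X → M₀; associativity then exposes the splice.
      refine Eq.symm ((congrArg (fun t => (S.addSummand e).shortExact₀.extClass.comp t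
        (by norm_num)) h₂).trans ?_)
      rw [← Ext.comp_assoc_of_second_deg_zero]
      refine (congrArg (fun t => Ext.comp t (S.shortExact₁.extClass.comp
        (Ext.mk₀ (shiftInclusion e)) (add_zero 1)) (by norm_num)) (S.addSummand_extClass₀ e)).trans ?_
      rw [TwoStepExtension.extClass, Ext.comp_assoc_of_third_deg_zero]
      exact Ext.comp_assoc _ _ _ (zero_add 1) _ (by norm_num)

end Cone
/-! ### Isomorphism of cones -/

section Triangulated

variable {T : Type u₁} [Category.{v₁} T] [HasZeroObject T] [HasShift T ℤ] [Preadditive T]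
  [∀ n : ℤ, (shiftFunctor T n).Additive] [Pretriangulated T]
  {X₁ X₂ X₃ Y₁ Y₂ Y₃ : T} {f : X₁ ⟶ X₂} {g : X₂ ⟶ X₃} {h : X₃ ⟶ X₁⟦(1 : ℤ)⟧}
  {f' : Y₁ ⟶ Y₂} {g' : Y₂ ⟶ Y₃} {h' : Y₃ ⟶ Y₁⟦(1 : ℤ)⟧}

lemma nonempty_cone_iso (hX : Triangle.mk f g h ∈ distTriang T)
    (hY : Triangle.mk f' g' h' ∈ distTriang T) (i₁ : X₁ ≅ Y₁) (i₂ : X₂ ≅ Y₂)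
    (w : f ≫ i₂.hom = i₁.hom ≫ f') : Nonempty (X₃ ≅ Y₃) :=
  ⟨Triangle.π₃.mapIso (isoTriangleOfIso₁₂ _ _ hX hY i₁ i₂ w)⟩

lemma exists_fibre_iso (hX : Triangle.mk f g h ∈ distTriang T)
    (hY : Triangle.mk f' g' h' ∈ distTriang T) (i₂ : X₂ ≅ Y₂) (i₃ : X₃ ≅ Y₃)
    (w : g ≫ i₃.hom = i₂.hom ≫ g') : ∃ i₁ : X₁ ≅ Y₁, f ≫ i₂.hom = i₁.hom ≫ f' := by
  obtain ⟨a, ha₁, ha₂⟩ : ∃ a : X₁ ⟶ Y₁, f ≫ i₂.hom = a ≫ f' ∧ h ≫ a⟦(1 : ℤ)⟧' = i₃.hom ≫ h' :=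
    complete_distinguished_triangle_morphism₁ _ _ hX hY i₂.hom i₃.hom w
  let φ : Triangle.mk f g h ⟶ Triangle.mk f' g' h' :=
    { hom₁ := a, hom₂ := i₂.hom, hom₃ := i₃.hom, comm₁ := ha₁, comm₂ := w, comm₃ := ha₂ }
  have : IsIso a := isIso₁_of_isIso₂₃ φ hX hY (inferInstanceAs (IsIso i₂.hom))
    (inferInstanceAs (IsIso i₃.hom))
  exact ⟨asIso a, ha₁⟩

end Triangulated

lemma mapBiprodIso_map {T : Type u₁} [Category.{v₁} T] [Preadditive T] [HasBinaryBiproducts T]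
    {A : Type u₂} [Category.{v₂} A] [Abelian A] (F : T ⥤ A) [F.Additive]
    {X Y Z W : T} {X' Y' Z' W' : A} (iX : F.obj X ≅ X') (iY : F.obj Y ≅ Y') (iZ : F.obj Z ≅ Z')
    (iW : F.obj W ≅ W') {f : X ⟶ Z} {g : Y ⟶ W} {f' : X' ⟶ Z'} {g' : Y' ⟶ W'}
    (hf : F.map f ≫ iZ.hom = iX.hom ≫ f') (hg : F.map g ≫ iW.hom = iY.hom ≫ g') :
    F.map (biprod.map f g) ≫ (mapBiprodIso F iZ iW).hom =
      (mapBiprodIso F iX iY).hom ≫ biprod.map f' g' := by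
  apply map_biprod_hom_ext
  · rw [← F.map_comp_assoc, biprod.inl_map, F.map_comp_assoc, map_inl_mapBiprodIso_hom,
      reassoc_of% hf, reassoc_of% map_inl_mapBiprodIso_hom F iX iY, biprod.inl_map]
  · rw [← F.map_comp_assoc, biprod.inr_map, F.map_comp_assoc, map_inr_mapBiprodIso_hom,
      reassoc_of% hg, reassoc_of% map_inr_mapBiprodIso_hom F iX iY, biprod.inr_map]

namespace TwoStepExtension

variable {A : Type u₂} [Category.{v₂} A] [Abelian A] {M₁ M₀ : A} (S : TwoStepExtension M₁ M₀)

lemma exists_lift_map_id_right {V Q : A} (z : V ⟶ S.Q₁ ⊞ Q)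
    (hz : z ≫ biprod.map S.d₁ (𝟙 Q) = 0) : ∃ t : V ⟶ M₁, z = t ≫ S.d₂ ≫ biprod.inl := by
  have := S.mono_d₂
  have h₁ : (z ≫ biprod.fst) ≫ S.d₁ = 0 := by simpa using hz =≫ biprod.fst
  have h₂ : z ≫ biprod.snd = 0 := by simpa using hz =≫ biprod.snd
  have : Mono (ShortComplex.mk S.d₂ S.d₁ S.d₂_d₁).f := this
  refine ⟨S.exact₁.lift _ h₁, ?_⟩
  have ht : S.exact₁.lift _ h₁ ≫ S.d₂ = z ≫ biprod.fst := S.exact₁.lift_f _ h₁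
  rw [reassoc_of% ht]
  ext <;> simp [h₂]

lemma exists_lift_map_id_left {V Q : A} (z : V ⟶ Q ⊞ S.Q₁)
    (hz : z ≫ biprod.map (𝟙 Q) S.d₁ = 0) : ∃ t : V ⟶ M₁, z = t ≫ S.d₂ ≫ biprod.inr := by
  obtain ⟨t, ht⟩ := S.exists_lift_map_id_right (z ≫ (biprod.braiding _ _).hom) (by
    ext
    · simpa using hz =≫ biprod.snd
    · simpa using hz =≫ biprod.fst)
  refine ⟨t, ?_⟩
  rw [← cancel_mono (biprod.braiding _ _).hom, ht]
  ext <;> simp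

/-- Adding identity summands does not change the kernel, so `M₁` and `M₁'` are the kernels of the
two rows and `f₂` restricts to them. -/
lemma exists_kernel_iso {M₁' M₀' : A} (S' : TwoStepExtension M₁' M₀') {Q Q' : A}
    (f₂ : S.Q₁ ⊞ Q' ≅ Q ⊞ S'.Q₁) (f₃ : S.Q₀ ⊞ Q' ≅ Q ⊞ S'.Q₀)
    (w : biprod.map S.d₁ (𝟙 Q') ≫ f₃.hom = f₂.hom ≫ biprod.map (𝟙 Q) S'.d₁) :
    ∃ f₁ : M₁ ≅ M₁', (S.d₂ ≫ biprod.inl) ≫ f₂.hom = f₁.hom ≫ S'.d₂ ≫ biprod.inr := by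
  have := S.mono_d₂
  have := S'.mono_d₂
  have w' : f₂.inv ≫ biprod.map S.d₁ (𝟙 Q') = biprod.map (𝟙 Q) S'.d₁ ≫ f₃.inv := by
    rw [Iso.inv_comp_eq, ← reassoc_of% w, f₃.hom_inv_id, Category.comp_id]
  obtain ⟨t, ht⟩ := S'.exists_lift_map_id_left ((S.d₂ ≫ biprod.inl) ≫ f₂.hom) (by
    rw [Category.assoc, ← w]
    simp [reassoc_of% S.d₂_d₁])
  obtain ⟨t', ht'⟩ := S.exists_lift_map_id_right ((S'.d₂ ≫ biprod.inr) ≫ f₂.inv) (by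
    rw [Category.assoc, w']
    simp [reassoc_of% S'.d₂_d₁])
  refine ⟨⟨t, t', ?_, ?_⟩, ht⟩
  · rw [← cancel_mono (S.d₂ ≫ (biprod.inl : S.Q₁ ⟶ S.Q₁ ⊞ Q')), Category.assoc, ← ht',
      ← Category.assoc, ← ht]
    simp
  · rw [← cancel_mono (S'.d₂ ≫ (biprod.inr : S'.Q₁ ⟶ Q ⊞ S'.Q₁)), Category.assoc, ← ht,
      ← Category.assoc, ← ht']
    simp

end TwoStepExtension

/-- Schanuel's lemma: two projective covers of isomorphic objects become isomorphic after adding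
direct summands. -/
lemma exists_schanuel_iso {A : Type u₂} [Category.{v₂} A] [Abelian A] {Q Q' M M' : A}
    [Projective Q] [Projective Q'] (ε : Q ⟶ M) (ε' : Q' ⟶ M') [Epi ε] [Epi ε'] (i : M ≅ M') :
    ∃ f : Q ⊞ Q' ≅ Q ⊞ Q', (biprod.fst ≫ ε) ≫ i.hom = f.hom ≫ biprod.snd ≫ ε' := by
  let a : Q ⟶ Q' := Projective.factorThru (ε ≫ i.hom) ε'
  have ha : a ≫ ε' = ε ≫ i.hom := Projective.factorThru_comp _ _
  let b : Q' ⟶ Q := Projective.factorThru (ε' ≫ i.inv) ε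
  have hb : b ≫ ε = ε' ≫ i.inv := Projective.factorThru_comp _ _
  -- The isomorphism is a product of two elementary matrices: subtract `b` of the second coordinate
  -- from the first, then add `a` of the new first coordinate `x` to the second.
  let x : Q ⊞ Q' ⟶ Q := biprod.fst - biprod.snd ≫ b
  let y : Q ⊞ Q' ⟶ Q' := biprod.snd - biprod.fst ≫ a
  refine ⟨⟨biprod.lift x (biprod.snd + x ≫ a), biprod.lift (biprod.fst + y ≫ b) y, ?_, ?_⟩, ?_⟩
  · apply biprod.hom_ext <;>
    simp [x, y, Preadditive.comp_add, Preadditive.comp_sub, Preadditive.add_comp,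
      Preadditive.sub_comp]
  · apply biprod.hom_ext <;>
    simp [x, y, Preadditive.comp_add, Preadditive.comp_sub, Preadditive.add_comp,
      Preadditive.sub_comp]
  · simp [x, Preadditive.add_comp, Preadditive.sub_comp, ha, reassoc_of% hb]

section Cone

variable {T : Type u₁} [Category.{v₁} T] [HasZeroObject T] [HasShift T ℤ] [Preadditive T]
  [∀ n : ℤ, (shiftFunctor T n).Additive] [Pretriangulated T]
  {A : Type u₂} [Category.{v₂} A] [Abelian A] [HasShift A ℤ]
  [∀ n : ℤ, (shiftFunctor A n).Additive]
  {I : MorphismProperty T} {F : T ⥤ A} [F.CommShift ℤ] [F.IsHomological]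

lemma IsUniversalExact.exists_iso (hF : IsUniversalExact I F)
    (hI : IsStableHomologicalIdeal.{u₁, v₁, u₃, v₃} I) {P Q : T} (hP : IsIdealProjective I P)
    (hQ : IsIdealProjective I Q) (i : F.obj P ≅ F.obj Q) : ∃ i' : P ≅ Q, F.map i'.hom = i.hom := by
  obtain ⟨a, ha⟩ := (hF.map_bijective hI hP Q).2 i.hom
  obtain ⟨b, hb⟩ := (hF.map_bijective hI hQ P).2 i.inv
  dsimp at ha hb
  exact ⟨⟨a, b, (hF.map_bijective hI hP P).1 (by simp [ha, hb]),
    (hF.map_bijective hI hQ Q).1 (by simp [ha, hb])⟩, ha⟩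

/-- The isomorphism `F (Q̂ ⊞ R̂) ≅ Q ⊞ R`. -/
noncomputable def AdjointObj.biprodIso {Q R : A} (Q' : AdjointObj F Q) (R' : AdjointObj F R)
    [IsIso Q'.unit] [IsIso R'.unit] : F.obj (Q'.obj ⊞ R'.obj) ≅ Q ⊞ R :=
  mapBiprodIso F (asIso Q'.unit).symm (asIso R'.unit).symm

lemma AdjointObj.map_map_inv_unit {Q R : A} (Q' : AdjointObj F Q) (R' : AdjointObj F R)
    [IsIso Q'.unit] [IsIso R'.unit] (f : Q ⟶ R) :
    F.map (Q'.map R' f) ≫ (asIso R'.unit).symm.hom = (asIso Q'.unit).symm.hom ≫ f := by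
  rw [← cancel_epi Q'.unit, reassoc_of% Q'.unit_map R' f]
  simp

variable {M₁ M₀ M₁' M₀' : A} (S : TwoStepExtension M₁ M₀) (S' : TwoStepExtension M₁' M₀')
  (E : ParityDecomposition A)
  (Qh₁ : AdjointObj F S.Q₁) (Qh₀ : AdjointObj F S.Q₀) (Qh₁' : AdjointObj F S'.Q₁)
  (Qh₀' : AdjointObj F S'.Q₀) [IsIso Qh₁.unit] [IsIso Qh₀.unit] [IsIso Qh₁'.unit]
  [IsIso Qh₀'.unit]

lemma map_biprod_map_id_right :
    F.map (biprod.map (Qh₁.map Qh₀ S.d₁) (𝟙 Qh₀'.obj)) ≫ (Qh₀.biprodIso Qh₀').hom =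
      (Qh₁.biprodIso Qh₀').hom ≫ biprod.map S.d₁ (𝟙 S'.Q₀) :=
  mapBiprodIso_map F _ _ _ _ (Qh₁.map_map_inv_unit Qh₀ S.d₁) (by simp)

lemma map_biprod_map_id_left :
    F.map (biprod.map (𝟙 Qh₀.obj) (Qh₁'.map Qh₀' S'.d₁)) ≫ (Qh₀.biprodIso Qh₀').hom =
      (Qh₀.biprodIso Qh₁').hom ≫ biprod.map (𝟙 S.Q₀) S'.d₁ :=
  mapBiprodIso_map F _ _ _ _ (by simp) (Qh₁'.map_map_inv_unit Qh₀' S'.d₁)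

variable [IsTriangulated T] {X X' : T} {p : Qh₀.obj ⟶ X} {r : X ⟶ Qh₁.obj⟦(1 : ℤ)⟧}
  {p' : Qh₀'.obj ⟶ X'} {r' : X' ⟶ Qh₁'.obj⟦(1 : ℤ)⟧}

/-- Since `F` is bijective on morphisms between these `I`-projective objects, the square lifts to
`T`, and the rows of the lifted square have cones `X` and `X'`. -/
lemma nonempty_iso_of_square
    (hX : Triangle.mk (Qh₁.map Qh₀ S.d₁) p r ∈ distTriang T)
    (hX' : Triangle.mk (Qh₁'.map Qh₀' S'.d₁) p' r' ∈ distTriang T)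
    (hF : IsUniversalExact I F)
    (hI : IsStableHomologicalIdeal.{u₁, v₁, u₃, v₃} I)
    (f₂ : S.Q₁ ⊞ S'.Q₀ ≅ S.Q₀ ⊞ S'.Q₁) (f₃ : S.Q₀ ⊞ S'.Q₀ ≅ S.Q₀ ⊞ S'.Q₀)
    (w : biprod.map S.d₁ (𝟙 S'.Q₀) ≫ f₃.hom = f₂.hom ≫ biprod.map (𝟙 S.Q₀) S'.d₁) :
    Nonempty (X ≅ X') := by
  have h₁ := Qh₁.isIdealProjective hF.exact
  have h₀ := Qh₀.isIdealProjective hF.exact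
  have h₁' := Qh₁'.isIdealProjective hF.exact
  have h₀' := Qh₀'.isIdealProjective hF.exact
  obtain ⟨g₂, hg₂⟩ := hF.exists_iso hI (h₁.biprod h₀') (h₀.biprod h₁')
    (Qh₁.biprodIso Qh₀' ≪≫ f₂ ≪≫ (Qh₀.biprodIso Qh₁').symm)
  obtain ⟨g₃, hg₃⟩ := hF.exists_iso hI (h₀.biprod h₀') (h₀.biprod h₀')
    (Qh₀.biprodIso Qh₀' ≪≫ f₃ ≪≫ (Qh₀.biprodIso Qh₀').symm)
  obtain ⟨_, hΔ⟩ := exists_cone_map_id_right hX Qh₀'.obj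
  obtain ⟨_, hΔ'⟩ := exists_cone_map_id_left hX' Qh₀.obj
  refine nonempty_cone_iso hΔ hΔ' g₂ g₃ ((hF.map_bijective hI (h₁.biprod h₀') _).1 ?_)
  change F.map _ = F.map _
  rw [← cancel_mono (Qh₀.biprodIso Qh₀').hom, F.map_comp, F.map_comp, Category.assoc,
    Category.assoc, map_biprod_map_id_left, hg₂, hg₃]
  simp [reassoc_of% map_biprod_map_id_right S S' Qh₁ Qh₀ Qh₀', w]

/-- Parity makes the first summand invariant, which defines `f₄`; Schanuel's lemma gives `f₃` above
it. The lift of `f₃` is compatible with `h` because `F` detects morphisms out of `I`-projective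
objects. Completing to triangles gives `f₂`, and kernels give `f₁`. -/
lemma exists_square_of_iso [Projective M₁] [Projective M₁'] [Projective S.Q₀] [Projective S'.Q₀]
    (hX : Triangle.mk (Qh₁.map Qh₀ S.d₁) p r ∈ distTriang T)
    (hX' : Triangle.mk (Qh₁'.map Qh₀' S'.d₁) p' r' ∈ distTriang T)
    (hM₁ : E.even M₁) (hM₁' : E.even M₁') (hQ₀ : E.even S.Q₀) (hQ₀' : E.even S'.Q₀)
    (hF : IsUniversalExact I F) (hI : IsStableHomologicalIdeal.{u₁, v₁, u₃, v₃} I) (h : X ≅ X') :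
    ∃ (f₁ : M₁ ≅ M₁') (f₂ : S.Q₁ ⊞ S'.Q₀ ≅ S.Q₀ ⊞ S'.Q₁)
      (f₃ : S.Q₀ ⊞ S'.Q₀ ≅ S.Q₀ ⊞ S'.Q₀) (f₄ : M₀ ≅ M₀'),
      (S.d₂ ≫ biprod.inl) ≫ f₂.hom = f₁.hom ≫ (S'.d₂ ≫ biprod.inr) ∧
      biprod.map S.d₁ (𝟙 S'.Q₀) ≫ f₃.hom = f₂.hom ≫ biprod.map (𝟙 S.Q₀) S'.d₁ ∧
      (biprod.fst ≫ S.ε) ≫ f₄.hom = f₃.hom ≫ (biprod.snd ≫ S'.ε) := by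
  have := S.epi_ε
  have := S'.epi_ε
  obtain ⟨e, he, -⟩ := existsUnique_isConeSplitting S Qh₁ Qh₀ E hM₁ hQ₀ hX
  obtain ⟨e', he', -⟩ := existsUnique_isConeSplitting S' Qh₁' Qh₀' E hM₁' hQ₀' hX'
  have hM₀ : E.even M₀ := E.even_of_epi S.ε hQ₀
  have hM₀' : E.even M₀' := E.even_of_epi S'.ε hQ₀'
  have hdiag : ∀ {N N' L L' : A} (_ : E.even N) (_ : E.odd L') (k : N ⊞ L ⟶ N' ⊞ L'),
      biprod.inl ≫ k = (biprod.inl ≫ k ≫ biprod.fst) ≫ biprod.inl := by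
    intro N N' L L' hN hL' k
    apply biprod.hom_ext
    · simp
    · exact (E.even_odd_zero hN hL' _).trans (E.even_odd_zero hN hL' _).symm
  have h₁ := hdiag hM₀ (E.odd_shift hM₁') (e.inv ≫ F.map h.hom ≫ e'.hom)
  have h₂ := hdiag hM₀' (E.odd_shift hM₁) (e'.inv ≫ F.map h.inv ≫ e.hom)
  let f₄ : M₀ ≅ M₀' :=
    { hom := biprod.inl ≫ (e.inv ≫ F.map h.hom ≫ e'.hom) ≫ biprod.fst
      inv := biprod.inl ≫ (e'.inv ≫ F.map h.inv ≫ e.hom) ≫ biprod.fst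
      hom_inv_id := by
        simp only [Category.assoc] at h₁ ⊢
        rw [← reassoc_of% h₁]
        simp [← F.map_comp_assoc]
      inv_hom_id := by
        simp only [Category.assoc] at h₂ ⊢
        rw [← reassoc_of% h₂]
        simp [← F.map_comp_assoc] }
  have hf₄ : biprod.inl ≫ e.inv ≫ F.map h.hom ≫ e'.hom = f₄.hom ≫ biprod.inl := h₁
  obtain ⟨f₃, hf₃⟩ := exists_schanuel_iso S.ε S'.ε f₄
  have hP₀ := Qh₀.isIdealProjective hF.exact
  have hP₀' := Qh₀'.isIdealProjective hF.exact
  obtain ⟨g₃, hg₃⟩ := hF.exists_iso hI (hP₀.biprod hP₀') (hP₀.biprod hP₀')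
    (Qh₀.biprodIso Qh₀' ≪≫ f₃ ≪≫ (Qh₀.biprodIso Qh₀').symm)
  have hfst : (Qh₀.biprodIso Qh₀').inv ≫ F.map biprod.fst = biprod.fst ≫ Qh₀.unit := by
    rw [Iso.inv_comp_eq]
    simp [AdjointObj.biprodIso, mapBiprodIso]
  have hsnd : (Qh₀.biprodIso Qh₀').inv ≫ F.map biprod.snd = biprod.snd ≫ Qh₀'.unit := by
    rw [Iso.inv_comp_eq]
    simp [AdjointObj.biprodIso, mapBiprodIso]
  obtain ⟨_, hΔ⟩ := exists_cone_map_id_right hX Qh₀'.obj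
  obtain ⟨_, hΔ'⟩ := exists_cone_map_id_left hX' Qh₀.obj
  obtain ⟨g₂, hg₂⟩ := exists_fibre_iso hΔ hΔ' g₃ h (by
    apply (hF.map_bijective hI (hP₀.biprod hP₀') _).1
    change F.map _ = F.map _
    rw [← cancel_epi (Qh₀.biprodIso Qh₀').inv, ← cancel_mono e'.hom]
    have hp : Qh₀.unit ≫ F.map p = S.ε ≫ biprod.inl ≫ e.inv := by
      rw [← cancel_mono e.hom]
      simp [he.1]
    simp only [F.map_comp, Category.assoc, hg₃, Iso.trans_hom, Iso.symm_hom,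
      Iso.inv_hom_id_assoc]
    rw [reassoc_of% hfst, reassoc_of% hsnd, reassoc_of% hp, hf₄, he'.1]
    simpa using hf₃ =≫ biprod.inl)
  let f₂ : S.Q₁ ⊞ S'.Q₀ ≅ S.Q₀ ⊞ S'.Q₁ :=
    (Qh₁.biprodIso Qh₀').symm ≪≫ F.mapIso g₂ ≪≫ Qh₀.biprodIso Qh₁'
  have hf₂ : biprod.map S.d₁ (𝟙 S'.Q₀) ≫ f₃.hom = f₂.hom ≫ biprod.map (𝟙 S.Q₀) S'.d₁ := by
    have := F.congr_map hg₂
    rw [F.map_comp, F.map_comp, hg₃] at this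
    rw [← cancel_epi (Qh₁.biprodIso Qh₀').hom,
      ← reassoc_of% map_biprod_map_id_right S S' Qh₁ Qh₀ Qh₀']
    simp only [f₂, Iso.trans_hom, Iso.symm_hom, Category.assoc, Iso.hom_inv_id_assoc,
      Functor.mapIso_hom]
    rw [← map_biprod_map_id_left S S' Qh₀ Qh₁' Qh₀', ← reassoc_of% this]
    simp
  obtain ⟨f₁, hf₁⟩ := S.exists_kernel_iso S' f₂ f₃ hf₂
  exact ⟨f₁, f₂, f₃, f₄, hf₁, hf₂, hf₃⟩

end Cone
end ObstructionClass

/-! ### The theorem -/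

open ObstructionClass in
theorem mainTheorem4
    -- the triangulated category, with countable direct sums
    {T : Type u₁} [Category.{v₁} T] [HasZeroObject T] [HasShift T ℤ] [Preadditive T]
    [∀ n : ℤ, (shiftFunctor T n).Additive] [Pretriangulated T] [IsTriangulated T]
    [HasCountableCoproducts T]
    -- the stable homological ideal
    (I : MorphismProperty T) (hI : IsStableHomologicalIdeal.{u₁, v₁, u₃, v₃} I)
    (hIsum : CompatibleWithCountableSums I) (hIproj : HasEnoughIdealProjectives I)
    -- the universal exact stable homological functor to an even stable Abelian category
    {A : Type u₂} [Category.{v₂} A] [Abelian A] [HasShift A ℤ]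
    [∀ n : ℤ, (shiftFunctor A n).Additive] [HasExt.{w} A]
    (F : T ⥤ A) [F.CommShift ℤ] [F.IsHomological] (hF : IsUniversalExact I F)
    (E : ParityDecomposition A)
    -- the exact complex of even objects
    {M₁ M₀ : A} (S : TwoStepExtension M₁ M₀)
    (hM₁ : Projective M₁) (hQ₁ : Projective S.Q₁) (hQ₀ : Projective S.Q₀)
    (hM₁e : E.even M₁) (hQ₁e : E.even S.Q₁) (hQ₀e : E.even S.Q₀)
    -- the cone `X` of the lifted map
    (Qh₁ : AdjointObj F S.Q₁) (Qh₀ : AdjointObj F S.Q₀)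
    {X : T} (p : Qh₀.obj ⟶ X) (r : X ⟶ Qh₁.obj⟦(1 : ℤ)⟧)
    (hX : Triangle.mk (Qh₁.map Qh₀ S.d₁) p r ∈ distTriang T) :
    -- the obstruction class of `X`
    (∃ hX' : IsLeftOrthogonal I X,
      (∃! e : F.obj X ≅ M₀ ⊞ M₁⟦(1 : ℤ)⟧, IsConeSplitting F S Qh₁ Qh₀ p r e) ∧
      ∀ e : F.obj X ≅ M₀ ⊞ M₁⟦(1 : ℤ)⟧, IsConeSplitting F S Qh₁ Qh₀ p r e →
        ∀ c : Ext (F.obj X) ((F.obj X)⟦(-1 : ℤ)⟧) 2,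
          IsObstructionClass E I F ⟨X, hX', Iso.refl _⟩ c ↔
            extFourSummands e c = ((0, S.extClass), (0, 0))) ∧
    -- the isomorphism criterion
    (∀ {M₁' M₀' : A} (S' : TwoStepExtension M₁' M₀'),
      Projective M₁' → Projective S'.Q₁ → Projective S'.Q₀ →
      E.even M₁' → E.even S'.Q₁ → E.even S'.Q₀ →
      ∀ (Qh₁' : AdjointObj F S'.Q₁) (Qh₀' : AdjointObj F S'.Q₀)
        {X' : T} (p' : Qh₀'.obj ⟶ X') (r' : X' ⟶ Qh₁'.obj⟦(1 : ℤ)⟧),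
        Triangle.mk (Qh₁'.map Qh₀' S'.d₁) p' r' ∈ distTriang T →
        (Nonempty (X ≅ X') ↔
          ∃ (f₁ : M₁ ≅ M₁') (f₂ : S.Q₁ ⊞ S'.Q₀ ≅ S.Q₀ ⊞ S'.Q₁)
            (f₃ : S.Q₀ ⊞ S'.Q₀ ≅ S.Q₀ ⊞ S'.Q₀) (f₄ : M₀ ≅ M₀'),
            (S.d₂ ≫ biprod.inl) ≫ f₂.hom = f₁.hom ≫ (S'.d₂ ≫ biprod.inr) ∧
            biprod.map S.d₁ (𝟙 S'.Q₀) ≫ f₃.hom = f₂.hom ≫ biprod.map (𝟙 S.Q₀) S'.d₁ ∧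
            (biprod.fst ≫ S.ε) ≫ f₄.hom = f₃.hom ≫ (biprod.snd ≫ S'.ε))) := by
  have := Qh₁.isIso_unit hF hI hIproj
  have := Qh₀.isIso_unit hF hI hIproj
  refine ⟨?_, ?_⟩
  · obtain ⟨Mh⟩ := hF.exists_adjointObj hI hIproj M₁
    have := Mh.isIso_unit hF hI hIproj
    have hX' : IsLeftOrthogonal I X := IsLeftOrthogonal.cone hI _ hX
      (Qh₁.isIdealProjective hF.exact).isLeftOrthogonal
      (Qh₀.isIdealProjective hF.exact).isLeftOrthogonal
    refine ⟨hX', existsUnique_isConeSplitting S Qh₁ Qh₀ E hM₁e hQ₀e hX, fun e he c => ?_⟩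
    obtain ⟨L₀, hcan, hrel, huniv⟩ :=
      exists_obstructionClass_cone S E hF hI hM₁e hQ₀e Mh Qh₁ Qh₀ hX hX' he
    constructor
    · rintro ⟨L, hL, hc⟩
      obtain ⟨u, hu⟩ := huniv L hL
      -- Naturality is applied over the identity of `F X`, with `u` comparing the constructed
      -- canonical lifting with the arbitrary one, so the two classes coincide.
      have h := hc.naturality hF hI hIproj hrel (𝟙 _) (𝟙 _) (by simp) u (by simpa using hu)
      rw [CategoryTheory.Functor.map_id, Ext.comp_mk₀_id, Ext.mk₀_id_comp] at h
      rw [← h, extFourSummands_apply]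
    · intro h
      -- A class with the prescribed components is the one already realised by `L₀`.
      obtain rfl := (extFourSummands e).injective (h.trans (extFourSummands_apply e _).symm)
      exact ⟨L₀, hcan, hrel⟩
  · intro M₁' M₀' S' hM₁' hQ₁' hQ₀' hM₁e' hQ₁e' hQ₀e' Qh₁' Qh₀' X' p' r' hX'
    have := Qh₁'.isIso_unit hF hI hIproj
    have := Qh₀'.isIso_unit hF hI hIproj
    constructor
    · rintro ⟨h⟩
      exact exists_square_of_iso S S' E Qh₁ Qh₀ Qh₁' Qh₀' hX hX' hM₁e hM₁e' hQ₀e hQ₀e' hF hI h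
    · rintro ⟨-, f₂, f₃, -, -, w, -⟩
      exact nonempty_iso_of_square S S' Qh₁ Qh₀ Qh₁' Qh₀' hX hX' hF hI f₂ f₃ w
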